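/- Let $\lambda>0$, let $\mathcal Y\subset\mathbb R^d$ be compact, and let $\ell:\mathbb R^d\times\mathcal Y\to[0,\infty)$ be real analytic with $\ell(x,y)\le A+B|x|^2$ for some constants $A,B>0$. Let $\mu_0$ be a compactly supported Borel probability measure on $\mathbb R^d\times\mathcal Y$. Consider maps $v:\mathbb R^d\times\mathbb R^m\to\mathbb R^d$ that are real analytic and for which there are $p\in[0,2)$ and constants $C_j>0$ with $$|\partial_x^i\partial_\theta^j v(x,\theta)|\le C_j\,|\theta|^{(p-j)_+}\bigl(1+|x|^{(1-i)_+}\bigr)\qquad(i\in\{0,1,2\},\ j\in\mathbb Z_{\ge0}),$$ where $(s)_+=\max\{s,0\}$, $0^0=1$, and partial derivatives are measured in operator norm. Let $(\Omega,\mathcal F,\mathbb P)$ be a probability space. For a curve $\eta=(\eta_t)_{t\in(0,1)}$ of probability measures on $\mathbb R^m$ with $\int_0^1\!\int|\theta|^2\,d\eta_t\,dt<\infty$ put $$J(\eta)=\int \ell\,d\mu_1^\eta+\frac\lambda2\int_0^1\!\int_{\mathbb R^m}|\theta|^2\,d\eta_t(\theta)\,dt,$$ where $\mu^\eta\in C([0,1];\mathcal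 P(\mathbb R^d\times\mathcal Y))$ (narrow topology) is the distributional solution of $\partial_t\mu_t+\mathrm{div}_x\bigl(\mu_t\int v(x,\theta)\,d\eta_t(\theta)\bigr)=0$ on $(0,1)\times\mathbb R^d\times\mathcal Y$ with initial value $\mu_0$. Let $\widetilde J(\Theta)=J\bigl((\mathrm{Law}\,\Theta_t)_t\bigr)$ for $\Theta\in H:=L^2(0,1;L^2(\Omega;\mathbb R^m))$. A bounded linear operator $\mathcal A$ on $H$ is called the Hessian of $\widetilde J$ at $\Theta$ if $\widetilde J$ is Fréchet differentiable near $\Theta$ and $\lim_{\varepsilon\to0}\varepsilon^{-1}\bigl(\nabla\widetilde J(\Theta+\varepsilon\Phi)-\nabla\widetilde J(\Theta)\bigr)=\mathcal A\Phi$ in $H$ for every $\Phi\in H$. Then for every $\Theta\in H$ the Hessian $\mathrm{Hess}\,\widetilde J(\Theta)$ exists as a bounded linear operator $H\to H$. Moreover, it is a Fredholm operator when $C_2$ is small: for all $B_0,R$ there is a constant $c>0$, depending only on $d,\mathcal Y,\ell,\mu_0,\lambda,B_0,R$ (and not on $m$, $v$, $p$, the $C_j$, $\Omega$ or $\Theta$),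 such that if $C_0\le B_0$ and $C_2<c$, then $\mathrm{Hess}\,\widetilde J(\Theta)$ is Fredholm for every $\Theta\in H$ with $\|\Theta\|_H\le R$. -/

import Mathlib

open MeasureTheory Set Filter Topology

noncomputable section

/-- The Euclidean space `ℝⁿ`. -/
abbrev Eucl (n : ℕ) : Type := EuclideanSpace ℝ (Fin n)

/-- The space `L²(Ω; ℝᵐ)` of square integrable random vectors on `(Ω, P)`. -/
abbrev RandVec {Ω : Type*} [MeasurableSpace Ω] (P : Measure Ω) (m : ℕ) : Type _ :=
  Lp (Eucl m) 2 P

/-- The Hilbert space `L²(0,1; L²(Ω; ℝᵐ))` (a Bochner space). -/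
abbrev ParamSpace {Ω : Type*} [MeasurableSpace Ω] (P : Measure Ω) (m : ℕ) : Type _ :=
  Lp (RandVec P m) 2 (volume.restrict (Ioo (0 : ℝ) 1))

/-- The averaged velocity field `v_η(x) = ∫ v(x, θ) dη(θ)`. -/
def meanField {d m : ℕ} (v : Eucl d → Eucl m → Eucl d) (η : Measure (Eucl m)) (x : Eucl d) :
    Eucl d :=
  ∫ θ, v x θ ∂η

/-- `μ` (restricted to times in `[0,1]`) is a distributional solution of the continuity equation
`∂ₜ μₜ + div_x (μₜ v_{ηₜ}(x)) = 0` on `(0,1) × ℝᵈ × Y` with initial value `μ₀`: a narrowly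
continuous curve of Borel probability measures carried by `ℝᵈ × Y`, starting at `μ₀`, such that
`∫₀¹ ∫ (∂ₜ φ + ∇ₓ φ · v_{ηₜ}(x)) dμₜ(x,y) dt = 0` for all test functions `φ(t, (x, y))` that are
smooth with compact support in `(0,1) × ℝᵈ × ℝᵈ`. -/
structure IsContinuityEqSolution {d m : ℕ} (Y : Set (Eucl d)) (v : Eucl d → Eucl m → Eucl d)
    (μ₀ : ProbabilityMeasure (Eucl d × Eucl d)) (η : ℝ → Measure (Eucl m))
    (μ : ℝ → ProbabilityMeasure (Eucl d × Eucl d)) : Prop where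
  continuousOn : ContinuousOn μ (Icc 0 1)
  carried : ∀ t ∈ Icc (0 : ℝ) 1, (μ t : Measure (Eucl d × Eucl d)) (univ ×ˢ Y)ᶜ = 0
  initial : μ 0 = μ₀
  weak_eq : ∀ φ : ℝ × (Eucl d × Eucl d) → ℝ, ContDiff ℝ (⊤ : ℕ∞) φ → HasCompactSupport φ →
    tsupport φ ⊆ Ioo (0 : ℝ) 1 ×ˢ univ →
    ∫ t in Ioo (0 : ℝ) 1, ∫ z, (fderiv ℝ φ (t, z) (1, (0, 0))
      + fderiv ℝ φ (t, z) (0, (meanField v (η t) z.1, 0)))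
        ∂(μ t : Measure (Eucl d × Eucl d)) = 0

open Classical in
/-- The loss `L(η) = ∫ ℓ dμ₁^η`, where `μ^η` is the distributional solution of the continuity
equation driven by `η` (the value is a default where there is no solution). -/
def lossFunctional {d m : ℕ} (Y : Set (Eucl d)) (v : Eucl d → Eucl m → Eucl d)
    (l : Eucl d → Eucl d → ℝ) (μ₀ : ProbabilityMeasure (Eucl d × Eucl d))
    (η : ℝ → Measure (Eucl m)) : ℝ :=
  if h : ∃ μ, IsContinuityEqSolution Y v μ₀ η μ then
    ∫ z, l z.1 z.2 ∂(h.choose 1 : Measure (Eucl d × Eucl d))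
  else 0

/-- The objective `J(η) = L(η) + (lam / 2) ∫₀¹ ∫ |θ|² dηₜ(θ) dt`. -/
def objective {d m : ℕ} (Y : Set (Eucl d)) (v : Eucl d → Eucl m → Eucl d)
    (l : Eucl d → Eucl d → ℝ) (μ₀ : ProbabilityMeasure (Eucl d × Eucl d)) (lam : ℝ)
    (η : ℝ → Measure (Eucl m)) : ℝ :=
  lossFunctional Y v l μ₀ η + lam / 2 * ∫ t in Ioo (0 : ℝ) 1, ∫ θ, ‖θ‖ ^ 2 ∂(η t)

/-- The curve of laws `t ↦ Law Θₜ`. -/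
def lawCurve {Ω : Type*} [MeasurableSpace Ω] {P : Measure Ω} {m : ℕ} (Θ : ParamSpace P m) :
    ℝ → Measure (Eucl m) :=
  fun t => P.map (Θ t : RandVec P m)

/-- The lifted objective `J̃(Θ) = J(Law Θ)` on `L²(0,1; L²(Ω; ℝᵐ))`. -/
def liftedObjective {d m : ℕ} (Y : Set (Eucl d)) (v : Eucl d → Eucl m → Eucl d)
    (l : Eucl d → Eucl d → ℝ) (μ₀ : ProbabilityMeasure (Eucl d × Eucl d)) (lam : ℝ)
    {Ω : Type*} [MeasurableSpace Ω] (P : Measure Ω) (Θ : ParamSpace P m) : ℝ :=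
  objective Y v l μ₀ lam (lawCurve Θ)

/-- Admissible loss functions `ℓ : ℝᵈ × Y → [0,∞)`: real analytic, of at most quadratic growth in
`x`. Only the values on `ℝᵈ × Y` matter. -/
structure IsAdmissibleLoss {d : ℕ} (Y : Set (Eucl d)) (l : Eucl d → Eucl d → ℝ) : Prop where
  analytic : AnalyticOn ℝ (fun z : Eucl d × Eucl d => l z.1 z.2) (univ ×ˢ Y)
  nonneg : ∀ x, ∀ y ∈ Y, 0 ≤ l x y
  growth : ∃ A > 0, ∃ B > 0, ∀ x, ∀ y ∈ Y, l x y ≤ A + B * ‖x‖ ^ 2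

/-- The neural network `v` is real analytic and, for `i ∈ {0,1,2}` and all `j`, satisfies
`|∂ₓⁱ ∂_θʲ v(x,θ)| ≤ C_j |θ|^{(p-j)₊} (1 + |x|^{(1-i)₊})`, with operator norms of the partial
Fréchet derivatives. Here `1 - i` is truncated, so that it is `(1-i)₊`, and `0 ^ 0 = 1`. -/
structure HasBoundedDerivatives {d m : ℕ} (v : Eucl d → Eucl m → Eucl d) (p : ℝ) (C : ℕ → ℝ) :
    Prop where
  analytic : AnalyticOnNhd ℝ (fun z : Eucl d × Eucl m => v z.1 z.2) univ
  p_nonneg : 0 ≤ p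
  p_lt_two : p < 2
  C_pos : ∀ j, 0 < C j
  bound : ∀ i ∈ ({0, 1, 2} : Set ℕ), ∀ (j : ℕ) (x : Eucl d) (θ : Eucl m),
    ‖iteratedFDeriv ℝ i (fun x' => iteratedFDeriv ℝ j (fun θ' => v x' θ') θ) x‖
      ≤ C j * ‖θ‖ ^ max (p - j) 0 * (1 + ‖x‖ ^ (1 - i))

/-- The bounded linear operator `A` is the Hessian of `F` at `x`: `F` is Fréchet differentiable
near `x` and `A h` is the derivative at `ε = 0` of the gradient `∇F(x + ε h)`, in norm,
for each direction `h`. -/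
def HasHessianAt {H : Type*} [NormedAddCommGroup H] [InnerProductSpace ℝ H] [CompleteSpace H]
    (F : H → ℝ) (A : H →L[ℝ] H) (x : H) : Prop :=
  (∀ᶠ y in 𝓝 x, DifferentiableAt ℝ F y) ∧ ∀ h : H, HasLineDerivAt ℝ (gradient F) (A h) x h

end

/-! View `Θ` as a square integrable function `Ψ` on `(0,1) × Ω`. The continuity equation determines
its solution at time one: it is the image of `μ₀` under the flow `X_t = x + ∫_{s ≤ t} v(X_s, Ψ(s,
ω)) dP ds`. Hence the lifted objective is the `μ₀`-average of `ℓ(X_1, y)` plus `(lam / 2) ‖Θ‖²`, and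
everything reduces to differentiating an integral equation with respect to its control.

Linearising gives the derivative `Ξ Φ = (1 - T)⁻¹ ∫_{s ≤ t} v_θ Φ`, where `T` is the Volterra
operator with kernel `v_x` along the trajectory. Gronwall's inequality with an `L¹` kernel inverts
`1 - T` without any smallness. The bounds on `v` match the spaces: `v` and its `x`-derivatives grow
like `|θ|²` and act in `L¹`, `v_θ` and the mixed derivatives grow like `|θ|` and act in `L²`, and
`v_θθ` is bounded in `θ` and acts in `L^∞`. This makes the flow Fréchet differentiable from `L²` to
continuous paths. The gradient is differentiated only along lines, by dominated convergence, which
is what the notion of Hessian asks for.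

The Hessian has the form `lam + N + K`. Each term of `K` contains `Ξ` in at least one of its two
arguments. The operator `Ξ` integrates in time against a fixed `L²` kernel with values in a
finite-dimensional space, so it is a norm limit of finite rank operators, and so is `K`. The
remaining term `N` comes from `v_θθ`, pairs the adjoint state with `v_θθ Φ Ψ`, and acts by pointwise
multiplication, so no compactness is available for it; but its norm is at most `C 2` times a
constant that depends only on `ℓ`, `μ₀`, `C 0` and `‖Θ‖`. If `‖N‖ < lam`, then `lam + N` is
invertible by a Neumann series, and the addition of `K` leaves a Fredholm operator.

The main steps are `VJet.hasFDerivAt_flow`, `VJet.hasDerivAt_dterm`,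
`VJet.hessCompact_mem_finiteRankClosure`, `VJet.exists_meanHessMul` and `exists_hasHessianAt`. The
link with the continuity equation is `TransportField.eq_of_initial_eq`, proved by an Euler scheme
acting on test functions. -/

noncomputable section

open scoped unitInterval ENNReal

set_option linter.unusedSectionVars false

/-! ### Space-time, trajectories and integration in time -/

section

variable {Ω : Type*} [MeasurableSpace Ω]

/-- The space-time measure on `ℝ × Ω`, carried by `(0,1) × Ω`. -/
abbrev stm (P : Measure Ω) : Measure (ℝ × Ω) := (volume.restrict (Ioo (0 : ℝ) 1)).prod P

instance isProbabilityMeasure_restrict_Ioo :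
    IsProbabilityMeasure (volume.restrict (Ioo (0 : ℝ) 1)) := ⟨by simp⟩

/-- The time coordinate, as a point of the unit interval. -/
def timeOf (q : ℝ × Ω) : I := projIcc 0 1 zero_le_one q.1

theorem measurable_timeOf : Measurable (timeOf : ℝ × Ω → I) :=
  continuous_projIcc.measurable.comp measurable_fst

theorem ae_fst_ne_stm (P : Measure Ω) [SFinite P] (t : ℝ) : ∀ᵐ q ∂(stm P), q.1 ≠ t := by
  have h : ∀ᵐ s ∂(volume.restrict (Ioo (0 : ℝ) 1)), s ≠ t :=
    ae_restrict_of_ae (Measure.ae_ne volume t)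
  exact (Measure.quasiMeasurePreserving_fst (μ := volume.restrict (Ioo (0 : ℝ) 1)) (ν := P)).ae h

theorem measurableSet_fst_le (t : ℝ) : MeasurableSet {q : ℝ × Ω | q.1 ≤ t} :=
  measurableSet_le measurable_fst measurable_const

/-- The Banach space of continuous trajectories `[0,1] → F`. -/
def Traj (F : Type*) [NormedAddCommGroup F] : Type _ := C(I, F)

namespace Traj

variable {F : Type*} [NormedAddCommGroup F]

instance : NormedAddCommGroup (Traj F) := inferInstanceAs (NormedAddCommGroup C(I, F))

instance [NormedSpace ℝ F] : NormedSpace ℝ (Traj F) := inferInstanceAs (NormedSpace ℝ C(I, F))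

instance [CompleteSpace F] : CompleteSpace (Traj F) := inferInstanceAs (CompleteSpace C(I, F))

instance : FunLike (Traj F) I F := inferInstanceAs (FunLike C(I, F) I F)

/-- The trajectory given by a continuous function. -/
def mk (f : I → F) (hf : Continuous f) : Traj F := (⟨f, hf⟩ : C(I, F))

/-- The constant trajectory. -/
def const (x : F) : Traj F := mk (fun _ => x) continuous_const

@[simp] theorem mk_apply (f : I → F) (hf : Continuous f) (t : I) : mk f hf t = f t := rfl

@[simp] theorem const_apply (x : F) (t : I) : const x t = x := rfl

@[simp] theorem add_apply (X Y : Traj F) (t : I) : (X + Y) t = X t + Y t := rfl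

@[simp] theorem sub_apply (X Y : Traj F) (t : I) : (X - Y) t = X t - Y t := rfl

@[simp] theorem smul_apply [NormedSpace ℝ F] (c : ℝ) (X : Traj F) (t : I) : (c • X) t = c • X t :=
  rfl

@[ext] theorem ext {X Y : Traj F} (h : ∀ t, X t = Y t) : X = Y := DFunLike.ext X Y h

@[fun_prop] theorem continuous (X : Traj F) : Continuous fun t => X t :=
  ContinuousMap.continuous (X : C(I, F))

theorem norm_coe_le_norm (X : Traj F) (t : I) : ‖X t‖ ≤ ‖X‖ :=
  ContinuousMap.norm_coe_le_norm (X : C(I, F)) t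

theorem norm_le (X : Traj F) {c : ℝ} (hc : 0 ≤ c) : ‖X‖ ≤ c ↔ ∀ t, ‖X t‖ ≤ c :=
  ContinuousMap.norm_le (X : C(I, F)) hc

/-- Evaluation at a time, as a continuous linear map. -/
def eval [NormedSpace ℝ F] (t : I) : Traj F →L[ℝ] F :=
  LinearMap.mkContinuous
    { toFun := fun X => X t, map_add' := fun _ _ => rfl, map_smul' := fun _ _ => rfl } 1
    (fun X => by rw [one_mul]; exact X.norm_coe_le_norm t)

@[simp] theorem eval_apply [NormedSpace ℝ F] (t : I) (X : Traj F) : eval t X = X t := rfl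

theorem continuous_eval [NormedSpace ℝ F] (t : I) : Continuous fun X : Traj F => X t :=
  (eval t).continuous

end Traj

section Cumul

variable {F : Type*} [NormedAddCommGroup F] [NormedSpace ℝ F]
variable (P : Measure Ω) [IsProbabilityMeasure P]

/-- Dominated convergence: for fixed `q` the indicator of `q.1 ≤ t` jumps only at `t = q.1`, and the
slice of space-time at a given time is null. -/
theorem continuous_cumul {g : ℝ × Ω → F} (hg : Integrable g (stm P)) :
    Continuous fun t : ℝ => ∫ q in {q | q.1 ≤ t}, g q ∂(stm P) := by
  have : (fun t : ℝ => ∫ q in {q : ℝ × Ω | q.1 ≤ t}, g q ∂(stm P)) =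
      fun t => ∫ q, {q : ℝ × Ω | q.1 ≤ t}.indicator g q ∂(stm P) := by
    ext t
    rw [integral_indicator (measurableSet_fst_le t)]
  rw [this, continuous_iff_continuousAt]
  intro t
  refine continuousAt_of_dominated (bound := fun q => ‖g q‖) ?_ ?_ hg.norm ?_
  · exact Eventually.of_forall fun s => hg.aestronglyMeasurable.indicator (measurableSet_fst_le s)
  · exact Eventually.of_forall fun s => Eventually.of_forall fun q =>
      norm_indicator_le_norm_self g q
  · filter_upwards [ae_fst_ne_stm P t] with q hq
    rcases lt_or_gt_of_ne hq with h | h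
    · have : (fun s : ℝ => {q : ℝ × Ω | q.1 ≤ s}.indicator g q) =ᶠ[𝓝 t] fun _ => g q := by
        filter_upwards [lt_mem_nhds h] with s hs
        rw [indicator_of_mem]
        exact hs.le
      exact continuousAt_const.congr this.symm
    · have : (fun s : ℝ => {q : ℝ × Ω | q.1 ≤ s}.indicator g q) =ᶠ[𝓝 t] fun _ => 0 := by
        filter_upwards [gt_mem_nhds h] with s hs
        rw [indicator_of_notMem]
        simpa using hs
      exact continuousAt_const.congr this.symm

/-- The primitive `t ↦ ∫_{s ≤ t} g(s, ω)` as a continuous linear operator `L¹ → C([0,1])`. -/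
def cumul : Lp F 1 (stm P) →L[ℝ] Traj F :=
  LinearMap.mkContinuous
    { toFun := fun g => Traj.mk (fun t => ∫ q in {q | q.1 ≤ (t : ℝ)}, g q ∂(stm P))
        ((continuous_cumul P (L1.integrable_coeFn g)).comp continuous_subtype_val)
      map_add' := fun f g => by
        ext t
        simp only [Traj.mk_apply, Traj.add_apply]
        rw [← integral_add (L1.integrable_coeFn f).integrableOn (L1.integrable_coeFn g).integrableOn]
        exact integral_congr_ae (ae_restrict_of_ae (Lp.coeFn_add f g))
      map_smul' := fun c g => by
        ext t
        simp only [Traj.mk_apply, Traj.smul_apply, RingHom.id_apply]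
        rw [← integral_smul]
        exact integral_congr_ae (ae_restrict_of_ae (Lp.coeFn_smul c g)) } 1
    (fun g => by
      rw [one_mul, Traj.norm_le _ (norm_nonneg _)]
      intro t
      simp only [LinearMap.coe_mk, AddHom.coe_mk, Traj.mk_apply]
      rw [L1.norm_eq_integral_norm]
      refine (norm_integral_le_integral_norm _).trans ?_
      exact setIntegral_le_integral (L1.integrable_coeFn g).norm
        (Eventually.of_forall fun _ => norm_nonneg _))

theorem cumul_apply (g : Lp F 1 (stm P)) (t : I) :
    cumul P g t = ∫ q in {q | q.1 ≤ (t : ℝ)}, g q ∂(stm P) := rfl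

theorem norm_cumul_le : ‖cumul (F := F) P‖ ≤ 1 :=
  LinearMap.mkContinuous_norm_le _ zero_le_one _

/-- `cumul` only depends on time averages. -/
theorem setIntegral_stm_eq {g : ℝ × Ω → F} (hg : Integrable g (stm P)) {t : ℝ}
    (ht : t ∈ Icc (0 : ℝ) 1) :
    ∫ q in {q | q.1 ≤ t}, g q ∂(stm P) = ∫ s in (0 : ℝ)..t, ∫ ω, g (s, ω) ∂P := by
  have h1 : {q : ℝ × Ω | q.1 ≤ t} = Iic t ×ˢ univ := by ext; simp
  rw [h1, setIntegral_prod _ hg.integrableOn, intervalIntegral.integral_of_le ht.1,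
    Measure.restrict_restrict measurableSet_Iic, Measure.restrict_univ]
  refine setIntegral_congr_set ?_
  have : (Ioc 0 t : Set ℝ) =ᵐ[volume] Ioo 0 t := Ioo_ae_eq_Ioc.symm
  refine EventuallyEq.trans ?_ this.symm
  -- The half-line meets the open interval `(0,1)` in `(0,t]` if `t < 1` and in `(0,1)` if `t = 1`.
  rcases ht.2.lt_or_eq with h | h
  · have : (Iic t ∩ Ioo (0 : ℝ) 1) = Ioc 0 t := by
      ext s; simp only [mem_inter_iff, mem_Iic, mem_Ioo, mem_Ioc]
      constructor
      · rintro ⟨a, b, c⟩; exact ⟨b, a⟩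
      · rintro ⟨a, b⟩; exact ⟨b, a, b.trans_lt h⟩
    rw [this]; assumption
  · have : (Iic t ∩ Ioo (0 : ℝ) 1) = Ioo 0 t := by
      ext s; simp only [mem_inter_iff, mem_Iic, mem_Ioo]
      constructor
      · rintro ⟨a, b, c⟩; exact ⟨b, h ▸ c⟩
      · rintro ⟨a, b⟩; exact ⟨b.le, a, h ▸ b⟩
    rw [this]
    exact EventuallyEq.rfl

end Cumul

/-! ### Gronwall's inequality and Picard iteration with an integrable kernel -/

section Gronwall

variable (P : Measure Ω) [IsProbabilityMeasure P]

/-- With `F` the primitive of `a`, the integrand is half the derivative of `exp (2F)`. As `a` is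
only integrable, `F` is only absolutely continuous, and the fundamental theorem is applied in that
class. The weight `exp (2F)` is chosen so that integration against `a` gains a factor `1/2`. -/
theorem setIntegral_mul_exp_cumul {a : ℝ × Ω → ℝ} (ha : Integrable a (stm P)) (t : I) :
    ∫ q in {q | q.1 ≤ (t : ℝ)},
        a q * Real.exp (2 * ∫ q' in {q' | q'.1 ≤ (timeOf q : ℝ)}, a q' ∂(stm P)) ∂(stm P) =
      (Real.exp (2 * ∫ q in {q | q.1 ≤ (t : ℝ)}, a q ∂(stm P)) - 1) / 2 := by
  set F : ℝ → ℝ := fun t => ∫ q in {q | q.1 ≤ t}, a q ∂(stm P) with hF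
  have hFc : Continuous F := continuous_cumul P ha
  set b : ℝ → ℝ := fun s => ∫ ω, a (s, ω) ∂P with hb
  have hbi : Integrable b (volume.restrict (Ioo (0 : ℝ) 1)) := ha.integral_prod_left
  have hbI : IntervalIntegrable b volume 0 1 := by
    rw [intervalIntegrable_iff_integrableOn_Ioo_of_le zero_le_one]; exact hbi
  have hFeq : ∀ t ∈ Icc (0 : ℝ) 1, F t = ∫ s in (0 : ℝ)..t, b s := fun t ht =>
    setIntegral_stm_eq P ha ht
  have hmeas : AEStronglyMeasurable (fun q : ℝ × Ω => Real.exp (2 * F (timeOf q))) (stm P) :=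
    ((Real.continuous_exp.comp (continuous_const.mul
      (hFc.comp continuous_subtype_val))).measurable.comp measurable_timeOf).aestronglyMeasurable
  have hbd : ∃ C, ∀ q : ℝ × Ω, ‖Real.exp (2 * F (timeOf q))‖ ≤ C := by
    obtain ⟨C, hC⟩ := (isCompact_univ (X := I)).exists_bound_of_continuousOn
      (f := fun t : I => Real.exp (2 * F t))
      (by fun_prop)
    exact ⟨C, fun q => hC _ (mem_univ _)⟩
  obtain ⟨C, hC⟩ := hbd
  have hint : Integrable (fun q => a q * Real.exp (2 * F (timeOf q))) (stm P) :=
    ha.mul_bdd (c := C) hmeas (Eventually.of_forall hC)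
  rw [setIntegral_stm_eq P hint t.2]
  have hG : AbsolutelyContinuousOnInterval (fun t => ∫ s in (0 : ℝ)..t, b s) 0 t := by
    refine IntervalIntegrable.absolutelyContinuousOnInterval_intervalIntegral ?_ (by simp)
    exact hbI.mono_set (by rw [uIcc_of_le t.2.1, uIcc_of_le zero_le_one]; exact Icc_subset_Icc_right t.2.2)
  set G : ℝ → ℝ := fun t => ∫ s in (0 : ℝ)..t, b s with hGdef
  -- The exponential is Lipschitz on the bounded range of `G`, and Lipschitz functions preserve
  -- absolute continuity.
  have hE : AbsolutelyContinuousOnInterval (fun s => Real.exp (2 * G s)) 0 t := by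
    obtain ⟨B, hB⟩ := hG.exists_bound
    have hlip : ∃ K : NNReal, LipschitzOnWith K (fun x : ℝ => Real.exp (2 * x)) (Icc (-B) B) := by
      have : ContDiffOn ℝ 1 (fun x : ℝ => Real.exp (2 * x)) (Icc (-B) B) := by fun_prop
      exact this.exists_lipschitzOnWith one_ne_zero (convex_Icc _ _) isCompact_Icc
    obtain ⟨K, hK⟩ := hlip
    rw [absolutelyContinuousOnInterval_iff] at hG ⊢
    intro ε hε
    obtain ⟨δ, hδ, h⟩ := hG (ε / (K + 1)) (by positivity)
    refine ⟨δ, hδ, fun E hE hlen => ?_⟩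
    have h2 := h E hE hlen
    have hmem : ∀ x ∈ uIcc (0 : ℝ) t, G x ∈ Icc (-B) B := fun x hx => abs_le.1 (hB x hx)
    calc _ ≤ ∑ i ∈ Finset.range E.1, K * dist (G (E.2 i).1) (G (E.2 i).2) := by
          refine Finset.sum_le_sum fun i hi => ?_
          have hm := hE.1 i hi
          exact hK.dist_le_mul _ (hmem _ hm.1) _ (hmem _ hm.2)
      _ = K * ∑ i ∈ Finset.range E.1, dist (G (E.2 i).1) (G (E.2 i).2) := by
          rw [Finset.mul_sum]
      _ ≤ K * (ε / (K + 1)) := by gcongr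
      _ < ε := by
          rw [← mul_div_assoc, div_lt_iff₀ (by positivity)]
          nlinarith [K.coe_nonneg]
  have hftc := hE.integral_deriv_eq_sub
  have hG0 : G 0 = 0 := by simp [hGdef]
  have hmain : ∫ s in (0 : ℝ)..t, ∫ ω, a (s, ω) * Real.exp (2 * F (timeOf (s, ω))) ∂P
      = ∫ s in (0 : ℝ)..t, (1 / 2) * deriv (fun s => Real.exp (2 * G s)) s := by
    refine intervalIntegral.integral_congr_ae ?_
    filter_upwards [hbI.ae_hasDerivAt_integral] with s hs hst
    rw [uIoc_of_le t.2.1] at hst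
    have hs01 : s ∈ Icc (0 : ℝ) 1 := ⟨hst.1.le, hst.2.trans t.2.2⟩
    have hd : HasDerivAt G (b s) s := hs (by rwa [uIcc_of_le zero_le_one]) 0 (by simp)
    have hts : ∀ ω : Ω, ((timeOf (s, ω) : I) : ℝ) = s := fun ω => by
      simp [timeOf, projIcc_of_mem zero_le_one hs01]
    simp_rw [hts]
    rw [integral_mul_const]
    rw [((hd.const_mul 2).exp).deriv, hFeq s hs01]
    ring
  rw [hmain, intervalIntegral.integral_const_mul, hftc, hG0]
  have : ∫ q in {q | q.1 ≤ (t : ℝ)}, a q ∂(stm P) = G t := hFeq t t.2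
  rw [this]
  simp
  ring


theorem integrable_mul_comp_timeOf {a : ℝ × Ω → ℝ} (ha : Integrable a (stm P)) {u : I → ℝ}
    (hu : Continuous u) : Integrable (fun q => a q * u (timeOf q)) (stm P) := by
  obtain ⟨C, hC⟩ := (isCompact_univ (X := I)).exists_bound_of_continuousOn hu.continuousOn
  exact ha.mul_bdd (c := C) (hu.measurable.comp measurable_timeOf).aestronglyMeasurable
    (Eventually.of_forall fun q => hC _ (mem_univ _))

/-- A function dominated by a weight `S e^{2F}` integrates to one dominated by `(S/2) e^{2F}`. -/
theorem setIntegral_mul_le_of_le_exp {a : ℝ × Ω → ℝ} (ha : Integrable a (stm P))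
    (ha0 : 0 ≤ᵐ[stm P] a) {u : I → ℝ} (hu : Continuous u) {S : ℝ} (hS : 0 ≤ S)
    (h : ∀ t : I, u t ≤ S * Real.exp (2 * ∫ q in {q | q.1 ≤ (t : ℝ)}, a q ∂(stm P))) (t : I) :
    ∫ q in {q | q.1 ≤ (t : ℝ)}, a q * u (timeOf q) ∂(stm P) ≤
      S / 2 * Real.exp (2 * ∫ q in {q | q.1 ≤ (t : ℝ)}, a q ∂(stm P)) := by
  have hFc : Continuous fun t : I => Real.exp (2 * ∫ q in {q | q.1 ≤ (t : ℝ)}, a q ∂(stm P)) :=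
    Real.continuous_exp.comp (continuous_const.mul
      ((continuous_cumul P ha).comp continuous_subtype_val))
  calc _ ≤ ∫ q in {q | q.1 ≤ (t : ℝ)}, S * (a q *
        Real.exp (2 * ∫ q' in {q' | q'.1 ≤ (timeOf q : ℝ)}, a q' ∂(stm P))) ∂(stm P) := by
        refine integral_mono_ae (integrable_mul_comp_timeOf P ha hu).integrableOn
          ((integrable_mul_comp_timeOf P ha hFc).const_mul S).integrableOn ?_
        filter_upwards [ae_restrict_of_ae ha0] with q hq
        have := mul_le_mul_of_nonneg_left (h (timeOf q)) (show 0 ≤ a q from hq)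
        linarith
    _ ≤ _ := by
        rw [integral_const_mul, setIntegral_mul_exp_cumul P ha]
        nlinarith

/-- Gronwall's inequality with an integrable kernel. -/
theorem gronwall_cumul {a : ℝ × Ω → ℝ} (ha : Integrable a (stm P)) (ha0 : 0 ≤ᵐ[stm P] a)
    {u : I → ℝ} (hu : Continuous u) (hu0 : ∀ t, 0 ≤ u t) {c A : ℝ} (hc : 0 ≤ c)
    (hA : ∫ q, a q ∂(stm P) ≤ A)
    (h : ∀ t : I, u t ≤ c + ∫ q in {q | q.1 ≤ (t : ℝ)}, a q * u (timeOf q) ∂(stm P)) (t : I) :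
    u t ≤ 2 * Real.exp (2 * A) * c := by
  set F : I → ℝ := fun t => ∫ q in {q | q.1 ≤ (t : ℝ)}, a q ∂(stm P) with hF
  have hFc : Continuous F := (continuous_cumul P ha).comp continuous_subtype_val
  have hF0 : ∀ t, 0 ≤ F t := fun t => integral_nonneg_of_ae (ae_restrict_of_ae ha0)
  have hFA : ∀ t, F t ≤ A := fun t => (setIntegral_le_integral ha ha0).trans hA
  obtain ⟨t₀, -, ht₀⟩ := (isCompact_univ (X := I)).exists_isMaxOn ⟨0, mem_univ _⟩
    (f := fun t => u t * Real.exp (-(2 * F t))) (by fun_prop)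
  -- `S` is the best constant in `u ≤ S exp (2F)`. Inserting this bound into the hypothesis at the
  -- maximum point gives `S ≤ c + S / 2`.
  set S := u t₀ * Real.exp (-(2 * F t₀)) with hSdef
  have hS0 : 0 ≤ S := mul_nonneg (hu0 _) (Real.exp_pos _).le
  have hS : ∀ t, u t ≤ S * Real.exp (2 * F t) := fun t => by
    have h1 : u t * Real.exp (-(2 * F t)) ≤ S := ht₀ (mem_univ t)
    have h2 := mul_le_mul_of_nonneg_right h1 (Real.exp_pos (2 * F t)).le
    rwa [mul_assoc, ← Real.exp_add, neg_add_cancel, Real.exp_zero, mul_one] at h2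
  have hSc : S ≤ 2 * c := by
    have h1 := (h t₀).trans (add_le_add_right
      (setIntegral_mul_le_of_le_exp P ha ha0 hu hS0 hS t₀) c)
    have h2 := mul_le_mul_of_nonneg_right h1 (Real.exp_pos (-(2 * F t₀))).le
    rw [add_mul, mul_assoc (S / 2), ← Real.exp_add] at h2
    have h3 : 2 * F t₀ + -(2 * F t₀) = 0 := by ring
    change S ≤ c * Real.exp (-(2 * F t₀)) + S / 2 * Real.exp (2 * F t₀ + -(2 * F t₀)) at h2
    rw [h3, Real.exp_zero] at h2
    have h4 : Real.exp (-(2 * F t₀)) ≤ 1 := Real.exp_le_one_iff.2 (by linarith [hF0 t₀])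
    nlinarith
  calc u t ≤ S * Real.exp (2 * F t) := hS t
    _ ≤ (2 * c) * Real.exp (2 * A) := by
        gcongr
        exact hFA t
    _ = _ := by ring

/-- Picard iteration for Volterra type maps with an integrable kernel. -/
theorem exists_fixedPoint_of_volterra {F : Type*} [NormedAddCommGroup F] [CompleteSpace F]
    {a : ℝ × Ω → ℝ} (ha : Integrable a (stm P)) (ha0 : 0 ≤ᵐ[stm P] a) (T : Traj F → Traj F)
    (hT : ∀ ξ η : Traj F, ∀ t : I, ‖T ξ t - T η t‖ ≤
      ∫ q in {q | q.1 ≤ (t : ℝ)}, a q * ‖ξ (timeOf q) - η (timeOf q)‖ ∂(stm P)) :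
    ∃ ξ, T ξ = ξ := by
  set Φ : I → ℝ := fun t => ∫ q in {q | q.1 ≤ (t : ℝ)}, a q ∂(stm P) with hΦ
  have hΦ0 : ∀ t, 0 ≤ Φ t := fun t => integral_nonneg_of_ae (ae_restrict_of_ae ha0)
  have hΦA : ∀ t, Φ t ≤ ∫ q, a q ∂(stm P) := fun t => setIntegral_le_integral ha ha0
  -- Each application of `T` gains `1/2` in the weight `exp (2Φ)`. In the sup norm the weight costs
  -- at most `exp (2A)` once, so some iterate of `T` is a contraction.
  have key : ∀ (n : ℕ) (ξ η : Traj F) (t : I), ‖(T^[n]) ξ t - (T^[n]) η t‖ ≤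
      (1 / 2) ^ n * ‖ξ - η‖ * Real.exp (2 * Φ t) := by
    intro n
    induction n with
    | zero =>
      intro ξ η t
      have h1 : ‖ξ t - η t‖ ≤ ‖ξ - η‖ := (ξ - η).norm_coe_le_norm t
      have h2 : 1 ≤ Real.exp (2 * Φ t) := Real.one_le_exp (by linarith [hΦ0 t])
      simp only [Function.iterate_zero, id_eq, pow_zero, one_mul]
      nlinarith [norm_nonneg (ξ - η)]
    | succ n ih =>
      intro ξ η t
      rw [Function.iterate_succ_apply', Function.iterate_succ_apply']
      refine (hT _ _ t).trans ?_
      refine (setIntegral_mul_le_of_le_exp P ha ha0 (u := fun t => ‖(T^[n]) ξ t - (T^[n]) η t‖)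
        (by fun_prop) (S := (1 / 2) ^ n * ‖ξ - η‖) (by positivity) (ih ξ η) t).trans_eq ?_
      rw [pow_succ]; ring
  set A := ∫ q, a q ∂(stm P)
  obtain ⟨n, hn⟩ : ∃ n : ℕ, (1 / 2 : ℝ) ^ n * Real.exp (2 * A) < 1 := by
    have := (tendsto_pow_atTop_nhds_zero_of_lt_one (r := (1 / 2 : ℝ)) (by norm_num)
      (by norm_num)).mul_const (Real.exp (2 * A))
    rw [zero_mul] at this
    exact (this.eventually (gt_mem_nhds one_pos)).exists
  have hK0 : 0 ≤ (1 / 2 : ℝ) ^ n * Real.exp (2 * A) := by positivity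
  have hcon : ContractingWith ⟨(1 / 2 : ℝ) ^ n * Real.exp (2 * A), hK0⟩ (T^[n]) := by
    refine ⟨by exact_mod_cast hn, LipschitzWith.of_dist_le_mul fun ξ η => ?_⟩
    rw [dist_eq_norm, dist_eq_norm, Traj.norm_le _ (by positivity)]
    intro t
    refine (key n ξ η t).trans ?_
    change _ ≤ (1 / 2 : ℝ) ^ n * Real.exp (2 * A) * ‖ξ - η‖
    rw [mul_right_comm]
    gcongr
    exact hΦA t
  exact ⟨_, hcon.isFixedPt_fixedPoint_iterate⟩

end Gronwall

end

/-! ### Dominated convergence and norm estimates in `Lᵖ` -/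

section LpGeneric

variable {α : Type*} [MeasurableSpace α] {μ : Measure α}
variable {F G : Type*} [NormedAddCommGroup F] [NormedAddCommGroup G]

/-- Dominated convergence in `Lᵖ`, with chosen representatives. -/
theorem tendsto_Lp_of_dominated {p : ℝ≥0∞} [hp1 : Fact (1 ≤ p)] (hp : p ≠ ∞) {ι : Type*} {l : Filter ι}
    [l.IsCountablyGenerated] {f : ι → Lp F p μ} {g : Lp F p μ} {φ : ι → α → F} {b : α → ℝ}
    (hφ : ∀ᶠ i in l, f i =ᵐ[μ] φ i) (hb : MemLp b p μ)
    (h1 : ∀ᶠ i in l, ∀ᵐ q ∂μ, ‖φ i q - g q‖ ≤ b q)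
    (h2 : ∀ᵐ q ∂μ, Tendsto (fun i => φ i q) l (𝓝 (g q))) : Tendsto f l (𝓝 g) := by
  have hp0 : p ≠ 0 := (zero_lt_one.trans_le hp1.out).ne'
  have hpr : 0 < p.toReal := ENNReal.toReal_pos hp0 hp
  rw [Lp.tendsto_Lp_iff_tendsto_eLpNorm']
  have key : Tendsto (fun i => ∫⁻ q, ‖φ i q - g q‖ₑ ^ p.toReal ∂μ) l (𝓝 (∫⁻ _, 0 ∂μ)) := by
    refine tendsto_lintegral_filter_of_dominated_convergence' (fun q => ‖b q‖ₑ ^ p.toReal) ?_ ?_ ?_ ?_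
    · filter_upwards [hφ] with i hi
      exact (((Lp.aestronglyMeasurable (f i)).congr hi).sub
        (Lp.aestronglyMeasurable g)).enorm.pow_const _
    · filter_upwards [h1] with i hi
      filter_upwards [hi] with q hq
      gcongr
      rw [enorm_le_iff_norm_le]
      exact hq.trans (le_abs_self _)
    · exact (lintegral_rpow_enorm_lt_top_of_eLpNorm_lt_top hp0 hp hb.2).ne
    · filter_upwards [h2] with q hq
      have : Tendsto (fun i => ‖φ i q - g q‖ₑ) l (𝓝 0) := by
        have := (hq.sub_const (g q)).enorm
        simpa using this
      have := this.ennrpow_const p.toReal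
      simpa [ENNReal.zero_rpow_of_pos hpr] using this
  rw [lintegral_zero] at key
  have key2 := key.ennrpow_const (1 / p.toReal)
  rw [ENNReal.zero_rpow_of_pos (by positivity)] at key2
  refine key2.congr' ?_
  filter_upwards [hφ] with i hi
  rw [eLpNorm_eq_lintegral_rpow_enorm_toReal hp0 hp]
  congr 1
  refine lintegral_congr_ae ?_
  filter_upwards [hi] with q hq
  simp [hq]

/-- Differentiation of a curve in `Lᵖ` by dominated convergence. -/
theorem hasDerivAt_Lp_of_dominated [NormedSpace ℝ F] {p : ℝ≥0∞} [hp1 : Fact (1 ≤ p)] (hp : p ≠ ∞)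
    {f : ℝ → Lp F p μ} {f' : Lp F p μ} {φ : ℝ → α → F} {b : α → ℝ}
    (hφ : ∀ ε, f ε =ᵐ[μ] φ ε) (hb : MemLp b p μ)
    (h1 : ∀ᶠ ε in 𝓝 (0 : ℝ), ∀ᵐ q ∂μ, ‖φ ε q - φ 0 q‖ ≤ |ε| * b q)
    (h2 : ∀ᵐ q ∂μ, HasDerivAt (fun ε => φ ε q) (f' q) 0) : HasDerivAt f f' 0 := by
  rw [hasDerivAt_iff_tendsto_slope_zero]
  refine tendsto_Lp_of_dominated hp (φ := fun ε q => ε⁻¹ • (φ ε q - φ 0 q))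
    (b := fun q => ‖b q‖ + ‖f' q‖) ?_ (hb.norm.add (Lp.memLp f').norm) ?_ ?_
  · refine Eventually.of_forall fun ε => ?_
    filter_upwards [hφ (0 + ε), hφ 0, Lp.coeFn_sub (f (0 + ε)) (f 0),
      Lp.coeFn_smul ε⁻¹ (f (0 + ε) - f 0)] with q h1 h2 h3 h4
    rw [h4, Pi.smul_apply, h3, Pi.sub_apply, h1, h2, zero_add]
  · filter_upwards [h1.filter_mono nhdsWithin_le_nhds, self_mem_nhdsWithin] with ε hε hne
    filter_upwards [hε] with q hq
    refine (norm_sub_le _ _).trans (add_le_add_left ?_ _)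
    rw [norm_smul, norm_inv, Real.norm_eq_abs, inv_mul_le_iff₀ (abs_pos.2 hne)]
    exact hq.trans (mul_le_mul_of_nonneg_left (le_abs_self _) (abs_nonneg _))
  · filter_upwards [h2] with q hq
    have := hasDerivAt_iff_tendsto_slope_zero.1 hq
    simpa using this

/-- The pointwise norm of an element of `Lᵖ`. -/
def Lp.normLp {p : ℝ≥0∞} (f : Lp F p μ) : Lp ℝ p μ := (Lp.memLp f).norm.toLp

theorem Lp.coeFn_normLp {p : ℝ≥0∞} (f : Lp F p μ) : Lp.normLp f =ᵐ[μ] fun q => ‖f q‖ :=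
  MemLp.coeFn_toLp _

theorem Lp.norm_normLp {p : ℝ≥0∞} (f : Lp F p μ) : ‖Lp.normLp f‖ = ‖f‖ := by
  rw [Lp.normLp, Lp.norm_toLp, Lp.norm_def, eLpNorm_norm]

/-- Cauchy–Schwarz for the scalar functions of pointwise norms, since `F` and `G` carry no inner
product. -/
theorem Lp.integral_norm_mul_norm_le (f : Lp F 2 μ) (g : Lp G 2 μ) :
    ∫ q, ‖f q‖ * ‖g q‖ ∂μ ≤ ‖f‖ * ‖g‖ := by
  have h := real_inner_le_norm (Lp.normLp g) (Lp.normLp f)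
  rw [L2.inner_def, Lp.norm_normLp, Lp.norm_normLp, mul_comm] at h
  refine le_trans (le_of_eq ?_) h
  refine integral_congr_ae ?_
  filter_upwards [Lp.coeFn_normLp f, Lp.coeFn_normLp g] with q h1 h2
  simp [h1, h2]

theorem Lp.integral_norm_sq (f : Lp F 2 μ) : ∫ q, ‖f q‖ ^ 2 ∂μ = ‖f‖ ^ 2 := by
  have h := real_inner_self_eq_norm_sq (Lp.normLp f)
  rw [L2.inner_def, Lp.norm_normLp] at h
  rw [← h]
  refine integral_congr_ae ?_
  filter_upwards [Lp.coeFn_normLp f] with q h1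
  simp [h1, pow_two]

theorem Lp.integrable_norm_mul_norm (f : Lp F 2 μ) (g : Lp G 2 μ) :
    Integrable (fun q => ‖f q‖ * ‖g q‖) μ :=
  (Lp.memLp f).norm.integrable_mul (Lp.memLp g).norm

theorem Lp.integrable_norm_sq (f : Lp F 2 μ) : Integrable (fun q => ‖f q‖ ^ 2) μ := by
  simpa [pow_two] using Lp.integrable_norm_mul_norm f f

variable [IsProbabilityMeasure μ]

theorem Lp.integrable_norm (f : Lp F 2 μ) : Integrable (fun q => ‖f q‖) μ :=
  ((Lp.memLp f).integrable (by norm_num)).norm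

/-- The constant function one in `L²` of a probability measure. -/
def Lp.one (μ : Measure α) [IsProbabilityMeasure μ] : Lp ℝ 2 μ := (memLp_const (1 : ℝ)).toLp

theorem Lp.coeFn_one : Lp.one μ =ᵐ[μ] fun _ => (1 : ℝ) := MemLp.coeFn_toLp _

theorem Lp.norm_one : ‖Lp.one μ‖ = 1 := by
  rw [Lp.one, Lp.norm_toLp, eLpNorm_const' _ (by norm_num) (by norm_num)]
  simp

theorem Lp.integral_norm_le (f : Lp F 2 μ) : ∫ q, ‖f q‖ ∂μ ≤ ‖f‖ := by
  have h := L2.inner_def (𝕜 := ℝ) (Lp.normLp f) (Lp.one μ)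
  have h2 := real_inner_le_norm (Lp.normLp f) (Lp.one μ)
  rw [h, Lp.norm_normLp, Lp.norm_one] at h2
  rw [mul_one] at h2
  refine le_trans (le_of_eq ?_) h2
  refine integral_congr_ae ?_
  filter_upwards [Lp.coeFn_normLp f, Lp.coeFn_one (μ := μ)] with q h1 h2
  simp [h1, h2]

/-- The three terms are the shapes met in the estimates of `v`: a path increment times the growth `1
+ |θ|²`, a mixed term, and a square of the parameter increment. On a probability space each integral
is bounded by the corresponding product of `L²` norms. -/
theorem Lp.norm_one_le_of_ae_le {H : Type*} [NormedAddCommGroup H] {g : Lp H 1 μ}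
    {θ θ' φ : Lp F 2 μ} {A B D : ℝ} (hB : 0 ≤ B)
    (h : ∀ᵐ q ∂μ, ‖g q‖ ≤ A * (1 + ‖θ q‖ ^ 2) + B * (1 + ‖θ q‖ + ‖θ' q‖) * ‖φ q‖
      + D * ‖φ q‖ ^ 2) :
    ‖g‖ ≤ A * (1 + ‖θ‖ ^ 2) + B * (1 + ‖θ‖ + ‖θ'‖) * ‖φ‖ + D * ‖φ‖ ^ 2 := by
  rw [L1.norm_eq_integral_norm]
  have i1 : Integrable (fun q => A * (1 + ‖θ q‖ ^ 2)) μ :=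
    ((integrable_const _).add (Lp.integrable_norm_sq θ)).const_mul A
  have i2 : Integrable (fun q => B * (‖φ q‖ + ‖θ q‖ * ‖φ q‖ + ‖θ' q‖ * ‖φ q‖)) μ :=
    (((Lp.integrable_norm φ).add (Lp.integrable_norm_mul_norm θ φ)).add
      (Lp.integrable_norm_mul_norm θ' φ)).const_mul B
  have i3 : Integrable (fun q => D * ‖φ q‖ ^ 2) μ := (Lp.integrable_norm_sq φ).const_mul D
  calc ∫ q, ‖g q‖ ∂μ ≤ ∫ q, (A * (1 + ‖θ q‖ ^ 2) +
        B * (‖φ q‖ + ‖θ q‖ * ‖φ q‖ + ‖θ' q‖ * ‖φ q‖) + D * ‖φ q‖ ^ 2) ∂μ := by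
        refine integral_mono_ae (L1.integrable_coeFn g).norm ((i1.add i2).add i3) ?_
        filter_upwards [h] with q hq
        refine hq.trans (le_of_eq ?_)
        ring
    _ = A * (1 + ∫ q, ‖θ q‖ ^ 2 ∂μ) + B * (∫ q, ‖φ q‖ ∂μ + ∫ q, ‖θ q‖ * ‖φ q‖ ∂μ +
        ∫ q, ‖θ' q‖ * ‖φ q‖ ∂μ) + D * ∫ q, ‖φ q‖ ^ 2 ∂μ := by
        rw [integral_add (by exact i1.add i2) i3, integral_add i1 i2, integral_const_mul,
          integral_const_mul, integral_const_mul,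
          integral_add (integrable_const _) (Lp.integrable_norm_sq θ),
          integral_add (by exact (Lp.integrable_norm φ).add (Lp.integrable_norm_mul_norm θ φ))
            (Lp.integrable_norm_mul_norm θ' φ),
          integral_add (Lp.integrable_norm φ) (Lp.integrable_norm_mul_norm θ φ)]
        simp
    _ ≤ A * (1 + ‖θ‖ ^ 2) + B * (‖φ‖ + ‖θ‖ * ‖φ‖ + ‖θ'‖ * ‖φ‖) + D * ‖φ‖ ^ 2 := by
        rw [Lp.integral_norm_sq, Lp.integral_norm_sq]
        gcongr
        · exact Lp.integral_norm_le φ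
        · exact Lp.integral_norm_mul_norm_le θ φ
        · exact Lp.integral_norm_mul_norm_le θ' φ
    _ = _ := by ring

theorem Lp.norm_two_le_of_ae_le {H : Type*} [NormedAddCommGroup H] {g : Lp H 2 μ}
    {θ φ : Lp F 2 μ} {A D : ℝ} (hA : 0 ≤ A) (hD : 0 ≤ D)
    (h : ∀ᵐ q ∂μ, ‖g q‖ ≤ A * (1 + ‖θ q‖) + D * ‖φ q‖) :
    ‖g‖ ≤ A * (1 + ‖θ‖) + D * ‖φ‖ := by
  set u : Lp ℝ 2 μ := A • (Lp.one μ + Lp.normLp θ) + D • Lp.normLp φ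
  have h1 : ‖g‖ ≤ ‖u‖ := by
    refine Lp.norm_le_norm_of_ae_le ?_
    filter_upwards [h, Lp.coeFn_add (A • (Lp.one μ + Lp.normLp θ)) (D • Lp.normLp φ),
      Lp.coeFn_smul A (Lp.one μ + Lp.normLp θ), Lp.coeFn_smul D (Lp.normLp φ),
      Lp.coeFn_add (Lp.one μ) (Lp.normLp θ), Lp.coeFn_normLp θ, Lp.coeFn_normLp φ,
      Lp.coeFn_one (μ := μ)] with q h0 h1 h2 h3 h4 h5 h6 h7
    refine h0.trans ((le_of_eq ?_).trans (le_abs_self _))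
    rw [h1, Pi.add_apply, h2, Pi.smul_apply, h3, Pi.smul_apply, h4, Pi.add_apply, h5, h6, h7]
    simp only [smul_eq_mul]
  refine h1.trans ((norm_add_le _ _).trans ?_)
  rw [norm_smul, norm_smul, Lp.norm_normLp, Real.norm_of_nonneg hA, Real.norm_of_nonneg hD]
  gcongr
  refine (norm_add_le _ _).trans ?_
  rw [Lp.norm_normLp, Lp.norm_one]

end LpGeneric

/-! ### Superposition operators on paths and parameters -/

section Nemytskii

variable {Ω : Type*} [MeasurableSpace Ω] (P : Measure Ω) [IsProbabilityMeasure P]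
variable {E M F : Type*} [NormedAddCommGroup E] [NormedSpace ℝ E] [NormedAddCommGroup M]
  [NormedSpace ℝ M] [NormedAddCommGroup F] [NormedSpace ℝ F]

theorem aestronglyMeasurable_path (X : Traj E) :
    AEStronglyMeasurable (fun q : ℝ × Ω => X (timeOf q)) (stm P) :=
  (X.continuous.stronglyMeasurable.comp_measurable measurable_timeOf).aestronglyMeasurable

theorem aestronglyMeasurable_nem {f : E → M → F} (hf : Continuous fun z : E × M => f z.1 z.2)
    (X : Traj E) (Θ : Lp M 2 (stm P)) :
    AEStronglyMeasurable (fun q => f (X (timeOf q)) (Θ q)) (stm P) :=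
  hf.comp_aestronglyMeasurable
    ((aestronglyMeasurable_path P X).prodMk (Lp.aestronglyMeasurable Θ))

theorem memLp_path (X : Traj E) : MemLp (fun q : ℝ × Ω => X (timeOf q)) ∞ (stm P) :=
  memLp_top_of_bound (aestronglyMeasurable_path P X) ‖X‖
    (Eventually.of_forall fun _ => X.norm_coe_le_norm _)

/-- A continuous path as an element of `L^∞`. -/
def pathLp : Traj E →L[ℝ] Lp E ∞ (stm P) :=
  LinearMap.mkContinuous
    { toFun := fun X => (memLp_path P X).toLp
      map_add' := fun X Y => by rw [← MemLp.toLp_add]; rfl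
      map_smul' := fun c X => by rw [RingHom.id_apply, ← MemLp.toLp_const_smul]; rfl } 1
    (fun X => by
      rw [one_mul]
      refine (Lp.norm_le_of_ae_bound (C := ‖X‖) (norm_nonneg X) ?_).trans ?_
      · filter_upwards [MemLp.coeFn_toLp (memLp_path P X)] with q hq
        simp only [LinearMap.coe_mk, AddHom.coe_mk]
        rw [hq]
        exact X.norm_coe_le_norm _
      · simp)

theorem coeFn_pathLp (X : Traj E) : pathLp P X =ᵐ[stm P] fun q => X (timeOf q) :=
  MemLp.coeFn_toLp (memLp_path P X)

theorem norm_pathLp_le (X : Traj E) : ‖pathLp P X‖ ≤ ‖X‖ := by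
  simpa using (pathLp (E := E) P).le_of_opNorm_le (LinearMap.mkContinuous_norm_le _ zero_le_one _) X

/-- Multiplication of a path by an operator-valued `Lᵖ` function. -/
def mulPath (p : ℝ≥0∞) [Fact (1 ≤ p)] : Lp (E →L[ℝ] F) p (stm P) →L[ℝ] Traj E →L[ℝ] Lp F p (stm P) :=
  ((ContinuousLinearMap.id ℝ (E →L[ℝ] F)).holderL (stm P) p ∞ p).bilinearComp
    (ContinuousLinearMap.id ℝ _) (pathLp P)

theorem coeFn_mulPath (p : ℝ≥0∞) [Fact (1 ≤ p)] (A : Lp (E →L[ℝ] F) p (stm P)) (X : Traj E) :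
    mulPath P p A X =ᵐ[stm P] fun q => A q (X (timeOf q)) := by
  have h : mulPath P p A X = (ContinuousLinearMap.id ℝ (E →L[ℝ] F)).holder p A (pathLp P X) := rfl
  rw [h]
  filter_upwards [ContinuousLinearMap.coeFn_holder (r := p) (ContinuousLinearMap.id ℝ (E →L[ℝ] F)) A
    (pathLp P X), coeFn_pathLp P X] with q h1 h2
  rw [h1, h2]; rfl

/-- The pairing of `L²` operators with `L²` vectors, with values in `L¹`. -/
def pairLp : Lp (M →L[ℝ] F) 2 (stm P) →L[ℝ] Lp M 2 (stm P) →L[ℝ] Lp F 1 (stm P) :=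
  (ContinuousLinearMap.id ℝ (M →L[ℝ] F)).holderL (stm P) 2 2 1

theorem coeFn_pairLp (A : Lp (M →L[ℝ] F) 2 (stm P)) (Θ : Lp M 2 (stm P)) :
    pairLp P A Θ =ᵐ[stm P] fun q => A q (Θ q) :=
  ContinuousLinearMap.coeFn_holder (r := 1) (ContinuousLinearMap.id ℝ (M →L[ℝ] F)) A Θ

theorem norm_pairLp_le (A : Lp (M →L[ℝ] F) 2 (stm P)) (Θ : Lp M 2 (stm P)) :
    ‖pairLp P A Θ‖ ≤ ‖A‖ * ‖Θ‖ := by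
  have h := ContinuousLinearMap.norm_holder_apply_apply_le (r := 1)
    (ContinuousLinearMap.id ℝ (M →L[ℝ] F)) A Θ
  refine h.trans ?_
  gcongr
  exact mul_le_of_le_one_left (norm_nonneg _) ContinuousLinearMap.norm_id_le

/-- The Nemytskii operator `(X, Θ) ↦ f(X_t, Θ_t)`. -/
def nem (p : ℝ≥0∞) (f : E → M → F) (X : Traj E) (Θ : Lp M 2 (stm P)) : Lp F p (stm P) :=
  open Classical in
  -- The default is never met below: the growth conditions always give membership in `Lᵖ`.
  if h : MemLp (fun q => f (X (timeOf q)) (Θ q)) p (stm P) then h.toLp else 0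

variable {P}

theorem coeFn_nem {p : ℝ≥0∞} {f : E → M → F} {X : Traj E} {Θ : Lp M 2 (stm P)}
    (h : MemLp (fun q => f (X (timeOf q)) (Θ q)) p (stm P)) :
    nem P p f X Θ =ᵐ[stm P] fun q => f (X (timeOf q)) (Θ q) := by
  rw [nem, dif_pos h]
  exact h.coeFn_toLp

/-- Continuity and growth in `x` (linear) and `θ` (quadratic). -/
structure NemOne (f : E → M → F) : Prop where
  cont : Continuous fun z : E × M => f z.1 z.2
  bound : ∃ C, 0 ≤ C ∧ ∀ x θ, ‖f x θ‖ ≤ C * (1 + ‖x‖) * (1 + ‖θ‖ ^ 2)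

/-- Continuity and growth in `x` (linear) and `θ` (linear). -/
structure NemTwo (f : E → M → F) : Prop where
  cont : Continuous fun z : E × M => f z.1 z.2
  bound : ∃ C, 0 ≤ C ∧ ∀ x θ, ‖f x θ‖ ≤ C * (1 + ‖x‖) * (1 + ‖θ‖)

theorem memLp_one_sq (Θ : Lp M 2 (stm P)) : MemLp (fun q => 1 + ‖Θ q‖ ^ 2) 1 (stm P) :=
  memLp_one_iff_integrable.2 ((integrable_const _).add (Lp.integrable_norm_sq Θ))

theorem memLp_two_norm (Θ : Lp M 2 (stm P)) : MemLp (fun q => 1 + ‖Θ q‖) 2 (stm P) :=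
  (memLp_const (1 : ℝ)).add (Lp.memLp Θ).norm

theorem NemOne.memLp {f : E → M → F} (h : NemOne f) (X : Traj E) (Θ : Lp M 2 (stm P)) :
    MemLp (fun q => f (X (timeOf q)) (Θ q)) 1 (stm P) := by
  obtain ⟨C, hC, hb⟩ := h.bound
  refine ((memLp_one_sq Θ).const_mul (C * (1 + ‖X‖))).mono (aestronglyMeasurable_nem P h.cont X Θ)
    (Eventually.of_forall fun q => ?_)
  refine (hb _ _).trans (le_trans ?_ (le_abs_self _))
  gcongr
  exact X.norm_coe_le_norm _

theorem NemTwo.memLp {f : E → M → F} (h : NemTwo f) (X : Traj E) (Θ : Lp M 2 (stm P)) :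
    MemLp (fun q => f (X (timeOf q)) (Θ q)) 2 (stm P) := by
  obtain ⟨C, hC, hb⟩ := h.bound
  refine ((memLp_two_norm Θ).const_mul (C * (1 + ‖X‖))).mono (aestronglyMeasurable_nem P h.cont X Θ)
    (Eventually.of_forall fun q => ?_)
  refine (hb _ _).trans (le_trans ?_ (le_abs_self _))
  gcongr
  exact X.norm_coe_le_norm _

theorem NemOne.coeFn {f : E → M → F} (h : NemOne f) (X : Traj E) (Θ : Lp M 2 (stm P)) :
    nem P 1 f X Θ =ᵐ[stm P] fun q => f (X (timeOf q)) (Θ q) := coeFn_nem (h.memLp X Θ)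

theorem NemTwo.coeFn {f : E → M → F} (h : NemTwo f) (X : Traj E) (Θ : Lp M 2 (stm P)) :
    nem P 2 f X Θ =ᵐ[stm P] fun q => f (X (timeOf q)) (Θ q) := coeFn_nem (h.memLp X Θ)

theorem Traj.eventually_norm_le (X : Traj E) : ∀ᶠ Y in 𝓝 X, ‖Y‖ ≤ ‖X‖ + 1 := by
  filter_upwards [(continuous_norm.tendsto X).eventually (gt_mem_nhds (lt_add_one ‖X‖))] with Y hY
  exact hY.le

/-- Paths near `X` in the sup norm share the majorant `1 + |Θ|²`, so pointwise continuity suffices.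
This will give continuity of the derivatives in the starting point. -/
theorem NemOne.continuous {f : E → M → F} (h : NemOne f) (Θ : Lp M 2 (stm P)) :
    Continuous fun X : Traj E => nem P 1 f X Θ := by
  obtain ⟨C, hC, hb⟩ := h.bound
  rw [continuous_iff_continuousAt]
  intro X
  refine tendsto_Lp_of_dominated (by norm_num) (Eventually.of_forall fun Y => h.coeFn Y Θ)
    (b := fun q => (C * (1 + (‖X‖ + 1)) + C * (1 + ‖X‖)) * (1 + ‖Θ q‖ ^ 2))
    ((memLp_one_sq Θ).const_mul _) ?_ ?_
  · filter_upwards [X.eventually_norm_le] with Y hY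
    filter_upwards [h.coeFn X Θ] with q hq
    rw [hq]
    refine (norm_sub_le _ _).trans ?_
    rw [add_mul]
    refine add_le_add ((hb _ _).trans ?_) ((hb _ _).trans ?_)
    · have : ‖Y (timeOf q)‖ ≤ ‖X‖ + 1 := (Y.norm_coe_le_norm _).trans hY
      gcongr
    · gcongr
      exact X.norm_coe_le_norm _
  · filter_upwards [h.coeFn X Θ] with q hq
    rw [hq]
    have : Continuous fun Y : Traj E => f (Y (timeOf q)) (Θ q) :=
      h.cont.comp ((Traj.continuous_eval _).prodMk continuous_const)
    exact this.tendsto X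

theorem NemTwo.continuous {f : E → M → F} (h : NemTwo f) (Θ : Lp M 2 (stm P)) :
    Continuous fun X : Traj E => nem P 2 f X Θ := by
  obtain ⟨C, hC, hb⟩ := h.bound
  rw [continuous_iff_continuousAt]
  intro X
  refine tendsto_Lp_of_dominated (by norm_num) (Eventually.of_forall fun Y => h.coeFn Y Θ)
    (b := fun q => (C * (1 + (‖X‖ + 1)) + C * (1 + ‖X‖)) * (1 + ‖Θ q‖))
    ((memLp_two_norm Θ).const_mul _) ?_ ?_
  · filter_upwards [X.eventually_norm_le] with Y hY
    filter_upwards [h.coeFn X Θ] with q hq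
    rw [hq]
    refine (norm_sub_le _ _).trans ?_
    rw [add_mul]
    refine add_le_add ((hb _ _).trans ?_) ((hb _ _).trans ?_)
    · have : ‖Y (timeOf q)‖ ≤ ‖X‖ + 1 := (Y.norm_coe_le_norm _).trans hY
      gcongr
    · gcongr
      exact X.norm_coe_le_norm _
  · filter_upwards [h.coeFn X Θ] with q hq
    rw [hq]
    have : Continuous fun Y : Traj E => f (Y (timeOf q)) (Θ q) :=
      h.cont.comp ((Traj.continuous_eval _).prodMk continuous_const)
    exact this.tendsto X

end Nemytskii

/-! ### Vector fields with their derivatives of order at most two -/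

section Jet

variable {E M : Type*} [NormedAddCommGroup E] [NormedSpace ℝ E] [NormedAddCommGroup M]
  [NormedSpace ℝ M]

/-- A vector field `v(x, θ)` together with its derivatives of order at most two and with the growth
bounds that are used below. -/
structure VJet (v : E → M → E) (c0 c1 c2 : ℝ) where
  vx : E → M → E →L[ℝ] E
  vθ : E → M → M →L[ℝ] E
  vxx : E → M → E →L[ℝ] E →L[ℝ] E
  vxθ : E → M → M →L[ℝ] E →L[ℝ] E
  vθx : E → M → E →L[ℝ] M →L[ℝ] E
  vθθ : E → M → M →L[ℝ] M →L[ℝ] E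
  nonneg0 : 0 ≤ c0
  nonneg1 : 0 ≤ c1
  nonneg2 : 0 ≤ c2
  cont_vxx : Continuous fun z : E × M => vxx z.1 z.2
  cont_vxθ : Continuous fun z : E × M => vxθ z.1 z.2
  cont_vθx : Continuous fun z : E × M => vθx z.1 z.2
  cont_vθθ : Continuous fun z : E × M => vθθ z.1 z.2
  hasFDerivAt_v : ∀ x θ, HasFDerivAt (fun z : E × M => v z.1 z.2)
    ((vx x θ).coprod (vθ x θ)) (x, θ)
  hasFDerivAt_vx : ∀ x θ, HasFDerivAt (fun z : E × M => vx z.1 z.2)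
    ((vxx x θ).coprod (vxθ x θ)) (x, θ)
  hasFDerivAt_vθ : ∀ x θ, HasFDerivAt (fun z : E × M => vθ z.1 z.2)
    ((vθx x θ).coprod (vθθ x θ)) (x, θ)
  -- With `j` derivatives in `θ` the growth is `1 + |θ|^(2 - j)`, constant for `j = 2`; along an
  -- `L²` parameter these functions lie in `L¹`, `L²` and `L^∞`.
  norm_v : ∀ x θ, ‖v x θ‖ ≤ c0 * (1 + ‖θ‖ ^ 2) * (1 + ‖x‖)
  norm_vx : ∀ x θ, ‖vx x θ‖ ≤ 2 * c0 * (1 + ‖θ‖ ^ 2)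
  norm_vxx : ∀ x θ, ‖vxx x θ‖ ≤ 2 * c0 * (1 + ‖θ‖ ^ 2)
  norm_vθ : ∀ x θ, ‖vθ x θ‖ ≤ c1 * (1 + ‖θ‖) * (1 + ‖x‖)
  norm_vxθ : ∀ x θ, ‖vxθ x θ‖ ≤ 2 * c1 * (1 + ‖θ‖)
  norm_vθx : ∀ x θ, ‖vθx x θ‖ ≤ 2 * c1 * (1 + ‖θ‖)
  norm_vθθ : ∀ x θ, ‖vθθ x θ‖ ≤ c2 * (1 + ‖x‖)

section Slices

variable {F : Type*} [NormedAddCommGroup F] [NormedSpace ℝ F]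

theorem HasFDerivAt.slice_left {f : E → M → F} {A : E →L[ℝ] F} {B : M →L[ℝ] F} {x : E} {θ : M}
    (h : HasFDerivAt (fun z : E × M => f z.1 z.2) (A.coprod B) (x, θ)) :
    HasFDerivAt (fun x' => f x' θ) A x := by
  have := h.comp x (hasFDerivAt_prodMk_left (𝕜 := ℝ) x θ)
  rwa [ContinuousLinearMap.coprod_comp_inl] at this

theorem HasFDerivAt.slice_right {f : E → M → F} {A : E →L[ℝ] F} {B : M →L[ℝ] F} {x : E} {θ : M}
    (h : HasFDerivAt (fun z : E × M => f z.1 z.2) (A.coprod B) (x, θ)) :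
    HasFDerivAt (fun θ' => f x θ') B θ := by
  have := h.comp θ (hasFDerivAt_prodMk_right (𝕜 := ℝ) x θ)
  rwa [ContinuousLinearMap.coprod_comp_inr] at this

theorem norm_image_sub_le_of_norm_fderiv_le {f : E → F} {f' : E → E →L[ℝ] F} {C : ℝ}
    (h : ∀ x, HasFDerivAt f (f' x) x) (hC : ∀ x, ‖f' x‖ ≤ C) (x y : E) :
    ‖f y - f x‖ ≤ C * ‖y - x‖ :=
  convex_univ.norm_image_sub_le_of_norm_hasFDerivWithin_le
    (fun z _ => (h z).hasFDerivWithinAt) (fun z _ => hC z) (mem_univ _) (mem_univ _)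

/-- Mean value inequality on the ball `‖z‖ ≤ ‖θ‖ + ‖θ'‖`. -/
theorem norm_image_sub_le_of_norm_fderiv_le_ball {f : M → F} {f' : M → M →L[ℝ] F} {C : ℝ}
    {θ θ' : M} (h : ∀ x, HasFDerivAt f (f' x) x)
    (hC : ∀ z, ‖z‖ ≤ ‖θ‖ + ‖θ'‖ → ‖f' z‖ ≤ C) :
    ‖f θ' - f θ‖ ≤ C * ‖θ' - θ‖ :=
  (convex_closedBall (0 : M) (‖θ‖ + ‖θ'‖)).norm_image_sub_le_of_norm_hasFDerivWithin_le
    (fun z _ => (h z).hasFDerivWithinAt) (fun z hz => hC z (by simpa using hz))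
    (by simp) (by simp)

/-- First order Taylor estimate when the derivative is Lipschitz at `x`. -/
theorem norm_taylor_le {f : E → F} {f' : E → E →L[ℝ] F} {C : ℝ} (hC0 : 0 ≤ C)
    (h : ∀ x, HasFDerivAt f (f' x) x) {x y : E} (hC : ∀ z, ‖f' z - f' x‖ ≤ C * ‖z - x‖) :
    ‖f y - f x - f' x (y - x)‖ ≤ C * ‖y - x‖ ^ 2 := by
  have := (convex_closedBall x ‖y - x‖).norm_image_sub_le_of_norm_hasFDerivWithin_le'
    (f := f) (f' := f') (φ := f' x) (C := C * ‖y - x‖) (x := x) (y := y)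
    (fun z _ => (h z).hasFDerivWithinAt) (fun z hz => (hC z).trans (by
      rw [Metric.mem_closedBall, dist_eq_norm] at hz
      gcongr)) (by simp) (by simp [dist_eq_norm])
  rwa [mul_assoc, ← pow_two] at this

end Slices

namespace VJet

variable {v : E → M → E} {c0 c1 c2 : ℝ} (J : VJet v c0 c1 c2)
include J

theorem cont_v : Continuous fun z : E × M => v z.1 z.2 :=
  continuous_iff_continuousAt.2 fun z => (J.hasFDerivAt_v z.1 z.2).continuousAt

theorem cont_vx : Continuous fun z : E × M => J.vx z.1 z.2 :=
  continuous_iff_continuousAt.2 fun z => (J.hasFDerivAt_vx z.1 z.2).continuousAt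

theorem cont_vθ : Continuous fun z : E × M => J.vθ z.1 z.2 :=
  continuous_iff_continuousAt.2 fun z => (J.hasFDerivAt_vθ z.1 z.2).continuousAt

theorem v_sub_le_left (x x' : E) (θ : M) :
    ‖v x' θ - v x θ‖ ≤ 2 * c0 * (1 + ‖θ‖ ^ 2) * ‖x' - x‖ :=
  norm_image_sub_le_of_norm_fderiv_le (fun x => (J.hasFDerivAt_v x θ).slice_left)
    (fun x => J.norm_vx x θ) x x'

theorem v_sub_le_right (x : E) (θ θ' : M) :
    ‖v x θ' - v x θ‖ ≤ c1 * (1 + ‖x‖) * (1 + ‖θ‖ + ‖θ'‖) * ‖θ' - θ‖ := by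
  refine norm_image_sub_le_of_norm_fderiv_le_ball (fun θ => (J.hasFDerivAt_v x θ).slice_right)
    (fun z hz => (J.norm_vθ x z).trans ?_)
  have := J.nonneg1
  calc c1 * (1 + ‖z‖) * (1 + ‖x‖) ≤ c1 * (1 + (‖θ‖ + ‖θ'‖)) * (1 + ‖x‖) := by gcongr
    _ = _ := by ring

theorem vx_sub_le_left (x x' : E) (θ : M) :
    ‖J.vx x' θ - J.vx x θ‖ ≤ 2 * c0 * (1 + ‖θ‖ ^ 2) * ‖x' - x‖ :=
  norm_image_sub_le_of_norm_fderiv_le (fun x => (J.hasFDerivAt_vx x θ).slice_left)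
    (fun x => J.norm_vxx x θ) x x'

theorem vx_sub_le_right (x : E) (θ θ' : M) :
    ‖J.vx x θ' - J.vx x θ‖ ≤ 2 * c1 * (1 + ‖θ‖ + ‖θ'‖) * ‖θ' - θ‖ := by
  refine norm_image_sub_le_of_norm_fderiv_le_ball (fun θ => (J.hasFDerivAt_vx x θ).slice_right)
    (fun z hz => (J.norm_vxθ x z).trans ?_)
  have := J.nonneg1
  rw [add_assoc]
  gcongr

theorem vθ_sub_le_left (x x' : E) (θ : M) :
    ‖J.vθ x' θ - J.vθ x θ‖ ≤ 2 * c1 * (1 + ‖θ‖) * ‖x' - x‖ :=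
  norm_image_sub_le_of_norm_fderiv_le (fun x => (J.hasFDerivAt_vθ x θ).slice_left)
    (fun x => J.norm_vθx x θ) x x'

theorem vθ_sub_le_right (x : E) (θ θ' : M) :
    ‖J.vθ x θ' - J.vθ x θ‖ ≤ c2 * (1 + ‖x‖) * ‖θ' - θ‖ :=
  norm_image_sub_le_of_norm_fderiv_le (fun θ => (J.hasFDerivAt_vθ x θ).slice_right)
    (fun θ => J.norm_vθθ x θ) θ θ'

theorem vx_sub_le (x x' : E) (θ θ' : M) :
    ‖J.vx x' θ' - J.vx x θ‖ ≤ 2 * c0 * (1 + ‖θ‖ ^ 2) * ‖x' - x‖ +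
      2 * c1 * (1 + ‖θ‖ + ‖θ'‖) * ‖θ' - θ‖ := by
  have h : J.vx x' θ' - J.vx x θ = (J.vx x' θ - J.vx x θ) + (J.vx x' θ' - J.vx x' θ) := by abel
  rw [h]
  exact (norm_add_le _ _).trans (add_le_add (J.vx_sub_le_left x x' θ) (J.vx_sub_le_right x' θ θ'))

theorem vθ_sub_le (x x' : E) (θ θ' : M) :
    ‖J.vθ x' θ' - J.vθ x θ‖ ≤ 2 * c1 * (1 + ‖θ‖) * ‖x' - x‖ +
      c2 * (1 + ‖x'‖) * ‖θ' - θ‖ := by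
  have h : J.vθ x' θ' - J.vθ x θ = (J.vθ x' θ - J.vθ x θ) + (J.vθ x' θ' - J.vθ x' θ) := by abel
  rw [h]
  exact (norm_add_le _ _).trans (add_le_add (J.vθ_sub_le_left x x' θ) (J.vθ_sub_le_right x' θ θ'))

/-- The state is moved first at the new parameter, `v_x` is then brought back to the old parameter,
and the parameter is moved last. Because `v_θθ` is bounded in `θ`, the remainder in `θ` is quadratic
with a constant coefficient, hence integrable for increments that are merely in `L²`. -/
theorem taylor (x x' : E) (θ θ' : M) :
    ‖v x' θ' - v x θ - (J.vx x θ (x' - x) + J.vθ x θ (θ' - θ))‖ ≤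
      2 * c0 * (1 + ‖θ'‖ ^ 2) * ‖x' - x‖ ^ 2 +
      2 * c1 * (1 + ‖θ'‖ + ‖θ‖) * ‖θ' - θ‖ * ‖x' - x‖ + c2 * (1 + ‖x‖) * ‖θ' - θ‖ ^ 2 := by
  have h : v x' θ' - v x θ - (J.vx x θ (x' - x) + J.vθ x θ (θ' - θ)) =
      (v x' θ' - v x θ' - J.vx x θ' (x' - x)) + (J.vx x θ' - J.vx x θ) (x' - x) +
      (v x θ' - v x θ - J.vθ x θ (θ' - θ)) := by
    rw [_root_.sub_apply]; abel
  have n0 := J.nonneg0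
  have n2 := J.nonneg2
  rw [h]
  refine norm_add₃_le.trans (add_le_add (add_le_add ?_ ?_) ?_)
  · exact norm_taylor_le (by positivity) (fun x => (J.hasFDerivAt_v x θ').slice_left)
      (fun z => J.vx_sub_le_left x z θ')
  · refine ((J.vx x θ' - J.vx x θ).le_opNorm _).trans ?_
    gcongr
    refine (J.vx_sub_le_right x θ θ').trans (le_of_eq ?_)
    ring
  · exact norm_taylor_le (by positivity) (fun θ => (J.hasFDerivAt_v x θ).slice_right)
      (fun z => J.vθ_sub_le_right x θ z)

theorem nemOne_v : NemOne v := ⟨J.cont_v, c0, J.nonneg0, fun x θ =>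
  (J.norm_v x θ).trans (le_of_eq (by ring))⟩

theorem nemOne_vx : NemOne J.vx := ⟨J.cont_vx, 2 * c0, by have := J.nonneg0; positivity, fun x θ =>
  (J.norm_vx x θ).trans (by
    have := J.nonneg0
    have h : 2 * c0 ≤ 2 * c0 * (1 + ‖x‖) := le_mul_of_one_le_right (by positivity) (by simp)
    gcongr)⟩

theorem nemOne_vxx : NemOne J.vxx :=
  ⟨J.cont_vxx, 2 * c0, by have := J.nonneg0; positivity, fun x θ =>
  (J.norm_vxx x θ).trans (by
    have := J.nonneg0
    have h : 2 * c0 ≤ 2 * c0 * (1 + ‖x‖) := le_mul_of_one_le_right (by positivity) (by simp)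
    gcongr)⟩

theorem nemTwo_vθ : NemTwo J.vθ := ⟨J.cont_vθ, c1, J.nonneg1, fun x θ =>
  (J.norm_vθ x θ).trans (le_of_eq (by ring))⟩

theorem nemTwo_vxθ : NemTwo J.vxθ :=
  ⟨J.cont_vxθ, 2 * c1, by have := J.nonneg1; positivity, fun x θ =>
  (J.norm_vxθ x θ).trans (by
    have := J.nonneg1
    have h : 2 * c1 ≤ 2 * c1 * (1 + ‖x‖) := le_mul_of_one_le_right (by positivity) (by simp)
    gcongr)⟩

theorem nemTwo_vθx : NemTwo J.vθx :=
  ⟨J.cont_vθx, 2 * c1, by have := J.nonneg1; positivity, fun x θ =>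
  (J.norm_vθx x θ).trans (by
    have := J.nonneg1
    have h : 2 * c1 ≤ 2 * c1 * (1 + ‖x‖) := le_mul_of_one_le_right (by positivity) (by simp)
    gcongr)⟩

end VJet

end Jet

/-! ### Linear Volterra equations -/

section Volterra

variable {Ω : Type*} [MeasurableSpace Ω] (P : Measure Ω) [IsProbabilityMeasure P]
variable {E M F : Type*} [NormedAddCommGroup E] [NormedSpace ℝ E] [NormedAddCommGroup M]
  [NormedSpace ℝ M] [NormedAddCommGroup F] [NormedSpace ℝ F]

theorem norm_cumul_apply_le {g : Lp F 1 (stm P)} {b : ℝ × Ω → ℝ} (hb : Integrable b (stm P))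
    (h : ∀ᵐ q ∂(stm P), ‖g q‖ ≤ b q) (t : I) :
    ‖cumul P g t‖ ≤ ∫ q in {q | q.1 ≤ (t : ℝ)}, b q ∂(stm P) := by
  rw [cumul_apply]
  refine (norm_integral_le_integral_norm _).trans ?_
  exact integral_mono_ae (L1.integrable_coeFn g).norm.integrableOn hb.integrableOn
    (ae_restrict_of_ae h)

theorem norm_cumul_le_norm (g : Lp F 1 (stm P)) : ‖cumul P g‖ ≤ ‖g‖ := by
  have h := ContinuousLinearMap.le_of_opNorm_le (cumul (F := F) P) (norm_cumul_le (F := F) P) g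
  rwa [one_mul] at h

/-- The Volterra operator `(Tξ)_t = ∫_{s ≤ t} α ξ`. -/
def volt : Lp (E →L[ℝ] E) 1 (stm P) →L[ℝ] Traj E →L[ℝ] Traj E :=
  (ContinuousLinearMap.compL ℝ _ _ _ (cumul P)).comp (mulPath P 1)

theorem volt_apply (α : Lp (E →L[ℝ] E) 1 (stm P)) (ξ : Traj E) :
    volt P α ξ = cumul P (mulPath P 1 α ξ) := rfl

theorem norm_volt_apply_le (α : Lp (E →L[ℝ] E) 1 (stm P)) (ξ : Traj E) (t : I) :
    ‖volt P α ξ t‖ ≤ ∫ q in {q | q.1 ≤ (t : ℝ)}, ‖α q‖ * ‖ξ (timeOf q)‖ ∂(stm P) := by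
  rw [volt_apply]
  refine norm_cumul_apply_le P (integrable_mul_comp_timeOf P (L1.integrable_coeFn α).norm
    ξ.continuous.norm) ?_ t
  filter_upwards [coeFn_mulPath P 1 α ξ] with q hq
  rw [hq]
  exact (α q).le_opNorm _

/-- The inverse of `1 - T` for a Volterra operator `T`. -/
def volterraResolvent (α : Lp (E →L[ℝ] E) 1 (stm P)) : Traj E →L[ℝ] Traj E :=
  -- `Ring.inverse` vanishes off the units; for complete `E` this case is excluded by
  -- `isUnit_one_sub_volt`.
  Ring.inverse (1 - volt P α)

variable [CompleteSpace E]

theorem norm_le_of_sub_volt_eq {α : Lp (E →L[ℝ] E) 1 (stm P)} {ξ f : Traj E}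
    (h : ξ - volt P α ξ = f) : ‖ξ‖ ≤ 2 * Real.exp (2 * ‖α‖) * ‖f‖ := by
  rw [Traj.norm_le _ (by positivity)]
  refine gronwall_cumul P (L1.integrable_coeFn α).norm
    (Eventually.of_forall fun q => norm_nonneg _) (by fun_prop) (fun t => norm_nonneg _)
    (norm_nonneg _) (L1.norm_eq_integral_norm α).ge fun t => ?_
  have h1 : ξ t = f t + volt P α ξ t := by rw [← h]; simp
  rw [h1]
  exact (norm_add_le _ _).trans (add_le_add (f.norm_coe_le_norm t) (norm_volt_apply_le P α ξ t))

/-- Gronwall gives injectivity, Picard iteration gives surjectivity, and a bijective bounded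
operator between Banach spaces has a bounded inverse. No smallness of `α` is needed. -/
theorem isUnit_one_sub_volt (α : Lp (E →L[ℝ] E) 1 (stm P)) : IsUnit (1 - volt P α) := by
  rw [ContinuousLinearMap.isUnit_iff_bijective]
  constructor
  · rw [injective_iff_map_eq_zero]
    intro ξ hξ
    have := norm_le_of_sub_volt_eq P (α := α) (ξ := ξ) (f := 0) (by simpa using hξ)
    rw [norm_zero, mul_zero] at this
    exact norm_le_zero_iff.1 this
  · intro f
    obtain ⟨ξ, hξ⟩ := exists_fixedPoint_of_volterra P (L1.integrable_coeFn α).norm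
      (Eventually.of_forall fun q => norm_nonneg _) (fun ξ => f + volt P α ξ) (fun ξ η t => by
        have h : (f + volt P α ξ) t - (f + volt P α η) t = volt P α (ξ - η) t := by
          rw [map_sub]; simp
        rw [h]
        exact norm_volt_apply_le P α (ξ - η) t)
    refine ⟨ξ, ?_⟩
    have : ξ - volt P α ξ = f := by rw [sub_eq_iff_eq_add]; exact hξ.symm
    simpa using this

theorem volterraResolvent_sub_volt (α : Lp (E →L[ℝ] E) 1 (stm P)) (f : Traj E) :
    volterraResolvent P α f - volt P α (volterraResolvent P α f) = f := by
  have := Ring.mul_inverse_cancel _ (isUnit_one_sub_volt P α)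
  exact DFunLike.congr_fun this f

theorem volterraResolvent_apply_sub (α : Lp (E →L[ℝ] E) 1 (stm P)) (ξ : Traj E) :
    volterraResolvent P α (ξ - volt P α ξ) = ξ := by
  have := Ring.inverse_mul_cancel _ (isUnit_one_sub_volt P α)
  exact DFunLike.congr_fun this ξ

theorem norm_volterraResolvent_le (α : Lp (E →L[ℝ] E) 1 (stm P)) :
    ‖volterraResolvent P α‖ ≤ 2 * Real.exp (2 * ‖α‖) :=
  ContinuousLinearMap.opNorm_le_bound _ (by positivity) fun f =>
    norm_le_of_sub_volt_eq P (volterraResolvent_sub_volt P α f)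

theorem continuous_volterraResolvent : Continuous (volterraResolvent (E := E) P) := by
  rw [continuous_iff_continuousAt]
  intro α
  obtain ⟨u, hu⟩ := isUnit_one_sub_volt P α
  have h1 := NormedRing.inverse_continuousAt (R := Traj E →L[ℝ] Traj E) u
  rw [hu] at h1
  exact h1.comp (f := fun α => 1 - volt P α) (by fun_prop)

/-- The derivative of the inverse, composed with the linear dependence of `1 - T` on its kernel; the
two minus signs cancel. -/
theorem hasDerivAt_volterraResolvent {α : ℝ → Lp (E →L[ℝ] E) 1 (stm P)} {α' : Lp (E →L[ℝ] E) 1 (stm P)}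
    {s : ℝ} (h : HasDerivAt α α' s) :
    HasDerivAt (fun s => volterraResolvent P (α s))
      ((volterraResolvent P (α s)).comp ((volt P α').comp (volterraResolvent P (α s)))) s := by
  obtain ⟨u, hu⟩ := isUnit_one_sub_volt P (α s)
  have h1 : HasDerivAt (fun s => 1 - volt P (α s)) (-volt P α') s := by
    have := (ContinuousLinearMap.hasFDerivAt (volt (E := E) P) (x := α s)).comp_hasDerivAt s h
    exact this.const_sub 1
  have h2 := hasFDerivAt_ringInverse (𝕜 := ℝ) (R := Traj E →L[ℝ] Traj E) u
  rw [hu] at h2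
  have h3 := h2.comp_hasDerivAt s h1
  have hinv : (↑u⁻¹ : Traj E →L[ℝ] Traj E) = volterraResolvent P (α s) := by
    rw [volterraResolvent, ← hu, Ring.inverse_unit]
  have h4 : (-ContinuousLinearMap.mulLeftRight ℝ (Traj E →L[ℝ] Traj E) ↑u⁻¹ ↑u⁻¹) (-volt P α') =
      (volterraResolvent P (α s)).comp ((volt P α').comp (volterraResolvent P (α s))) := by
    rw [← hinv]
    ext f
    simp
  rw [h4] at h3
  exact h3

end Volterra

/-! ### The controlled flow and its first derivative -/

section Flow

variable {Ω : Type*} [MeasurableSpace Ω] (P : Measure Ω) [IsProbabilityMeasure P]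
variable {E M : Type*} [NormedAddCommGroup E] [NormedSpace ℝ E] [NormedAddCommGroup M]
  [NormedSpace ℝ M]

namespace VJet

variable {v : E → M → E} {c0 c1 c2 : ℝ} (J : VJet v c0 c1 c2)
include J

theorem norm_nem_v_sub_le (X : Traj E) (Θ Θ' : Lp M 2 (stm P)) :
    ‖nem P 1 v X Θ' - nem P 1 v X Θ‖ ≤
      c1 * (1 + ‖X‖) * (1 + ‖Θ‖ + ‖Θ'‖) * ‖Θ' - Θ‖ := by
  have n1 := J.nonneg1
  have := Lp.norm_one_le_of_ae_le (g := nem P 1 v X Θ' - nem P 1 v X Θ) (θ := Θ) (θ' := Θ')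
    (φ := Θ' - Θ) (A := 0) (B := c1 * (1 + ‖X‖)) (D := 0) (by positivity) (by
      filter_upwards [Lp.coeFn_sub (nem P 1 v X Θ') (nem P 1 v X Θ), Lp.coeFn_sub Θ' Θ,
        J.nemOne_v.coeFn X Θ, J.nemOne_v.coeFn X Θ'] with q h1 h2 h3 h4
      rw [h1, h2, Pi.sub_apply, Pi.sub_apply, h3, h4]
      refine (J.v_sub_le_right _ _ _).trans ?_
      rw [zero_mul, zero_mul, zero_add, add_zero]
      gcongr
      exact X.norm_coe_le_norm _)
  simpa using this

theorem norm_nem_vx_le (X : Traj E) (Θ : Lp M 2 (stm P)) :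
    ‖nem P 1 J.vx X Θ‖ ≤ 2 * c0 * (1 + ‖Θ‖ ^ 2) := by
  have := Lp.norm_one_le_of_ae_le (g := nem P 1 J.vx X Θ) (θ := Θ) (θ' := Θ)
    (φ := Θ) (A := 2 * c0) (B := 0) (D := 0) le_rfl (by
      filter_upwards [J.nemOne_vx.coeFn X Θ] with q h1
      rw [h1]
      simpa using J.norm_vx _ _)
  simpa using this

theorem norm_nem_vθ_le (X : Traj E) (Θ : Lp M 2 (stm P)) :
    ‖nem P 2 J.vθ X Θ‖ ≤ c1 * (1 + ‖X‖) * (1 + ‖Θ‖) := by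
  have n1 := J.nonneg1
  have := Lp.norm_two_le_of_ae_le (g := nem P 2 J.vθ X Θ) (θ := Θ)
    (φ := Θ) (A := c1 * (1 + ‖X‖)) (D := 0) (by positivity) le_rfl (by
      filter_upwards [J.nemTwo_vθ.coeFn X Θ] with q h1
      rw [h1, zero_mul, add_zero]
      refine (J.norm_vθ _ _).trans ?_
      rw [mul_right_comm]
      gcongr
      exact X.norm_coe_le_norm _)
  simpa using this

variable [CompleteSpace E]

/-- Picard iteration: `v` is Lipschitz in the state with constant `2 c0 (1 + |Θ|²)`, which is
integrable over space-time. -/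
theorem exists_flow (x : E) (Θ : Lp M 2 (stm P)) :
    ∃ X : Traj E, X = Traj.const x + cumul P (nem P 1 v X Θ) := by
  have n0 := J.nonneg0
  have ha : Integrable (fun q => 2 * c0 * (1 + ‖Θ q‖ ^ 2)) (stm P) :=
    (memLp_one_iff_integrable.1 (memLp_one_sq Θ)).const_mul _
  obtain ⟨X, hX⟩ := exists_fixedPoint_of_volterra P ha
    (Eventually.of_forall fun q => by show (0 : ℝ) ≤ 2 * c0 * (1 + ‖Θ q‖ ^ 2); positivity)
    (fun X => Traj.const x + cumul P (nem P 1 v X Θ)) (fun ξ η t => by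
      have h : (Traj.const x + cumul P (nem P 1 v ξ Θ)) t -
          (Traj.const x + cumul P (nem P 1 v η Θ)) t =
          cumul P (nem P 1 v ξ Θ - nem P 1 v η Θ) t := by rw [map_sub]; simp
      rw [h]
      refine norm_cumul_apply_le P
        (integrable_mul_comp_timeOf P ha (u := fun t => ‖ξ t - η t‖) (by fun_prop)) ?_ t
      filter_upwards [Lp.coeFn_sub (nem P 1 v ξ Θ) (nem P 1 v η Θ), J.nemOne_v.coeFn ξ Θ,
        J.nemOne_v.coeFn η Θ] with q h1 h2 h3
      rw [h1, Pi.sub_apply, h2, h3]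
      exact J.v_sub_le_left _ _ _)
  exact ⟨X, hX.symm⟩

/-- The trajectory started at `x` and driven by `Θ`. -/
def flow (x : E) (Θ : Lp M 2 (stm P)) : Traj E := (J.exists_flow P x Θ).choose

theorem flow_eq (x : E) (Θ : Lp M 2 (stm P)) :
    J.flow P x Θ = Traj.const x + cumul P (nem P 1 v (J.flow P x Θ) Θ) :=
  (J.exists_flow P x Θ).choose_spec

theorem norm_flow_le (x : E) (Θ : Lp M 2 (stm P)) :
    1 + ‖J.flow P x Θ‖ ≤ 2 * Real.exp (2 * (c0 * (1 + ‖Θ‖ ^ 2))) * (1 + ‖x‖) := by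
  have n0 := J.nonneg0
  set X := J.flow P x Θ with hX
  have ha : Integrable (fun q => c0 * (1 + ‖Θ q‖ ^ 2)) (stm P) :=
    (memLp_one_iff_integrable.1 (memLp_one_sq Θ)).const_mul _
  have key := gronwall_cumul P ha
    (Eventually.of_forall fun q => by show (0 : ℝ) ≤ c0 * (1 + ‖Θ q‖ ^ 2); positivity)
    (u := fun t => 1 + ‖X t‖) (by fun_prop) (fun t => by positivity) (c := 1 + ‖x‖) (by positivity)
    (A := c0 * (1 + ‖Θ‖ ^ 2)) (by
      rw [integral_const_mul, integral_add (integrable_const _) (Lp.integrable_norm_sq Θ),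
        Lp.integral_norm_sq]
      simp) (fun t => by
      have h1 : X t = x + cumul P (nem P 1 v X Θ) t := by
        conv_lhs => rw [hX, J.flow_eq P x Θ]
        rfl
      have h2 : ‖cumul P (nem P 1 v X Θ) t‖ ≤
          ∫ q in {q | q.1 ≤ (t : ℝ)}, c0 * (1 + ‖Θ q‖ ^ 2) * (1 + ‖X (timeOf q)‖) ∂(stm P) := by
        refine norm_cumul_apply_le P
          (integrable_mul_comp_timeOf P ha (u := fun t => 1 + ‖X t‖) (by fun_prop)) ?_ t
        filter_upwards [J.nemOne_v.coeFn X Θ] with q h2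
        rw [h2]
        exact J.norm_v _ _
      have h3 : ‖X t‖ ≤ ‖x‖ + ‖cumul P (nem P 1 v X Θ) t‖ := by
        conv_lhs => rw [h1]
        exact norm_add_le _ _
      linarith)
  have h0 : ‖X‖ ≤ 2 * Real.exp (2 * (c0 * (1 + ‖Θ‖ ^ 2))) * (1 + ‖x‖) - 1 := by
    rw [Traj.norm_le]
    · intro t; linarith [key t]
    · have := key 0
      linarith [norm_nonneg (X 0)]
  linarith

/-- The control is changed along the fixed path `X'`, then the path is changed under the fixed
control `Θ`. Only the second change feeds back into Gronwall, so the exponential involves `Θ` alone.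
-/
theorem norm_flow_sub_le (x x' : E) (Θ Θ' : Lp M 2 (stm P)) :
    ‖J.flow P x' Θ' - J.flow P x Θ‖ ≤ 2 * Real.exp (2 * (2 * c0 * (1 + ‖Θ‖ ^ 2))) *
      (‖x' - x‖ + c1 * (1 + ‖J.flow P x' Θ'‖) * (1 + ‖Θ‖ + ‖Θ'‖) * ‖Θ' - Θ‖) := by
  have n0 := J.nonneg0
  have n1 := J.nonneg1
  set X := J.flow P x Θ with hX
  set X' := J.flow P x' Θ' with hX'
  have ha : Integrable (fun q => 2 * c0 * (1 + ‖Θ q‖ ^ 2)) (stm P) :=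
    (memLp_one_iff_integrable.1 (memLp_one_sq Θ)).const_mul _
  rw [Traj.norm_le _ (by positivity)]
  refine gronwall_cumul P ha
    (Eventually.of_forall fun q => by show (0 : ℝ) ≤ 2 * c0 * (1 + ‖Θ q‖ ^ 2); positivity)
    (u := fun t => ‖(X' - X) t‖) (by fun_prop) (fun t => by positivity) (by positivity)
    (by
      rw [integral_const_mul, integral_add (integrable_const _) (Lp.integrable_norm_sq Θ),
        Lp.integral_norm_sq]
      simp) (fun t => ?_)
  have h1 : (X' - X) t = (x' - x) + cumul P (nem P 1 v X' Θ' - nem P 1 v X' Θ) t +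
      cumul P (nem P 1 v X' Θ - nem P 1 v X Θ) t := by
    rw [Traj.sub_apply]
    conv_lhs => rw [hX, hX', J.flow_eq P x Θ, J.flow_eq P x' Θ', ← hX, ← hX']
    rw [map_sub, map_sub]
    simp
    abel
  rw [h1]
  refine norm_add₃_le.trans (add_le_add (add_le_add le_rfl ?_) ?_)
  · exact ((Traj.norm_coe_le_norm _ t).trans (norm_cumul_le_norm P _)).trans
      (J.norm_nem_v_sub_le P X' Θ Θ')
  · refine norm_cumul_apply_le P
      (integrable_mul_comp_timeOf P ha (u := fun t => ‖(X' - X) t‖) (by fun_prop)) ?_ t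
    filter_upwards [Lp.coeFn_sub (nem P 1 v X' Θ) (nem P 1 v X Θ), J.nemOne_v.coeFn X Θ,
      J.nemOne_v.coeFn X' Θ] with q h1 h2 h3
    rw [h1, Pi.sub_apply, h2, h3]
    exact J.v_sub_le_left _ _ _

/-- The derivative of the trajectory with respect to the control. -/
def dflow (x : E) (Θ : Lp M 2 (stm P)) : Lp M 2 (stm P) →L[ℝ] Traj E :=
  (volterraResolvent P (nem P 1 J.vx (J.flow P x Θ) Θ)).comp
    ((cumul P).comp (pairLp P (nem P 2 J.vθ (J.flow P x Θ) Θ)))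

omit [CompleteSpace E] in
theorem norm_nem_taylor_le (X X' : Traj E) (Θ Θ' : Lp M 2 (stm P)) :
    ‖nem P 1 v X' Θ' - nem P 1 v X Θ - (mulPath P 1 (nem P 1 J.vx X Θ) (X' - X) +
      pairLp P (nem P 2 J.vθ X Θ) (Θ' - Θ))‖ ≤
      2 * c0 * ‖X' - X‖ ^ 2 * (1 + ‖Θ'‖ ^ 2) +
      2 * c1 * ‖X' - X‖ * (1 + ‖Θ'‖ + ‖Θ‖) * ‖Θ' - Θ‖ + c2 * (1 + ‖X‖) * ‖Θ' - Θ‖ ^ 2 := by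
  have n0 := J.nonneg0
  have n1 := J.nonneg1
  have n2 := J.nonneg2
  refine Lp.norm_one_le_of_ae_le (by positivity) ?_
  set A := mulPath P 1 (nem P 1 J.vx X Θ) (X' - X)
  set B := pairLp P (nem P 2 J.vθ X Θ) (Θ' - Θ)
  filter_upwards [Lp.coeFn_sub (nem P 1 v X' Θ' - nem P 1 v X Θ) (A + B),
    Lp.coeFn_sub (nem P 1 v X' Θ') (nem P 1 v X Θ), Lp.coeFn_add A B,
    coeFn_mulPath P 1 (nem P 1 J.vx X Θ) (X' - X),
    coeFn_pairLp P (nem P 2 J.vθ X Θ) (Θ' - Θ), Lp.coeFn_sub Θ' Θ, J.nemOne_v.coeFn X' Θ',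
    J.nemOne_v.coeFn X Θ, J.nemOne_vx.coeFn X Θ, J.nemTwo_vθ.coeFn X Θ]
    with q h1 h2 h3 h4 h5 h6 h7 h8 h9 h10
  rw [h1, Pi.sub_apply, h2, Pi.sub_apply, h3, Pi.add_apply, h4, h5, h6, h7, h8, h9, h10,
    Pi.sub_apply, Traj.sub_apply]
  refine (J.taylor _ _ _ _).trans ?_
  have hx : ‖X' (timeOf q) - X (timeOf q)‖ ≤ ‖X' - X‖ := (X' - X).norm_coe_le_norm _
  have hX : ‖X (timeOf q)‖ ≤ ‖X‖ := X.norm_coe_le_norm _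
  calc _ ≤ 2 * c0 * (1 + ‖Θ' q‖ ^ 2) * ‖X' - X‖ ^ 2 +
      2 * c1 * (1 + ‖Θ' q‖ + ‖Θ q‖) * ‖Θ' q - Θ q‖ * ‖X' - X‖ +
      c2 * (1 + ‖X‖) * ‖Θ' q - Θ q‖ ^ 2 := by gcongr
    _ = _ := by ring

omit J in
theorem _root_.hasFDerivAt_of_norm_sub_le_sq {F G : Type*} [NormedAddCommGroup F] [NormedSpace ℝ F]
    [NormedAddCommGroup G] [NormedSpace ℝ G] {f : F → G} {f' : F →L[ℝ] G} {x : F} {C : ℝ}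
    (h : ∀ᶠ y in 𝓝 x, ‖f y - f x - f' (y - x)‖ ≤ C * ‖y - x‖ ^ 2) : HasFDerivAt f f' x := by
  rw [hasFDerivAt_iff_isLittleO]
  have h1 : (fun y => f y - f x - f' (y - x)) =O[𝓝 x] fun y => ‖y - x‖ ^ 2 :=
    Asymptotics.IsBigO.of_bound C (by
      filter_upwards [h] with y hy
      rwa [norm_pow, norm_norm])
  refine h1.trans_isLittleO ?_
  have h2 : (fun y => ‖y - x‖ ^ 2) =o[𝓝 x] fun y => ‖y - x‖ ^ 1 := by
    have : Tendsto (fun y => ‖y - x‖) (𝓝 x) (𝓝 0) := by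
      have h3 : Continuous fun y => ‖y - x‖ := by fun_prop
      simpa using h3.tendsto x
    exact (Asymptotics.isLittleO_pow_pow one_lt_two).comp_tendsto this
  simpa using h2

/-- The error of the linearisation solves the linear Volterra equation whose source is the time
integral of the Taylor remainder. That remainder is quadratic in the increment of the control
because the flow is Lipschitz. -/
theorem hasFDerivAt_flow (x : E) (Θ : Lp M 2 (stm P)) :
    HasFDerivAt (fun Θ => J.flow P x Θ) (J.dflow P x Θ) Θ := by
  have n0 := J.nonneg0
  have n1 := J.nonneg1
  have n2 := J.nonneg2
  set X := J.flow P x Θ with hX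
  -- On the unit ball about `Θ`, `r` bounds the controls, `B` bounds one plus the norm of the
  -- trajectories, and `K` is the Lipschitz constant of the flow at `Θ`.
  set r := ‖Θ‖ + 1 with hr
  set B := 2 * Real.exp (2 * (c0 * (1 + r ^ 2))) * (1 + ‖x‖) with hB
  set K := 2 * Real.exp (2 * (2 * c0 * (1 + r ^ 2))) * (c1 * B * (1 + r + r)) with hK
  have hB0 : 0 ≤ B := by positivity
  have hK0 : 0 ≤ K := by positivity
  have hB' : ∀ Θ' : Lp M 2 (stm P), ‖Θ'‖ ≤ r → 1 + ‖J.flow P x Θ'‖ ≤ B := fun Θ' h =>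
    (J.norm_flow_le P x Θ').trans (by rw [hB]; gcongr)
  have hΘ : ‖Θ‖ ≤ r := by simp [hr]
  refine hasFDerivAt_of_norm_sub_le_sq (C := 2 * Real.exp (2 * (2 * c0 * (1 + r ^ 2))) *
    (2 * c0 * K ^ 2 * (1 + r ^ 2) + 2 * c1 * K * (1 + r + r) + c2 * B)) ?_
  filter_upwards [Metric.ball_mem_nhds Θ one_pos] with Θ' hΘ'
  rw [mem_ball_iff_norm] at hΘ'
  have hr' : ‖Θ'‖ ≤ r := by
    have := norm_add_le Θ (Θ' - Θ)
    rw [add_sub_cancel] at this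
    linarith
  set X' := J.flow P x Θ' with hX'
  have hlip : ‖X' - X‖ ≤ K * ‖Θ' - Θ‖ := by
    refine (J.norm_flow_sub_le P x x Θ Θ').trans ?_
    rw [sub_self, norm_zero, zero_add, hK, mul_assoc _ (c1 * B * (1 + r + r))]
    have := hB' Θ' hr'
    gcongr
  set R := nem P 1 v X' Θ' - nem P 1 v X Θ - (mulPath P 1 (nem P 1 J.vx X Θ) (X' - X) +
      pairLp P (nem P 2 J.vθ X Θ) (Θ' - Θ)) with hR
  have hdiff : X' - X - J.dflow P x Θ (Θ' - Θ) = volterraResolvent P (nem P 1 J.vx X Θ) (cumul P R) := by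
    have h1 : X' - X = cumul P (nem P 1 v X' Θ' - nem P 1 v X Θ) := by
      conv_lhs => rw [hX, hX', J.flow_eq P x Θ, J.flow_eq P x Θ', ← hX, ← hX']
      rw [map_sub]
      abel
    have h2 : cumul P R = (X' - X) - volt P (nem P 1 J.vx X Θ) (X' - X) -
        cumul P (pairLp P (nem P 2 J.vθ X Θ) (Θ' - Θ)) := by
      rw [hR, map_sub, map_add, ← h1, volt_apply]
      abel
    rw [h2, map_sub (volterraResolvent P _), volterraResolvent_apply_sub]
    rfl
  rw [hdiff]
  refine (ContinuousLinearMap.le_opNorm (volterraResolvent P (nem P 1 J.vx X Θ)) (cumul P R)).trans ?_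
  have e1 : ‖volterraResolvent P (nem P 1 J.vx X Θ)‖ ≤ 2 * Real.exp (2 * (2 * c0 * (1 + r ^ 2))) := by
    refine (norm_volterraResolvent_le P _).trans ?_
    have := J.norm_nem_vx_le P X Θ
    have h2 : 2 * c0 * (1 + ‖Θ‖ ^ 2) ≤ 2 * c0 * (1 + r ^ 2) := by gcongr
    gcongr
    linarith
  have e2 : ‖cumul P R‖ ≤ (2 * c0 * K ^ 2 * (1 + r ^ 2) + 2 * c1 * K * (1 + r + r) + c2 * B) *
      ‖Θ' - Θ‖ ^ 2 := by
    refine (norm_cumul_le_norm P R).trans ((J.norm_nem_taylor_le P X X' Θ Θ').trans ?_)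
    have := hB' Θ hΘ
    calc _ ≤ 2 * c0 * (K * ‖Θ' - Θ‖) ^ 2 * (1 + r ^ 2) +
      2 * c1 * (K * ‖Θ' - Θ‖) * (1 + r + r) * ‖Θ' - Θ‖ + c2 * B * ‖Θ' - Θ‖ ^ 2 := by gcongr
      _ = _ := by ring
  rw [mul_assoc]
  gcongr

end VJet

end Flow

/-! ### The second derivative along lines -/

section SecondOrder

variable {Ω : Type*} [MeasurableSpace Ω] (P : Measure Ω) [IsProbabilityMeasure P]
variable {E M F : Type*} [NormedAddCommGroup E] [NormedSpace ℝ E] [NormedAddCommGroup M]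
  [NormedSpace ℝ M] [NormedAddCommGroup F] [NormedSpace ℝ F]

/-- Multiplication of an `L²` function by a bounded operator-valued function. -/
def mulLp : Lp (M →L[ℝ] F) ∞ (stm P) →L[ℝ] Lp M 2 (stm P) →L[ℝ] Lp F 2 (stm P) :=
  (ContinuousLinearMap.id ℝ (M →L[ℝ] F)).holderL (stm P) ∞ 2 2

theorem coeFn_mulLp (A : Lp (M →L[ℝ] F) ∞ (stm P)) (Θ : Lp M 2 (stm P)) :
    mulLp P A Θ =ᵐ[stm P] fun q => A q (Θ q) :=
  ContinuousLinearMap.coeFn_holder (r := 2) (ContinuousLinearMap.id ℝ (M →L[ℝ] F)) A Θ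

theorem norm_mulLp_le (A : Lp (M →L[ℝ] F) ∞ (stm P)) (Θ : Lp M 2 (stm P)) :
    ‖mulLp P A Θ‖ ≤ ‖A‖ * ‖Θ‖ := by
  have h := ContinuousLinearMap.norm_holder_apply_apply_le (r := 2)
    (ContinuousLinearMap.id ℝ (M →L[ℝ] F)) A Θ
  refine h.trans ?_
  gcongr
  exact mul_le_of_le_one_left (norm_nonneg _) ContinuousLinearMap.norm_id_le

theorem coeFn_add_smul (Θ Φ : Lp M 2 (stm P)) (ε : ℝ) :
    (Θ + ε • Φ : Lp M 2 (stm P)) =ᵐ[stm P] fun q => Θ q + ε • Φ q := by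
  filter_upwards [Lp.coeFn_add Θ (ε • Φ), Lp.coeFn_smul ε Φ] with q h1 h2
  rw [h1, Pi.add_apply, h2, Pi.smul_apply]

theorem HasDerivAt.exists_eventually_norm_sub_le {f : ℝ → F} {f' : F} (h : HasDerivAt f f' 0) :
    ∃ K, 0 ≤ K ∧ ∀ᶠ ε in 𝓝 (0 : ℝ), ‖f ε - f 0‖ ≤ K * |ε| := by
  obtain ⟨K, hK0, hK⟩ := h.isBigO_sub.exists_nonneg
  refine ⟨K, hK0, ?_⟩
  filter_upwards [hK.bound] with ε hε
  simpa using hε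

namespace VJet

variable {v : E → M → E} {c0 c1 c2 : ℝ} (J : VJet v c0 c1 c2)
include J

theorem memLp_vθθ (X : Traj E) (Θ : Lp M 2 (stm P)) :
    MemLp (fun q => J.vθθ (X (timeOf q)) (Θ q)) ∞ (stm P) := by
  refine memLp_top_of_bound (aestronglyMeasurable_nem (f := J.vθθ) P J.cont_vθθ X Θ)
    (c2 * (1 + ‖X‖)) (Eventually.of_forall fun q => (J.norm_vθθ _ _).trans ?_)
  have := J.nonneg2
  gcongr
  exact X.norm_coe_le_norm _

theorem coeFn_nem_vθθ (X : Traj E) (Θ : Lp M 2 (stm P)) :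
    nem P ∞ J.vθθ X Θ =ᵐ[stm P] fun q => J.vθθ (X (timeOf q)) (Θ q) :=
  coeFn_nem (J.memLp_vθθ P X Θ)

theorem norm_nem_vθθ_le (X : Traj E) (Θ : Lp M 2 (stm P)) :
    ‖nem P ∞ J.vθθ X Θ‖ ≤ c2 * (1 + ‖X‖) := by
  have n2 := J.nonneg2
  refine (Lp.norm_le_of_ae_bound (C := c2 * (1 + ‖X‖)) (by positivity) ?_).trans ?_
  · filter_upwards [J.coeFn_nem_vθθ P X Θ] with q hq
    rw [hq]
    refine (J.norm_vθθ _ _).trans ?_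
    gcongr
    exact X.norm_coe_le_norm _
  · simp

/-- The pointwise chain rule is lifted to `L¹` by dominated convergence: the difference quotients
are majorised by products of `Θ` and `Φ` that are integrable. -/
theorem hasDerivAt_nem_vx {X : ℝ → Traj E} {ξ : Traj E} (hX : HasDerivAt X ξ 0)
    (Θ Φ : Lp M 2 (stm P)) :
    HasDerivAt (fun ε : ℝ => nem P 1 J.vx (X ε) (Θ + ε • Φ))
      (mulPath P 1 (nem P 1 J.vxx (X 0) Θ) ξ + pairLp P (nem P 2 J.vxθ (X 0) Θ) Φ) 0 := by
  have n0 := J.nonneg0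
  have n1 := J.nonneg1
  obtain ⟨K, hK0, hK⟩ := hX.exists_eventually_norm_sub_le
  refine hasDerivAt_Lp_of_dominated (by norm_num)
    (φ := fun ε q => J.vx (X ε (timeOf q)) (Θ q + ε • Φ q))
    (b := fun q => 2 * c0 * K * (1 + ‖Θ q‖ ^ 2) + 2 * c1 * (‖Φ q‖ + 2 * (‖Θ q‖ * ‖Φ q‖) + ‖Φ q‖ ^ 2))
    (fun ε => ?_) ?_ ?_ ?_
  · filter_upwards [J.nemOne_vx.coeFn (X ε) (Θ + ε • Φ), coeFn_add_smul P Θ Φ ε] with q h1 h2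
    rw [h1, h2]
  · refine memLp_one_iff_integrable.2 ((Integrable.const_mul ?_ _).add (Integrable.const_mul ?_ _))
    · exact (integrable_const _).add (Lp.integrable_norm_sq Θ)
    · exact ((Lp.integrable_norm Φ).add ((Lp.integrable_norm_mul_norm Θ Φ).const_mul 2)).add
        (Lp.integrable_norm_sq Φ)
  · filter_upwards [hK, Metric.ball_mem_nhds (0 : ℝ) one_pos] with ε hε hε1
    rw [mem_ball_zero_iff, Real.norm_eq_abs] at hε1
    refine Eventually.of_forall fun q => ?_
    simp only [zero_smul, add_zero]
    refine (J.vx_sub_le _ _ _ _).trans ?_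
    have h1 : ‖X ε (timeOf q) - X 0 (timeOf q)‖ ≤ K * |ε| :=
      ((X ε - X 0).norm_coe_le_norm _).trans hε
    have h2 : ‖Θ q + ε • Φ q - Θ q‖ = |ε| * ‖Φ q‖ := by
      rw [add_sub_cancel_left, norm_smul, Real.norm_eq_abs]
    have h3 : ‖Θ q + ε • Φ q‖ ≤ ‖Θ q‖ + ‖Φ q‖ := by
      refine (norm_add_le _ _).trans ?_
      rw [norm_smul, Real.norm_eq_abs]
      gcongr
      exact mul_le_of_le_one_left (norm_nonneg _) hε1.le
    rw [h2]
    calc _ ≤ 2 * c0 * (1 + ‖Θ q‖ ^ 2) * (K * |ε|) +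
        2 * c1 * (1 + ‖Θ q‖ + (‖Θ q‖ + ‖Φ q‖)) * (|ε| * ‖Φ q‖) := by gcongr
      _ = _ := by ring
  · filter_upwards [Lp.coeFn_add (mulPath P 1 (nem P 1 J.vxx (X 0) Θ) ξ)
      (pairLp P (nem P 2 J.vxθ (X 0) Θ) Φ), coeFn_mulPath P 1 (nem P 1 J.vxx (X 0) Θ) ξ,
      coeFn_pairLp P (nem P 2 J.vxθ (X 0) Θ) Φ, J.nemOne_vxx.coeFn (X 0) Θ,
      J.nemTwo_vxθ.coeFn (X 0) Θ] with q h1 h2 h3 h4 h5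
    rw [h1, Pi.add_apply, h2, h3, h4, h5]
    have d1 : HasDerivAt (fun ε => X ε (timeOf q)) (ξ (timeOf q)) 0 :=
      (ContinuousLinearMap.hasFDerivAt (Traj.eval (F := E) (timeOf q))).comp_hasDerivAt 0 hX
    have d2 : HasDerivAt (fun ε : ℝ => Θ q + ε • Φ q) (Φ q) 0 := by
      simpa using ((hasDerivAt_id (0 : ℝ)).smul_const (Φ q)).const_add (Θ q)
    have h0 := J.hasFDerivAt_vx (X 0 (timeOf q)) (Θ q + (0 : ℝ) • Φ q)
    have h6 := h0.comp_hasDerivAt (0 : ℝ) (d1.prodMk d2)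
    refine HasDerivAt.congr_deriv h6 ?_
    simp

/-- Here the majorant lies in `L²`, since `v_θθ` is bounded along bounded paths. Dominated
convergence works for one direction `Φ` at a time and gives no uniformity over directions. -/
theorem hasDerivAt_nem_vθ {X : ℝ → Traj E} {ξ : Traj E} (hX : HasDerivAt X ξ 0)
    (Θ Φ : Lp M 2 (stm P)) :
    HasDerivAt (fun ε : ℝ => nem P 2 J.vθ (X ε) (Θ + ε • Φ))
      (mulPath P 2 (nem P 2 J.vθx (X 0) Θ) ξ + mulLp P (nem P ∞ J.vθθ (X 0) Θ) Φ) 0 := by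
  have n1 := J.nonneg1
  have n2 := J.nonneg2
  obtain ⟨K, hK0, hK⟩ := hX.exists_eventually_norm_sub_le
  refine hasDerivAt_Lp_of_dominated (by norm_num)
    (φ := fun ε q => J.vθ (X ε (timeOf q)) (Θ q + ε • Φ q))
    (b := fun q => 2 * c1 * K * (1 + ‖Θ q‖) + c2 * (1 + (‖X 0‖ + 1)) * ‖Φ q‖)
    (fun ε => ?_) ?_ ?_ ?_
  · filter_upwards [J.nemTwo_vθ.coeFn (X ε) (Θ + ε • Φ), coeFn_add_smul P Θ Φ ε] with q h1 h2
    rw [h1, h2]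
  · exact ((memLp_two_norm Θ).const_mul _).add ((Lp.memLp Φ).norm.const_mul _)
  · filter_upwards [hK, hX.continuousAt.eventually (X 0).eventually_norm_le] with ε hε hε1
    refine Eventually.of_forall fun q => ?_
    simp only [zero_smul, add_zero]
    refine (J.vθ_sub_le _ _ _ _).trans ?_
    have h1 : ‖X ε (timeOf q) - X 0 (timeOf q)‖ ≤ K * |ε| :=
      ((X ε - X 0).norm_coe_le_norm _).trans hε
    have h2 : ‖Θ q + ε • Φ q - Θ q‖ = |ε| * ‖Φ q‖ := by
      rw [add_sub_cancel_left, norm_smul, Real.norm_eq_abs]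
    have h3 : ‖X ε (timeOf q)‖ ≤ ‖X 0‖ + 1 := ((X ε).norm_coe_le_norm _).trans hε1
    rw [h2]
    calc _ ≤ 2 * c1 * (1 + ‖Θ q‖) * (K * |ε|) + c2 * (1 + (‖X 0‖ + 1)) * (|ε| * ‖Φ q‖) := by gcongr
      _ = _ := by ring
  · filter_upwards [Lp.coeFn_add (mulPath P 2 (nem P 2 J.vθx (X 0) Θ) ξ)
      (mulLp P (nem P ∞ J.vθθ (X 0) Θ) Φ), coeFn_mulPath P 2 (nem P 2 J.vθx (X 0) Θ) ξ,
      coeFn_mulLp P (nem P ∞ J.vθθ (X 0) Θ) Φ, J.nemTwo_vθx.coeFn (X 0) Θ,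
      J.coeFn_nem_vθθ P (X 0) Θ] with q h1 h2 h3 h4 h5
    rw [h1, Pi.add_apply, h2, h3, h4, h5]
    have d1 : HasDerivAt (fun ε => X ε (timeOf q)) (ξ (timeOf q)) 0 :=
      (ContinuousLinearMap.hasFDerivAt (Traj.eval (F := E) (timeOf q))).comp_hasDerivAt 0 hX
    have d2 : HasDerivAt (fun ε : ℝ => Θ q + ε • Φ q) (Φ q) 0 := by
      simpa using ((hasDerivAt_id (0 : ℝ)).smul_const (Φ q)).const_add (Θ q)
    have h0 := J.hasFDerivAt_vθ (X 0 (timeOf q)) (Θ q + (0 : ℝ) • Φ q)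
    have h6 := h0.comp_hasDerivAt (0 : ℝ) (d1.prodMk d2)
    refine HasDerivAt.congr_deriv h6 ?_
    simp

variable [CompleteSpace E]

/-- The adjoint state: the functional `g ↦ Dℓ(X₁)[(1 - T)⁻¹ ∫ g]₁`. -/
def costate (x : E) (Θ : Lp M 2 (stm P)) (ℓ₁ : E →L[ℝ] ℝ) : Lp E 1 (stm P) →L[ℝ] ℝ :=
  ℓ₁.comp ((Traj.eval 1).comp ((volterraResolvent P (nem P 1 J.vx (J.flow P x Θ) Θ)).comp (cumul P)))

/-- The derivative of `Θ ↦ ℓ(X₁)`, where `ℓ₁ = Dℓ(X₁)`. -/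
def dterm (x : E) (Θ : Lp M 2 (stm P)) (ℓ₁ : E →L[ℝ] ℝ) : Lp M 2 (stm P) →L[ℝ] ℝ :=
  ℓ₁.comp ((Traj.eval 1).comp (J.dflow P x Θ))

/-- The regular part of the second derivative of `Θ ↦ ℓ(X₁)`. -/
def hessCompact (x : E) (Θ : Lp M 2 (stm P)) (ℓ₁ : E →L[ℝ] ℝ) (ℓ₂ : E →L[ℝ] E →L[ℝ] ℝ) :
    Lp M 2 (stm P) →L[ℝ] Lp M 2 (stm P) →L[ℝ] ℝ :=
  let X := J.flow P x Θ
  let Ξ := J.dflow P x Θ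
  let ψ := J.costate P x Θ ℓ₁
  ((ContinuousLinearMap.compL ℝ (Lp M 2 (stm P)) (Traj E) ℝ).flip Ξ).comp
    (((ContinuousLinearMap.compL ℝ (Traj E) E ℝ).flip (Traj.eval 1)).comp
        (ℓ₂.comp ((Traj.eval 1).comp Ξ)) +
      (ContinuousLinearMap.compL ℝ (Traj E) (Lp E 1 (stm P)) ℝ ψ).comp ((mulPath P 1).comp
        ((mulPath P 1 (nem P 1 J.vxx X Θ)).comp Ξ + pairLp P (nem P 2 J.vxθ X Θ)))) +
  (ContinuousLinearMap.compL ℝ (Lp M 2 (stm P)) (Lp E 1 (stm P)) ℝ ψ).comp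
    ((pairLp P).comp ((mulPath P 2 (nem P 2 J.vθx X Θ)).comp Ξ))

/-- The multiplication part of the second derivative of `Θ ↦ ℓ(X₁)`. -/
def hessMul (x : E) (Θ : Lp M 2 (stm P)) (ℓ₁ : E →L[ℝ] ℝ) :
    Lp M 2 (stm P) →L[ℝ] Lp M 2 (stm P) →L[ℝ] ℝ :=
  (ContinuousLinearMap.compL ℝ (Lp M 2 (stm P)) (Lp E 1 (stm P)) ℝ (J.costate P x Θ ℓ₁)).comp
    ((pairLp P).comp (mulLp P (nem P ∞ J.vθθ (J.flow P x Θ) Θ)))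

theorem hasFDerivAt_term {l : E → ℝ} {l1 : E → E →L[ℝ] ℝ} (hl : ∀ x, HasFDerivAt l (l1 x) x)
    (x : E) (Θ : Lp M 2 (stm P)) :
    HasFDerivAt (fun Θ => l (J.flow P x Θ 1)) (J.dterm P x Θ (l1 (J.flow P x Θ 1))) Θ :=
  (hl _).comp Θ ((ContinuousLinearMap.hasFDerivAt (Traj.eval (F := E) 1)).comp Θ
    (J.hasFDerivAt_flow P x Θ))

/-- The product rule for the three factors `Dℓ(X₁)`, the resolvent and `v_θ`. The first yields
`D²ℓ`, the second `v_xx` and `v_xθ`, the third `v_θx` and `v_θθ`. The term with `v_θθ` is the only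
one that does not pass through the derivative of the flow, which is why it is kept apart in
`hessMul`. -/
theorem hasDerivAt_dterm {l1 : E → E →L[ℝ] ℝ} {l2 : E → E →L[ℝ] E →L[ℝ] ℝ}
    (hl : ∀ x, HasFDerivAt l1 (l2 x) x) (x : E) (Θ Φ : Lp M 2 (stm P)) :
    HasDerivAt (fun ε : ℝ => J.dterm P x (Θ + ε • Φ) (l1 (J.flow P x (Θ + ε • Φ) 1)))
      (J.hessCompact P x Θ (l1 (J.flow P x Θ 1)) (l2 (J.flow P x Θ 1)) Φ +
        J.hessMul P x Θ (l1 (J.flow P x Θ 1)) Φ) 0 := by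
  set X : ℝ → Traj E := fun ε => J.flow P x (Θ + ε • Φ) with hXdef
  set ξ := J.dflow P x Θ Φ with hξ
  have h00 : Θ + (0 : ℝ) • Φ = Θ := by simp
  have hX0 : X 0 = J.flow P x Θ := by simp [hXdef]
  have hline : HasDerivAt (fun ε : ℝ => Θ + ε • Φ) Φ 0 := by
    simpa using ((hasDerivAt_id (0 : ℝ)).smul_const Φ).const_add Θ
  have hX : HasDerivAt X ξ 0 := by
    have h1 := J.hasFDerivAt_flow P x (Θ + (0 : ℝ) • Φ)
    have h2 := h1.comp_hasDerivAt (0 : ℝ) hline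
    rw [h00] at h2
    exact h2
  have ha := hasDerivAt_volterraResolvent P (J.hasDerivAt_nem_vx P hX Θ Φ)
  have hb := J.hasDerivAt_nem_vθ P hX Θ Φ
  have hb' := (ContinuousLinearMap.hasFDerivAt (pairLp (M := M) (F := E) P)).comp_hasDerivAt
    (0 : ℝ) hb
  have hb'' := (hasDerivAt_const (0 : ℝ) (cumul (F := E) P)).clm_comp hb'
  have hΞ := ha.clm_comp hb''
  have h1 : HasDerivAt (fun ε => l1 (X ε 1)) (l2 (X 0 1) (ξ 1)) 0 :=
    (hl _).comp_hasDerivAt (0 : ℝ) ((ContinuousLinearMap.hasFDerivAt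
      (Traj.eval (F := E) 1)).comp_hasDerivAt (0 : ℝ) hX)
  have hfin := h1.clm_comp ((hasDerivAt_const (0 : ℝ) (Traj.eval (F := E) 1)).clm_comp hΞ)
  refine hfin.congr_deriv ?_
  ext Ψ
  simp only [Function.comp_apply, h00, hX0]
  simp only [hessCompact, hessMul, costate, dflow, hξ, volt]
  simp
  abel

end VJet

end SecondOrder

/-! ### Norm limits of operators of finite rank -/

section FiniteRank

variable {A B C D : Type*} [NormedAddCommGroup A] [NormedSpace ℝ A] [NormedAddCommGroup B]
  [NormedSpace ℝ B] [NormedAddCommGroup C] [NormedSpace ℝ C] [NormedAddCommGroup D]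
  [NormedSpace ℝ D]

variable (A B) in
/-- The span of the operators of rank one. -/
def rankOneSpan : Submodule ℝ (A →L[ℝ] B) :=
  Submodule.span ℝ {T | ∃ (f : A →L[ℝ] ℝ) (b : B), T = f.smulRight b}

variable (A B) in
/-- The closure in operator norm of the operators of finite rank. -/
def finiteRankClosure : Submodule ℝ (A →L[ℝ] B) := (rankOneSpan A B).topologicalClosure

theorem isClosed_finiteRankClosure : IsClosed (finiteRankClosure A B : Set (A →L[ℝ] B)) :=
  Submodule.isClosed_topologicalClosure _

theorem smulRight_mem_finiteRankClosure (f : A →L[ℝ] ℝ) (b : B) :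
    f.smulRight b ∈ finiteRankClosure A B :=
  Submodule.le_topologicalClosure _ (Submodule.subset_span ⟨f, b, rfl⟩)

/-- The preimage under `Λ` of a closed subspace is a closed subspace, so operators of rank one are
enough. The ideal properties and the passage to transposes follow from this. -/
theorem map_mem_finiteRankClosure (Λ : (A →L[ℝ] B) →L[ℝ] (C →L[ℝ] D))
    (h : ∀ (f : A →L[ℝ] ℝ) (b : B), Λ (f.smulRight b) ∈ finiteRankClosure C D)
    {T : A →L[ℝ] B} (hT : T ∈ finiteRankClosure A B) : Λ T ∈ finiteRankClosure C D := by
  have h1 : rankOneSpan A B ≤ (finiteRankClosure C D).comap (Λ : (A →L[ℝ] B) →ₗ[ℝ] (C →L[ℝ] D)) := by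
    refine Submodule.span_le.2 ?_
    rintro _ ⟨f, b, rfl⟩
    exact h f b
  have h2 : finiteRankClosure A B ≤
      (finiteRankClosure C D).comap (Λ : (A →L[ℝ] B) →ₗ[ℝ] (C →L[ℝ] D)) :=
    Submodule.topologicalClosure_minimal _ h1 (isClosed_finiteRankClosure.preimage Λ.continuous)
  exact h2 hT

theorem comp_mem_finiteRankClosure (S : B →L[ℝ] C) {T : A →L[ℝ] B}
    (hT : T ∈ finiteRankClosure A B) : S.comp T ∈ finiteRankClosure A C :=
  map_mem_finiteRankClosure (ContinuousLinearMap.compL ℝ A B C S) (fun f b => by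
    have : ContinuousLinearMap.compL ℝ A B C S (f.smulRight b) = f.smulRight (S b) := by
      ext a; simp
    rw [this]
    exact smulRight_mem_finiteRankClosure _ _) hT

theorem mem_finiteRankClosure_comp (S : C →L[ℝ] A) {T : A →L[ℝ] B}
    (hT : T ∈ finiteRankClosure A B) : T.comp S ∈ finiteRankClosure C B :=
  map_mem_finiteRankClosure ((ContinuousLinearMap.compL ℝ C A B).flip S) (fun f b => by
    have : (ContinuousLinearMap.compL ℝ C A B).flip S (f.smulRight b) = (f.comp S).smulRight b := by
      ext a; simp
    rw [this]
    exact smulRight_mem_finiteRankClosure _ _) hT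

/-- Precomposition with an approximately finite rank operator is approximately of finite rank. -/
theorem precomp_mem_finiteRankClosure {T : A →L[ℝ] B} (hT : T ∈ finiteRankClosure A B) :
    (ContinuousLinearMap.compL ℝ A B ℝ).flip T ∈ finiteRankClosure (B →L[ℝ] ℝ) (A →L[ℝ] ℝ) :=
  map_mem_finiteRankClosure ((ContinuousLinearMap.compL ℝ A B ℝ).flip) (fun f b => by
    have : (ContinuousLinearMap.compL ℝ A B ℝ).flip (f.smulRight b) =
        (ContinuousLinearMap.apply ℝ ℝ b).smulRight f := by
      ext g a; simp [mul_comm]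
    rw [this]
    exact smulRight_mem_finiteRankClosure _ _) hT

theorem mem_finiteRankClosure_of_finiteDimensional [FiniteDimensional ℝ B] (T : A →L[ℝ] B) :
    T ∈ finiteRankClosure A B := by
  set b := Module.finBasis ℝ B
  have : T = ∑ i, ((LinearMap.toContinuousLinearMap (b.coord i)).comp T).smulRight (b i) := by
    ext a
    simp only [_root_.sum_apply, ContinuousLinearMap.smulRight_apply,
      ContinuousLinearMap.comp_apply, LinearMap.coe_toContinuousLinearMap', Module.Basis.coord_apply]
    exact (b.sum_repr (T a)).symm
  rw [this]
  exact Submodule.sum_mem _ fun i _ => smulRight_mem_finiteRankClosure _ _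

end FiniteRank

/-! ### Approximation of the derivative of the flow, continuity and bounds -/

section CompactFlow

variable {Ω : Type*} [MeasurableSpace Ω] (P : Measure Ω) [IsProbabilityMeasure P]
variable {A E M F : Type*} [NormedAddCommGroup E] [NormedSpace ℝ E] [NormedAddCommGroup M]
  [NormedSpace ℝ M] [NormedAddCommGroup F] [NormedSpace ℝ F] [NormedAddCommGroup A]
  [NormedSpace ℝ A]

/-- A continuous curve of operators, as an operator with values in trajectories. -/
def Traj.toOp : Traj (A →L[ℝ] F) →L[ℝ] A →L[ℝ] Traj F :=
  LinearMap.mkContinuous₂ (LinearMap.mk₂ ℝ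
    (fun (γ : Traj (A →L[ℝ] F)) (a : A) => Traj.mk (fun t => γ t a) (by fun_prop))
    (fun γ γ' a => by ext t; simp) (fun c γ a => by ext t; simp)
    (fun γ a a' => by ext t; simp) (fun c γ a => by ext t; simp)) 1 (fun γ a => by
      rw [one_mul]
      refine (Traj.norm_le _ (by positivity)).2 fun t => ?_
      exact ((γ t).le_opNorm a).trans (by gcongr; exact γ.norm_coe_le_norm t))

theorem Traj.toOp_apply (γ : Traj (A →L[ℝ] F)) (a : A) (t : I) : Traj.toOp γ a t = γ t a := rfl

/-- A fixed profile times a vector. -/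
def Traj.profile (g : C(I, ℝ)) : F →L[ℝ] Traj F :=
  LinearMap.mkContinuous
    { toFun := fun x => Traj.mk (fun t => g t • x) (by fun_prop)
      map_add' := fun x y => by ext t; simp
      map_smul' := fun c x => by ext t; exact smul_comm _ _ _ } ‖g‖
    (fun x => by
      refine (Traj.norm_le _ (by positivity)).2 fun t => ?_
      simp only [LinearMap.coe_mk, AddHom.coe_mk, Traj.mk_apply, norm_smul]
      gcongr
      exact g.norm_coe_le_norm t)

/-- Bernstein polynomials approximate `γ` uniformly in operator norm. Each approximant is a finite
sum of scalar profiles times operators into the finite-dimensional space `F`, hence of finite rank.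
This plays the role of an Arzelà–Ascoli argument. -/
theorem Traj.toOp_mem_finiteRankClosure [FiniteDimensional ℝ F] (γ : Traj (A →L[ℝ] F)) :
    Traj.toOp γ ∈ finiteRankClosure A (Traj F) := by
  obtain ⟨δ, hδ, hlim⟩ : ∃ δ : ℕ → Traj (A →L[ℝ] F),
      (∀ n t, δ n t = ∑ k : Fin (n + 1), bernstein n k t • γ (bernstein.z k)) ∧
        Tendsto δ atTop (𝓝 γ) :=
    ⟨fun n => bernsteinApproximation n (show C(I, A →L[ℝ] F) from γ),
      fun n t => bernsteinApproximation.apply n (show C(I, A →L[ℝ] F) from γ) t,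
      bernsteinApproximation_uniform (E := A →L[ℝ] F) γ⟩
  refine isClosed_finiteRankClosure.mem_of_tendsto
    (((Traj.toOp (A := A) (F := F)).continuous.tendsto γ).comp hlim)
    (Eventually.of_forall fun n => ?_)
  have hsum : Traj.toOp (δ n) =
      ∑ k : Fin (n + 1), (Traj.profile (bernstein n k)).comp (γ (bernstein.z k)) := by
    ext a t
    rw [Traj.toOp_apply, hδ]
    have h2 : ∀ X : Traj F, X t = Traj.eval t X := fun _ => rfl
    rw [h2]
    simp only [_root_.sum_apply, map_sum]
    rfl
  simp only [Function.comp_apply]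
  rw [hsum]
  exact Submodule.sum_mem _ fun k _ =>
    comp_mem_finiteRankClosure _ (mem_finiteRankClosure_of_finiteDimensional _)

/-- At time `t` the operator pairs with the truncation of `β` to times at most `t`. The truncations
depend continuously on `t` in `L²`, because time slices are null, so they form a continuous curve of
operators into `E`. -/
theorem cumul_comp_pairLp_mem_finiteRankClosure [FiniteDimensional ℝ E]
    (β : Lp (M →L[ℝ] E) 2 (stm P)) :
    (cumul P).comp (pairLp P β) ∈ finiteRankClosure (Lp M 2 (stm P)) (Traj E) := by
  have : CompleteSpace E := FiniteDimensional.complete ℝ E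
  set ind : I → Lp (M →L[ℝ] E) 2 (stm P) := fun t =>
    ((Lp.memLp β).indicator (measurableSet_fst_le (t : ℝ))).toLp
  have hind : ∀ t : I, ind t =ᵐ[stm P] {q : ℝ × Ω | q.1 ≤ (t : ℝ)}.indicator β := fun t =>
    MemLp.coeFn_toLp _
  have hcont : Continuous ind := by
    rw [continuous_iff_continuousAt]
    intro t
    refine tendsto_Lp_of_dominated (by norm_num) (φ := fun t : I =>
      {q : ℝ × Ω | q.1 ≤ (t : ℝ)}.indicator β) (b := fun q => ‖β q‖ + ‖β q‖)
      (Eventually.of_forall hind) ((Lp.memLp β).norm.add (Lp.memLp β).norm) ?_ ?_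
    · refine Eventually.of_forall fun s => ?_
      filter_upwards [hind t] with q hq
      rw [hq]
      exact (norm_sub_le _ _).trans (add_le_add (norm_indicator_le_norm_self _ _)
        (norm_indicator_le_norm_self _ _))
    · filter_upwards [ae_fst_ne_stm P (t : ℝ), hind t] with q hq hq2
      rw [hq2]
      rcases lt_or_gt_of_ne hq with h | h
      · have h1 : ∀ᶠ s : I in 𝓝 t, {q : ℝ × Ω | q.1 ≤ (s : ℝ)}.indicator β q = β q := by
          filter_upwards [(continuous_subtype_val.tendsto t).eventually (lt_mem_nhds h)] with s hs
          rw [indicator_of_mem]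
          exact hs.le
        rw [indicator_of_mem (show q ∈ {q : ℝ × Ω | q.1 ≤ (t : ℝ)} from h.le)]
        exact tendsto_const_nhds.congr' (h1.mono fun s hs => hs.symm)
      · have h1 : ∀ᶠ s : I in 𝓝 t, {q : ℝ × Ω | q.1 ≤ (s : ℝ)}.indicator β q = 0 := by
          filter_upwards [(continuous_subtype_val.tendsto t).eventually (gt_mem_nhds h)] with s hs
          rw [indicator_of_notMem]
          simpa using hs
        rw [indicator_of_notMem (show q ∉ {q : ℝ × Ω | q.1 ≤ (t : ℝ)} by simpa using h)]
        exact tendsto_const_nhds.congr' (h1.mono fun s hs => hs.symm)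
  set γ : Traj (Lp M 2 (stm P) →L[ℝ] E) :=
    Traj.mk (fun t => (L1.integralCLM (α := ℝ × Ω) (E := E) (μ := stm P)).comp (pairLp P (ind t)))
      (by fun_prop)
  have : (cumul P).comp (pairLp P β) = Traj.toOp γ := by
    ext Ψ t
    rw [Traj.toOp_apply]
    change cumul P (pairLp P β Ψ) t = L1.integralCLM (pairLp P (ind t) Ψ)
    rw [cumul_apply, ← L1.integral_eq, L1.integral_eq_integral, ← integral_indicator (measurableSet_fst_le _)]
    refine integral_congr_ae ?_
    filter_upwards [coeFn_pairLp P β Ψ, coeFn_pairLp P (ind t) Ψ, hind t] with q h1 h2 h3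
    rw [h2, h3]
    by_cases hq : q ∈ {q : ℝ × Ω | q.1 ≤ (t : ℝ)}
    · rw [indicator_of_mem hq, indicator_of_mem hq, h1]
    · rw [indicator_of_notMem hq, indicator_of_notMem hq]; rfl
  rw [this]
  exact Traj.toOp_mem_finiteRankClosure γ

theorem norm_mulPath_apply_le {p : ℝ≥0∞} [Fact (1 ≤ p)] (α : Lp (E →L[ℝ] F) p (stm P)) (X : Traj E) :
    ‖mulPath P p α X‖ ≤ ‖α‖ * ‖X‖ := by
  have h := ContinuousLinearMap.norm_holder_apply_apply_le (r := p)
    (ContinuousLinearMap.id ℝ (E →L[ℝ] F)) α (pathLp P X)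
  refine h.trans ?_
  gcongr
  · exact mul_le_of_le_one_left (norm_nonneg α)
      (ContinuousLinearMap.norm_id_le (𝕜 := ℝ) (E := E →L[ℝ] F))
  · exact norm_pathLp_le P X

namespace VJet

variable {v : E → M → E} {c0 c1 c2 : ℝ} (J : VJet v c0 c1 c2)
include J

section Bounds

variable [CompleteSpace E]

theorem continuous_flow (Θ : Lp M 2 (stm P)) : Continuous fun x => J.flow P x Θ := by
  have h : LipschitzWith (Real.toNNReal (2 * Real.exp (2 * (2 * c0 * (1 + ‖Θ‖ ^ 2)))))
      fun x => J.flow P x Θ := by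
    refine LipschitzWith.of_dist_le_mul fun x x' => ?_
    rw [dist_eq_norm, dist_eq_norm, Real.coe_toNNReal _ (by positivity)]
    simpa using J.norm_flow_sub_le P x' x Θ Θ
  exact h.continuous

theorem continuous_dflow (Θ : Lp M 2 (stm P)) : Continuous fun x => J.dflow P x Θ := by
  have hX := J.continuous_flow P Θ
  have h1 := (continuous_volterraResolvent (E := E) P).comp ((J.nemOne_vx.continuous Θ).comp hX)
  have h2 := (pairLp (M := M) (F := E) P).continuous.comp ((J.nemTwo_vθ.continuous Θ).comp hX)
  exact h1.clm_comp (continuous_const.clm_comp h2)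

theorem continuous_dterm (Θ : Lp M 2 (stm P)) :
    Continuous fun z : E × (E →L[ℝ] ℝ) => J.dterm P z.1 Θ z.2 :=
  continuous_snd.clm_comp (continuous_const.clm_comp ((J.continuous_dflow P Θ).comp continuous_fst))

theorem continuous_costate (Θ : Lp M 2 (stm P)) :
    Continuous fun z : E × (E →L[ℝ] ℝ) => J.costate P z.1 Θ z.2 := by
  have hX := (J.continuous_flow P Θ).comp (continuous_fst (X := E) (Y := E →L[ℝ] ℝ))
  have h1 := (continuous_volterraResolvent (E := E) P).comp ((J.nemOne_vx.continuous Θ).comp hX)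
  exact continuous_snd.clm_comp (continuous_const.clm_comp (h1.clm_comp continuous_const))

/-- Norm continuity makes the regular part Bochner integrable over the particles. The analogue for
`hessMul` would need `v_θθ` along the flow to be continuous in `L^∞` as a function of `x`, which the
data of `VJet` do not provide. -/
theorem continuous_hessCompact (Θ : Lp M 2 (stm P)) :
    Continuous fun z : E × (E →L[ℝ] ℝ) × (E →L[ℝ] E →L[ℝ] ℝ) =>
      J.hessCompact P z.1 Θ z.2.1 z.2.2 := by
  have hX : Continuous fun z : E × (E →L[ℝ] ℝ) × (E →L[ℝ] E →L[ℝ] ℝ) => J.flow P z.1 Θ :=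
    (J.continuous_flow P Θ).comp continuous_fst
  have hΞ : Continuous fun z : E × (E →L[ℝ] ℝ) × (E →L[ℝ] E →L[ℝ] ℝ) => J.dflow P z.1 Θ :=
    (J.continuous_dflow P Θ).comp continuous_fst
  have hψ : Continuous fun z : E × (E →L[ℝ] ℝ) × (E →L[ℝ] E →L[ℝ] ℝ) => J.costate P z.1 Θ z.2.1 :=
    (J.continuous_costate P Θ).comp (continuous_fst.prodMk (continuous_fst.comp continuous_snd))
  have a1 := (mulPath (E := E) (F := E →L[ℝ] E) P 1).continuous.comp
    ((J.nemOne_vxx.continuous Θ).comp hX)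
  have a2 := (pairLp (M := M) (F := E →L[ℝ] E) P).continuous.comp
    ((J.nemTwo_vxθ.continuous Θ).comp hX)
  have b1 := (mulPath (E := E) (F := M →L[ℝ] E) P 2).continuous.comp
    ((J.nemTwo_vθx.continuous Θ).comp hX)
  have hψ1 := (ContinuousLinearMap.compL ℝ (Traj E) (Lp E 1 (stm P)) ℝ).continuous.comp hψ
  have hψ2 := (ContinuousLinearMap.compL ℝ (Lp M 2 (stm P)) (Lp E 1 (stm P)) ℝ).continuous.comp hψ
  have hpre := (ContinuousLinearMap.compL ℝ (Lp M 2 (stm P)) (Traj E) ℝ).flip.continuous.comp hΞ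
  exact ((hpre.clm_comp ((continuous_const.clm_comp ((continuous_snd.comp continuous_snd).clm_comp
    (continuous_const.clm_comp hΞ))).add (hψ1.clm_comp (continuous_const.clm_comp
      ((a1.clm_comp hΞ).add a2)))))).add
    (hψ2.clm_comp (continuous_const.clm_comp (b1.clm_comp hΞ)))

theorem norm_costate_le (x : E) (Θ : Lp M 2 (stm P)) (ℓ₁ : E →L[ℝ] ℝ) :
    ‖J.costate P x Θ ℓ₁‖ ≤ ‖ℓ₁‖ * (2 * Real.exp (2 * (2 * c0 * (1 + ‖Θ‖ ^ 2)))) := by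
  refine ContinuousLinearMap.opNorm_le_bound _ (by positivity) fun g => ?_
  set R := volterraResolvent P (nem P 1 J.vx (J.flow P x Θ) Θ) with hR
  have hRn : ‖R‖ ≤ 2 * Real.exp (2 * (2 * c0 * (1 + ‖Θ‖ ^ 2))) :=
    (norm_volterraResolvent_le P _).trans (by
      have := J.norm_nem_vx_le P (J.flow P x Θ) Θ
      gcongr)
  change ‖ℓ₁ (R (cumul P g) 1)‖ ≤ _
  calc ‖ℓ₁ (R (cumul P g) 1)‖ ≤ ‖ℓ₁‖ * ‖R (cumul P g) 1‖ := ℓ₁.le_opNorm _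
    _ ≤ ‖ℓ₁‖ * (‖R‖ * ‖g‖) := by
        gcongr
        exact (Traj.norm_coe_le_norm _ _).trans ((R.le_opNorm _).trans
          (by gcongr; exact norm_cumul_le_norm P g))
    _ ≤ ‖ℓ₁‖ * ((2 * Real.exp (2 * (2 * c0 * (1 + ‖Θ‖ ^ 2)))) * ‖g‖) := by gcongr
    _ = _ := by ring

theorem norm_dflow_le (x : E) (Θ : Lp M 2 (stm P)) :
    ‖J.dflow P x Θ‖ ≤ 2 * Real.exp (2 * (2 * c0 * (1 + ‖Θ‖ ^ 2))) *
      (c1 * (1 + ‖J.flow P x Θ‖) * (1 + ‖Θ‖)) := by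
  have n1 := J.nonneg1
  refine ContinuousLinearMap.opNorm_le_bound _ (by positivity) fun Φ => ?_
  set R := volterraResolvent P (nem P 1 J.vx (J.flow P x Θ) Θ) with hR
  set β := nem P 2 J.vθ (J.flow P x Θ) Θ with hβ
  have hRn : ‖R‖ ≤ 2 * Real.exp (2 * (2 * c0 * (1 + ‖Θ‖ ^ 2))) :=
    (norm_volterraResolvent_le P _).trans (by
      have := J.norm_nem_vx_le P (J.flow P x Θ) Θ
      gcongr)
  have hβn : ‖β‖ ≤ c1 * (1 + ‖J.flow P x Θ‖) * (1 + ‖Θ‖) := J.norm_nem_vθ_le P _ _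
  change ‖R (cumul P (pairLp P β Φ))‖ ≤ _
  calc ‖R (cumul P (pairLp P β Φ))‖ ≤ ‖R‖ * (‖β‖ * ‖Φ‖) :=
        (R.le_opNorm _).trans (by
          gcongr
          exact (norm_cumul_le_norm P _).trans (norm_pairLp_le P β Φ))
    _ ≤ (2 * Real.exp (2 * (2 * c0 * (1 + ‖Θ‖ ^ 2)))) *
        ((c1 * (1 + ‖J.flow P x Θ‖) * (1 + ‖Θ‖)) * ‖Φ‖) := by gcongr
    _ = _ := by ring

theorem norm_dterm_le (x : E) (Θ : Lp M 2 (stm P)) (ℓ₁ : E →L[ℝ] ℝ) :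
    ‖J.dterm P x Θ ℓ₁‖ ≤ ‖ℓ₁‖ * ‖J.dflow P x Θ‖ :=
  ContinuousLinearMap.opNorm_le_bound _ (by positivity) fun Φ => by
    change ‖ℓ₁ (J.dflow P x Θ Φ 1)‖ ≤ _
    rw [mul_assoc]
    refine (ℓ₁.le_opNorm _).trans ?_
    gcongr
    exact (Traj.norm_coe_le_norm _ _).trans ((J.dflow P x Θ).le_opNorm _)

/-- The smallness of the multiplication part enters here: `c2` is a factor, and the other factors
are controlled by `c0` and `Θ` without `c1`. -/
theorem norm_hessMul_le (x : E) (Θ : Lp M 2 (stm P)) (ℓ₁ : E →L[ℝ] ℝ) :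
    ‖J.hessMul P x Θ ℓ₁‖ ≤ ‖J.costate P x Θ ℓ₁‖ * (c2 * (1 + ‖J.flow P x Θ‖)) := by
  have n2 := J.nonneg2
  refine ContinuousLinearMap.opNorm_le_bound₂ _ (by positivity) fun Φ Ψ => ?_
  change ‖J.costate P x Θ ℓ₁ (pairLp P (mulLp P (nem P ∞ J.vθθ (J.flow P x Θ) Θ) Φ) Ψ)‖ ≤ _
  refine ((J.costate P x Θ ℓ₁).le_opNorm _).trans ?_
  rw [mul_assoc, mul_assoc]
  gcongr
  refine (norm_pairLp_le P _ _).trans ?_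
  rw [← mul_assoc]
  gcongr
  refine (norm_mulLp_le P _ _).trans ?_
  gcongr
  exact J.norm_nem_vθθ_le P _ _

theorem norm_nem_vxx_le (X : Traj E) (Θ : Lp M 2 (stm P)) :
    ‖nem P 1 J.vxx X Θ‖ ≤ 2 * c0 * (1 + ‖Θ‖ ^ 2) := by
  have := Lp.norm_one_le_of_ae_le (g := nem P 1 J.vxx X Θ) (θ := Θ) (θ' := Θ)
    (φ := Θ) (A := 2 * c0) (B := 0) (D := 0) le_rfl (by
      filter_upwards [J.nemOne_vxx.coeFn X Θ] with q h1
      rw [h1]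
      simpa using J.norm_vxx _ _)
  simpa using this

theorem norm_nem_vxθ_le (X : Traj E) (Θ : Lp M 2 (stm P)) :
    ‖nem P 2 J.vxθ X Θ‖ ≤ 2 * c1 * (1 + ‖Θ‖) := by
  have n1 := J.nonneg1
  have := Lp.norm_two_le_of_ae_le (g := nem P 2 J.vxθ X Θ) (θ := Θ)
    (φ := Θ) (A := 2 * c1) (D := 0) (by positivity) le_rfl (by
      filter_upwards [J.nemTwo_vxθ.coeFn X Θ] with q h1
      rw [h1, zero_mul, add_zero]
      exact J.norm_vxθ _ _)
  simpa using this

theorem norm_nem_vθx_le (X : Traj E) (Θ : Lp M 2 (stm P)) :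
    ‖nem P 2 J.vθx X Θ‖ ≤ 2 * c1 * (1 + ‖Θ‖) := by
  have n1 := J.nonneg1
  have := Lp.norm_two_le_of_ae_le (g := nem P 2 J.vθx X Θ) (θ := Θ)
    (φ := Θ) (A := 2 * c1) (D := 0) (by positivity) le_rfl (by
      filter_upwards [J.nemTwo_vθx.coeFn X Θ] with q h1
      rw [h1, zero_mul, add_zero]
      exact J.norm_vθx _ _)
  simpa using this

theorem norm_hessCompact_le (x : E) (Θ : Lp M 2 (stm P)) (ℓ₁ : E →L[ℝ] ℝ)
    (ℓ₂ : E →L[ℝ] E →L[ℝ] ℝ) :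
    ‖J.hessCompact P x Θ ℓ₁ ℓ₂‖ ≤ ‖ℓ₂‖ * ‖J.dflow P x Θ‖ ^ 2 + ‖J.costate P x Θ ℓ₁‖ *
      ((2 * c0 * (1 + ‖Θ‖ ^ 2)) * ‖J.dflow P x Θ‖ ^ 2 +
        4 * c1 * (1 + ‖Θ‖) * ‖J.dflow P x Θ‖) := by
  have n0 := J.nonneg0
  have n1 := J.nonneg1
  refine ContinuousLinearMap.opNorm_le_bound₂ _ (by positivity) fun Φ Ψ => ?_
  set Ξ := J.dflow P x Θ
  set ψ := J.costate P x Θ ℓ₁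
  set X := J.flow P x Θ
  have e1 : ‖ℓ₂ (Ξ Φ 1) (Ξ Ψ 1)‖ ≤ ‖ℓ₂‖ * (‖Ξ‖ * ‖Φ‖) * (‖Ξ‖ * ‖Ψ‖) := by
    refine (ℓ₂.le_opNorm₂ _ _).trans ?_
    gcongr
    · exact (Traj.norm_coe_le_norm _ _).trans (Ξ.le_opNorm _)
    · exact (Traj.norm_coe_le_norm _ _).trans (Ξ.le_opNorm _)
  have e2 : ‖mulPath P 1 (nem P 1 J.vxx X Θ) (Ξ Φ) + pairLp P (nem P 2 J.vxθ X Θ) Φ‖ ≤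
      (2 * c0 * (1 + ‖Θ‖ ^ 2)) * (‖Ξ‖ * ‖Φ‖) + 2 * c1 * (1 + ‖Θ‖) * ‖Φ‖ := by
    refine (norm_add_le _ _).trans (add_le_add ?_ ?_)
    · refine (norm_mulPath_apply_le P _ _).trans ?_
      gcongr
      · exact J.norm_nem_vxx_le P X Θ
      · exact Ξ.le_opNorm _
    · refine (norm_pairLp_le P _ _).trans ?_
      gcongr
      exact J.norm_nem_vxθ_le P X Θ
  have e3 : ‖ψ (mulPath P 1 (mulPath P 1 (nem P 1 J.vxx X Θ) (Ξ Φ) +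
      pairLp P (nem P 2 J.vxθ X Θ) Φ) (Ξ Ψ))‖ ≤ ‖ψ‖ * (((2 * c0 * (1 + ‖Θ‖ ^ 2)) * (‖Ξ‖ * ‖Φ‖) +
      2 * c1 * (1 + ‖Θ‖) * ‖Φ‖) * (‖Ξ‖ * ‖Ψ‖)) := by
    refine (ψ.le_opNorm _).trans ?_
    gcongr
    refine (norm_mulPath_apply_le P _ _).trans ?_
    gcongr
    exact Ξ.le_opNorm _
  have e4 : ‖ψ (pairLp P (mulPath P 2 (nem P 2 J.vθx X Θ) (Ξ Φ)) Ψ)‖ ≤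
      ‖ψ‖ * ((2 * c1 * (1 + ‖Θ‖)) * (‖Ξ‖ * ‖Φ‖) * ‖Ψ‖) := by
    refine (ψ.le_opNorm _).trans ?_
    gcongr
    refine (norm_pairLp_le P _ _).trans ?_
    gcongr
    refine (norm_mulPath_apply_le P _ _).trans ?_
    gcongr
    · exact J.norm_nem_vθx_le P X Θ
    · exact Ξ.le_opNorm _
  change ‖ℓ₂ (Ξ Φ 1) (Ξ Ψ 1) + ψ (mulPath P 1 (mulPath P 1 (nem P 1 J.vxx X Θ) (Ξ Φ) +
      pairLp P (nem P 2 J.vxθ X Θ) Φ) (Ξ Ψ)) +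
      ψ (pairLp P (mulPath P 2 (nem P 2 J.vθx X Θ) (Ξ Φ)) Ψ)‖ ≤ _
  refine norm_add₃_le.trans ((add_le_add (add_le_add e1 e3) e4).trans (le_of_eq ?_))
  ring

end Bounds

variable [FiniteDimensional ℝ E] [CompleteSpace E]

theorem dflow_mem_finiteRankClosure (x : E) (Θ : Lp M 2 (stm P)) :
    J.dflow P x Θ ∈ finiteRankClosure (Lp M 2 (stm P)) (Traj E) :=
  comp_mem_finiteRankClosure _ (cumul_comp_pairLp_mem_finiteRankClosure P _)

/-- In the terms with `D²ℓ`, `v_xx` and `v_xθ` the derivative of the flow acts on the second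
argument, as a precomposition; in the term with `v_θx` it acts on the first. -/
theorem hessCompact_mem_finiteRankClosure (x : E) (Θ : Lp M 2 (stm P)) (ℓ₁ : E →L[ℝ] ℝ)
    (ℓ₂ : E →L[ℝ] E →L[ℝ] ℝ) : J.hessCompact P x Θ ℓ₁ ℓ₂ ∈
      finiteRankClosure (Lp M 2 (stm P)) (Lp M 2 (stm P) →L[ℝ] ℝ) := by
  have h := J.dflow_mem_finiteRankClosure P x Θ
  refine Submodule.add_mem _ (mem_finiteRankClosure_comp _ (precomp_mem_finiteRankClosure h)) ?_
  exact comp_mem_finiteRankClosure _ (comp_mem_finiteRankClosure _ (comp_mem_finiteRankClosure _ h))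

end VJet

end CompactFlow

/-! ### Averaging over the initial particles -/

/-- The first two derivatives in `x` of a function `l x y` with parameter `y ∈ S`. -/
structure LossJet {E G : Type*} [NormedAddCommGroup E] [NormedSpace ℝ E] [TopologicalSpace G]
    (l : E → G → ℝ) (S : Set G) where
  l1 : E → G → E →L[ℝ] ℝ
  l2 : E → G → E →L[ℝ] E →L[ℝ] ℝ
  cont_l : ContinuousOn (fun z : E × G => l z.1 z.2) (univ ×ˢ S)
  cont_l1 : ContinuousOn (fun z : E × G => l1 z.1 z.2) (univ ×ˢ S)
  cont_l2 : ContinuousOn (fun z : E × G => l2 z.1 z.2) (univ ×ˢ S)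
  hasFDerivAt_l : ∀ y ∈ S, ∀ x, HasFDerivAt (fun x => l x y) (l1 x y) x
  hasFDerivAt_l1 : ∀ y ∈ S, ∀ x, HasFDerivAt (fun x => l1 x y) (l2 x y) x

section Averages

variable {E G M : Type*} [NormedAddCommGroup E] [NormedSpace ℝ E] [FiniteDimensional ℝ E]
  [CompleteSpace E] [TopologicalSpace G] [NormedAddCommGroup M] [NormedSpace ℝ M]

/-- A continuous function of `(x, y)` is bounded on products of balls with compact sets. -/
theorem exists_bound_of_continuousOn_prod {F : Type*} [SeminormedAddCommGroup F] {f : E → G → F}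
    {S T : Set G} (hf : ContinuousOn (fun z : E × G => f z.1 z.2) (univ ×ˢ S)) (hT : IsCompact T)
    (hTS : T ⊆ S) (D : ℝ) :
    ∃ Λ : ℝ, 0 ≤ Λ ∧ ∀ x, ‖x‖ ≤ D → ∀ y ∈ T, ‖f x y‖ ≤ Λ := by
  obtain ⟨Λ, hΛ⟩ := ((isCompact_closedBall (0 : E) D).prod hT).exists_bound_of_continuousOn
    (hf.mono (prod_mono (subset_univ _) hTS))
  refine ⟨max Λ 0, le_max_right _ _, fun x hx y hy => (hΛ (x, y) ⟨?_, hy⟩).trans (le_max_left _ _)⟩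
  simpa using hx

variable {Ω : Type*} [MeasurableSpace Ω] (P : Measure Ω) [IsProbabilityMeasure P]
variable {v : E → M → E} {c0 c1 c2 : ℝ} (J : VJet v c0 c1 c2)
variable {l : E → G → ℝ} {S : Set G} (L : LossJet l S) {K : Set (E × G)}

namespace VJet

/-- The derivative of the loss of the particle `z` with respect to the parameters. -/
def dtermAt (Θ : Lp M 2 (stm P)) (z : E × G) : Lp M 2 (stm P) →L[ℝ] ℝ :=
  J.dterm P z.1 Θ (L.l1 (J.flow P z.1 Θ 1) z.2)

/-- The regular part of the Hessian of the loss of the particle `z`. -/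
def hessCompactAt (Θ : Lp M 2 (stm P)) (z : E × G) :
    Lp M 2 (stm P) →L[ℝ] Lp M 2 (stm P) →L[ℝ] ℝ :=
  J.hessCompact P z.1 Θ (L.l1 (J.flow P z.1 Θ 1) z.2) (L.l2 (J.flow P z.1 Θ 1) z.2)

/-- The multiplication part of the Hessian of the loss of the particle `z`. -/
def hessMulAt (Θ : Lp M 2 (stm P)) (z : E × G) : Lp M 2 (stm P) →L[ℝ] Lp M 2 (stm P) →L[ℝ] ℝ :=
  J.hessMul P z.1 Θ (L.l1 (J.flow P z.1 Θ 1) z.2)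

/-- These are the dominating constants for differentiation under the integral. Compactness of `K`
bounds the starting points, the flow bound `D` puts the endpoints in a ball, and there the
derivatives of the loss are bounded. The dependence on `c1` is harmless, as this bound does not
enter the final constant. -/
theorem exists_uniform_bounds (hK : IsCompact K) (hKS : K ⊆ univ ×ˢ S) (r : ℝ) :
    ∃ B : ℝ, 0 ≤ B ∧ ∀ z ∈ K, ∀ Θ : Lp M 2 (stm P), ‖Θ‖ ≤ r →
      ‖J.dtermAt P L Θ z‖ ≤ B ∧
      ‖J.hessCompactAt P L Θ z‖ ≤ B ∧
      ‖J.hessMulAt P L Θ z‖ ≤ B := by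
  have n0 := J.nonneg0
  have n1 := J.nonneg1
  have n2 := J.nonneg2
  obtain ⟨ρ, hρ⟩ := (hK.image continuous_fst).isBounded.exists_norm_le
  set D := 2 * Real.exp (2 * (c0 * (1 + r ^ 2))) * (1 + |ρ|) with hD
  have hTS : Prod.snd '' K ⊆ S := by
    rintro _ ⟨z, hz, rfl⟩
    exact (hKS hz).2
  obtain ⟨Λ₁, h10, hΛ₁⟩ :=
    exists_bound_of_continuousOn_prod (f := L.l1) L.cont_l1 (hK.image continuous_snd) hTS D
  obtain ⟨Λ₂, h20, hΛ₂⟩ :=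
    exists_bound_of_continuousOn_prod (f := L.l2) L.cont_l2 (hK.image continuous_snd) hTS D
  set e := 2 * Real.exp (2 * (2 * c0 * (1 + r ^ 2)))
  set Bd := e * (c1 * D * (1 + |r|))
  have hD0 : 0 ≤ D := by positivity
  have hBd0 : 0 ≤ Bd := by positivity
  refine ⟨Λ₁ * Bd + (Λ₂ * Bd ^ 2 + Λ₁ * e * ((2 * c0 * (1 + r ^ 2)) * Bd ^ 2 +
    4 * c1 * (1 + |r|) * Bd)) + Λ₁ * e * (c2 * D), by positivity, fun z hz Θ hΘ => ?_⟩
  have hr : ‖Θ‖ ≤ |r| := hΘ.trans (le_abs_self r)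
  have hr2 : ‖Θ‖ ^ 2 ≤ r ^ 2 := by rw [← sq_abs r]; gcongr
  have hX : 1 + ‖J.flow P z.1 Θ‖ ≤ D := by
    refine (J.norm_flow_le P z.1 Θ).trans ?_
    have : ‖z.1‖ ≤ |ρ| := (hρ _ ⟨z, hz, rfl⟩).trans (le_abs_self _)
    rw [hD]
    gcongr
  have hX1 : ‖J.flow P z.1 Θ 1‖ ≤ D := by
    have := (J.flow P z.1 Θ).norm_coe_le_norm 1
    linarith
  have a1 := hΛ₁ _ hX1 z.2 ⟨z, hz, rfl⟩
  have a2 := hΛ₂ _ hX1 z.2 ⟨z, hz, rfl⟩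
  have he : 2 * Real.exp (2 * (2 * c0 * (1 + ‖Θ‖ ^ 2))) ≤ e := by
    simp only [e]
    gcongr
  have b1 : ‖J.dflow P z.1 Θ‖ ≤ Bd := by
    refine (J.norm_dflow_le P z.1 Θ).trans ?_
    simp only [Bd]
    gcongr
  have b2 : ‖J.costate P z.1 Θ (L.l1 (J.flow P z.1 Θ 1) z.2)‖ ≤ Λ₁ * e :=
    (J.norm_costate_le P z.1 Θ _).trans (by gcongr)
  have p1 : 0 ≤ Λ₁ * Bd := by positivity
  have p2 : 0 ≤ Λ₂ * Bd ^ 2 + Λ₁ * e * ((2 * c0 * (1 + r ^ 2)) * Bd ^ 2 +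
    4 * c1 * (1 + |r|) * Bd) := by positivity
  have p3 : 0 ≤ Λ₁ * e * (c2 * D) := by positivity
  refine ⟨?_, ?_, ?_⟩
  · have : ‖J.dtermAt P L Θ z‖ ≤ Λ₁ * Bd :=
      (J.norm_dterm_le P z.1 Θ _).trans (by gcongr)
    linarith
  · have : ‖J.hessCompactAt P L Θ z‖ ≤
        Λ₂ * Bd ^ 2 + Λ₁ * e * ((2 * c0 * (1 + r ^ 2)) * Bd ^ 2 + 4 * c1 * (1 + |r|) * Bd) :=
      (J.norm_hessCompact_le P z.1 Θ _ _).trans (by gcongr)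
    linarith
  · have : ‖J.hessMulAt P L Θ z‖ ≤ Λ₁ * e * (c2 * D) :=
      (J.norm_hessMul_le P z.1 Θ _).trans (by gcongr)
    linarith

variable (Θ : Lp M 2 (stm P))

include J in
theorem continuousOn_endpoint (hKS : K ⊆ univ ×ˢ S) {F : Type*} [TopologicalSpace F] {f : E → G → F}
    (hf : ContinuousOn (fun z : E × G => f z.1 z.2) (univ ×ˢ S)) :
    ContinuousOn (fun z : E × G => f (J.flow P z.1 Θ 1) z.2) K := by
  have h1 : Continuous fun z : E × G => (J.flow P z.1 Θ 1, z.2) :=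
    ((Traj.continuous_eval 1).comp ((J.continuous_flow P Θ).comp continuous_fst)).prodMk
      continuous_snd
  exact hf.comp h1.continuousOn fun z hz => ⟨mem_univ _, (hKS hz).2⟩

theorem continuousOn_dterm (hKS : K ⊆ univ ×ˢ S) :
    ContinuousOn (fun z : E × G => J.dtermAt P L Θ z) K :=
  (J.continuous_dterm P Θ).comp_continuousOn
    (continuousOn_fst.prodMk (J.continuousOn_endpoint P Θ hKS L.cont_l1))

theorem continuousOn_hessCompact (hKS : K ⊆ univ ×ˢ S) :
    ContinuousOn (fun z : E × G => J.hessCompactAt P L Θ z) K := by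
  have h : ContinuousOn (fun z : E × G =>
      (z.1, L.l1 (J.flow P z.1 Θ 1) z.2, L.l2 (J.flow P z.1 Θ 1) z.2)) K :=
    continuousOn_fst.prodMk ((J.continuousOn_endpoint P Θ hKS L.cont_l1).prodMk
      (J.continuousOn_endpoint P Θ hKS L.cont_l2))
  have h2 := (J.continuous_hessCompact P Θ).comp_continuousOn h
  refine h2.congr fun z hz => ?_
  rfl

/-- Translation along the line moves the base point from `0` to any `ε`; differentiation under the
integral asks for the derivative on a whole neighbourhood. -/
theorem hasDerivAt_dterm_line {z : E × G} (hz : z.2 ∈ S) (Φ : Lp M 2 (stm P)) (ε : ℝ) :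
    HasDerivAt (fun ε : ℝ => J.dtermAt P L (Θ + ε • Φ) z)
      (J.hessCompactAt P L (Θ + ε • Φ) z Φ + J.hessMulAt P L (Θ + ε • Φ) z Φ) ε := by
  have h := J.hasDerivAt_dterm P (L.hasFDerivAt_l1 z.2 hz) z.1 (Θ + ε • Φ) Φ
  rw [← sub_self ε] at h
  have h2 := h.comp_sub_const ε ε
  refine h2.congr_of_eventuallyEq (Eventually.of_forall fun ε' => ?_)
  have : Θ + ε • Φ + (ε' - ε) • Φ = Θ + ε' • Φ := by module
  simp only [dtermAt, this]

variable [MeasurableSpace E] [MeasurableSpace G] [OpensMeasurableSpace (E × G)] [T2Space G]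
  (μ : Measure (E × G)) [IsProbabilityMeasure μ]

theorem integrable_of_continuousOn {F : Type*} [NormedAddCommGroup F] {f : E × G → F}
    (hK : IsCompact K) (hμ : ∀ᵐ z ∂μ, z ∈ K) (hf : ContinuousOn f K) : Integrable f μ := by
  have := hf.integrableOn_compact (μ := μ) hK
  rwa [IntegrableOn, Measure.restrict_eq_self_of_ae_mem hμ] at this

/-- The expected loss of the flow. -/
def meanLoss (l : E → G → ℝ) (Θ : Lp M 2 (stm P)) : ℝ := ∫ z, l (J.flow P z.1 Θ 1) z.2 ∂μ

/-- The derivative of the expected loss. -/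
def dMeanLoss : Lp M 2 (stm P) →L[ℝ] ℝ :=
  ∫ z, J.dtermAt P L Θ z ∂μ

/-- The regular part of the Hessian of the expected loss. -/
def meanHessCompact : Lp M 2 (stm P) →L[ℝ] Lp M 2 (stm P) →L[ℝ] ℝ :=
  ∫ z, J.hessCompactAt P L Θ z ∂μ

theorem hasFDerivAt_meanLoss (hK : IsCompact K) (hKS : K ⊆ univ ×ˢ S) (hμ : ∀ᵐ z ∂μ, z ∈ K) :
    HasFDerivAt (J.meanLoss P μ l) (J.dMeanLoss P L Θ μ) Θ := by
  obtain ⟨B, hB0, hB⟩ := J.exists_uniform_bounds P L hK hKS (‖Θ‖ + 1)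
  refine hasFDerivAt_integral_of_dominated_of_fderiv_le
    (F' := fun Θ z => J.dtermAt P L Θ z) (bound := fun _ => B)
    (Metric.ball_mem_nhds Θ one_pos)
    (Eventually.of_forall fun Θ' => (integrable_of_continuousOn μ hK hμ
      (J.continuousOn_endpoint P Θ' hKS L.cont_l)).aestronglyMeasurable)
    (integrable_of_continuousOn μ hK hμ (J.continuousOn_endpoint P Θ hKS L.cont_l))
    (integrable_of_continuousOn μ hK hμ (J.continuousOn_dterm P L Θ hKS)).aestronglyMeasurable
    ?_ (integrable_const _) ?_
  · filter_upwards [hμ] with z hz Θ' hΘ'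
    rw [mem_ball_iff_norm] at hΘ'
    refine (hB z hz Θ' ?_).1
    linarith [norm_sub_norm_le Θ' Θ]
  · filter_upwards [hμ] with z hz Θ' _
    exact J.hasFDerivAt_term P (L.hasFDerivAt_l z.2 (hKS hz).2) z.1 Θ'

/-- In the absence of continuity in `z`, the full second derivative applied to `Φ` is an almost
everywhere limit of difference quotients of `dtermAt`, which are continuous on `K`; the continuous
regular part is then subtracted. -/
theorem aestronglyMeasurable_hessMul (hK : IsCompact K) (hKS : K ⊆ univ ×ˢ S)
    (hμ : ∀ᵐ z ∂μ, z ∈ K) (Φ : Lp M 2 (stm P)) :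
    AEStronglyMeasurable (fun z : E × G =>
      J.hessMulAt P L Θ z Φ) μ := by
  have h1 : AEStronglyMeasurable (fun z : E × G =>
      J.hessCompactAt P L Θ z Φ +
      J.hessMulAt P L Θ z Φ) μ := by
    refine aestronglyMeasurable_of_tendsto_ae (𝓝[≠] (0 : ℝ)) (f := fun ε z =>
      slope (fun ε : ℝ => J.dtermAt P L (Θ + ε • Φ) z) 0 ε)
      (fun ε => ?_) ?_
    · simp only [slope_def_module]
      have h := fun ε : ℝ => (integrable_of_continuousOn μ hK hμ
        (J.continuousOn_dterm P L (Θ + ε • Φ) hKS)).aestronglyMeasurable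
      exact ((h ε).sub (h 0)).const_smul (ε - 0)⁻¹
    · filter_upwards [hμ] with z hz
      have h := J.hasDerivAt_dterm_line P L Θ (hKS hz).2 Φ 0
      rw [hasDerivAt_iff_tendsto_slope] at h
      simpa only [zero_smul, add_zero] using h
  have h2 := (integrable_of_continuousOn μ hK hμ ((J.continuousOn_hessCompact P L Θ hKS).clm_apply
    (continuousOn_const (c := Φ)))).aestronglyMeasurable
  refine (h1.sub h2).congr (Eventually.of_forall fun z => ?_)
  simp

theorem integrable_hessMul (hK : IsCompact K) (hKS : K ⊆ univ ×ˢ S)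
    (hμ : ∀ᵐ z ∂μ, z ∈ K) (Φ : Lp M 2 (stm P)) :
    Integrable (fun z : E × G => J.hessMulAt P L Θ z Φ) μ := by
  obtain ⟨B, hB0, hB⟩ := J.exists_uniform_bounds P L hK hKS ‖Θ‖
  refine Integrable.of_bound (J.aestronglyMeasurable_hessMul P L Θ μ hK hKS hμ Φ) (B * ‖Φ‖) ?_
  filter_upwards [hμ] with z hz
  exact (ContinuousLinearMap.le_opNorm _ _).trans (by gcongr; exact (hB z hz Θ le_rfl).2.2)

theorem hasDerivAt_dMeanLoss (hK : IsCompact K) (hKS : K ⊆ univ ×ˢ S) (hμ : ∀ᵐ z ∂μ, z ∈ K)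
    (Φ : Lp M 2 (stm P)) :
    HasDerivAt (fun ε : ℝ => J.dMeanLoss P L (Θ + ε • Φ) μ)
      (J.meanHessCompact P L Θ μ Φ +
        ∫ z, J.hessMulAt P L Θ z Φ ∂μ) 0 := by
  obtain ⟨B, hB0, hB⟩ := J.exists_uniform_bounds P L hK hKS (‖Θ‖ + ‖Φ‖)
  have hi := integrable_of_continuousOn μ (F := Lp M 2 (stm P) →L[ℝ] Lp M 2 (stm P) →L[ℝ] ℝ)
    (f := J.hessCompactAt P L Θ) hK hμ (J.continuousOn_hessCompact P L Θ hKS)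
  have hiΦ := integrable_of_continuousOn μ hK hμ ((J.continuousOn_hessCompact P L Θ hKS).clm_apply
    (continuousOn_const (c := Φ)))
  have hm := J.integrable_hessMul P L Θ μ hK hKS hμ Φ
  have key := (hasDerivAt_integral_of_dominated_loc_of_deriv_le (μ := μ) (x₀ := (0 : ℝ))
    (F := fun ε z => J.dtermAt P L (Θ + ε • Φ) z)
    (F' := fun ε z => J.hessCompactAt P L (Θ + ε • Φ) z Φ +
        J.hessMulAt P L (Θ + ε • Φ) z Φ)
    (bound := fun _ => B * ‖Φ‖ + B * ‖Φ‖)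
    (Metric.ball_mem_nhds 0 one_pos)
    (Eventually.of_forall fun ε => (integrable_of_continuousOn μ hK hμ
      (J.continuousOn_dterm P L (Θ + ε • Φ) hKS)).aestronglyMeasurable)
    (integrable_of_continuousOn μ hK hμ (J.continuousOn_dterm P L (Θ + (0 : ℝ) • Φ) hKS))
    (by
      simp only [zero_smul, add_zero]
      exact hiΦ.aestronglyMeasurable.add hm.aestronglyMeasurable)
    (by
      filter_upwards [hμ] with z hz ε hε
      rw [mem_ball_zero_iff, Real.norm_eq_abs] at hε
      have hn : ‖Θ + ε • Φ‖ ≤ ‖Θ‖ + ‖Φ‖ := by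
        refine (norm_add_le _ _).trans ?_
        rw [norm_smul, Real.norm_eq_abs]
        gcongr
        exact mul_le_of_le_one_left (norm_nonneg _) hε.le
      refine (norm_add_le _ _).trans (add_le_add ?_ ?_)
      · exact (ContinuousLinearMap.le_opNorm _ _).trans (by gcongr; exact (hB z hz _ hn).2.1)
      · exact (ContinuousLinearMap.le_opNorm _ _).trans (by gcongr; exact (hB z hz _ hn).2.2))
    (integrable_const _)
    (by
      filter_upwards [hμ] with z hz ε _
      exact J.hasDerivAt_dterm_line P L Θ (hKS hz).2 Φ ε)).2
  refine key.congr_deriv ?_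
  simp only [zero_smul, add_zero]
  rw [integral_add hiΦ hm, meanHessCompact, ContinuousLinearMap.integral_apply hi]

/-- A closed convex set contains the averages of its elements with respect to a probability measure.
-/
theorem meanHessCompact_mem_finiteRankClosure (hK : IsCompact K) (hKS : K ⊆ univ ×ˢ S)
    (hμ : ∀ᵐ z ∂μ, z ∈ K) : J.meanHessCompact P L Θ μ ∈
      finiteRankClosure (Lp M 2 (stm P)) (Lp M 2 (stm P) →L[ℝ] ℝ) := by
  have hi := integrable_of_continuousOn μ (F := Lp M 2 (stm P) →L[ℝ] Lp M 2 (stm P) →L[ℝ] ℝ)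
    (f := J.hessCompactAt P L Θ) hK hμ (J.continuousOn_hessCompact P L Θ hKS)
  exact Convex.integral_mem (finiteRankClosure _ _).convex isClosed_finiteRankClosure
    (Eventually.of_forall fun z => J.hessCompact_mem_finiteRankClosure P _ _ _ _) hi

/-- The multiplication part is integrated vector by vector and then assembled into an operator. The
radius in `hΛ` is the Gronwall bound for trajectories from `K`, so `Λ` bounds `Dℓ` at all endpoints;
the second exponential comes from the adjoint state. -/
theorem exists_meanHessMul (hK : IsCompact K) (hKS : K ⊆ univ ×ˢ S) (hμ : ∀ᵐ z ∂μ, z ∈ K)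
    {ρ Λ : ℝ} (hρ0 : 0 ≤ ρ) (hρ : ∀ z ∈ K, ‖z.1‖ ≤ ρ) (hΛ0 : 0 ≤ Λ)
    (hΛ : ∀ z ∈ K, ∀ x, ‖x‖ ≤ 2 * Real.exp (2 * (c0 * (1 + ‖Θ‖ ^ 2))) * (1 + ρ) →
      ‖L.l1 x z.2‖ ≤ Λ) :
    ∃ N : Lp M 2 (stm P) →L[ℝ] Lp M 2 (stm P) →L[ℝ] ℝ,
      (∀ Φ, N Φ = ∫ z, J.hessMulAt P L Θ z Φ ∂μ) ∧
      ‖N‖ ≤ Λ * (2 * Real.exp (2 * (2 * c0 * (1 + ‖Θ‖ ^ 2)))) *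
        (c2 * (2 * Real.exp (2 * (c0 * (1 + ‖Θ‖ ^ 2))) * (1 + ρ))) := by
  have n0 := J.nonneg0
  have n2 := J.nonneg2
  have hi := J.integrable_hessMul P L Θ μ hK hKS hμ
  set C := Λ * (2 * Real.exp (2 * (2 * c0 * (1 + ‖Θ‖ ^ 2)))) *
        (c2 * (2 * Real.exp (2 * (c0 * (1 + ‖Θ‖ ^ 2))) * (1 + ρ))) with hC
  have hC0 : 0 ≤ C := by positivity
  have hb : ∀ z ∈ K, ‖J.hessMulAt P L Θ z‖ ≤ C := by
    intro z hz
    have hX : 1 + ‖J.flow P z.1 Θ‖ ≤ 2 * Real.exp (2 * (c0 * (1 + ‖Θ‖ ^ 2))) * (1 + ρ) :=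
      (J.norm_flow_le P z.1 Θ).trans (by gcongr; exact hρ z hz)
    have hX1 := (J.flow P z.1 Θ).norm_coe_le_norm 1
    have h1 := hΛ z hz (J.flow P z.1 Θ 1) (by linarith)
    refine (J.norm_hessMul_le P z.1 Θ _).trans ?_
    rw [hC]
    gcongr
    exact (J.norm_costate_le P z.1 Θ _).trans (by gcongr)
  refine ⟨LinearMap.mkContinuous
    { toFun := fun Φ => ∫ z, J.hessMulAt P L Θ z Φ ∂μ
      map_add' := fun Φ Ψ => by simp only [map_add]; exact integral_add (hi Φ) (hi Ψ)
      map_smul' := fun c Φ => by simp only [map_smul, RingHom.id_apply]; exact integral_smul c _ }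
    C fun Φ => ?_, fun Φ => rfl, LinearMap.mkContinuous_norm_le _ hC0 _⟩
  have := norm_integral_le_of_norm_le_const (μ := μ)
    (f := fun z => J.hessMulAt P L Θ z Φ) (C := C * ‖Φ‖) (by
      filter_upwards [hμ] with z hz
      exact (ContinuousLinearMap.le_opNorm _ _).trans (by gcongr; exact hb z hz))
  simpa using this

end VJet

end Averages

/-! ### From the decomposition of the Hessian to the Fredholm property -/

section Fredholm

variable {H : Type*} [NormedAddCommGroup H] [InnerProductSpace ℝ H] [CompleteSpace H]

theorem hasFiniteRange_of_mem_rankOneSpan {A B : Type*} [NormedAddCommGroup A] [NormedSpace ℝ A]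
    [NormedAddCommGroup B] [NormedSpace ℝ B] {T : A →L[ℝ] B} (hT : T ∈ rankOneSpan A B) :
    (T : A →ₗ[ℝ] B).HasFiniteRange := by
  induction hT using Submodule.span_induction with
  | mem T hT =>
    obtain ⟨f, b, rfl⟩ := hT
    have : ((f.smulRight b : A →L[ℝ] B) : A →ₗ[ℝ] B) =
        (LinearMap.toSpanSingleton ℝ B b) ∘ₗ (f : A →ₗ[ℝ] ℝ) := by
      ext a; simp
    rw [this]
    exact LinearMap.HasFiniteRange.comp_left LinearMap.HasFiniteRange.of_isNoetherian_rng _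
  | zero => exact LinearMap.HasFiniteRange.zero
  | add S T _ _ hS hT => exact LinearMap.HasFiniteRange.add hS hT
  | smul c T _ hT => exact LinearMap.HasFiniteRange.smul hT c

/-- A small perturbation of a multiple of the identity, plus a limit of finite rank operators, is
a Fredholm operator. -/
theorem isFredholm_smul_id_add_add {c : ℝ} (hc : 0 < c) {M K : H →L[ℝ] H} (hM : ‖M‖ < c)
    (hK : K ∈ finiteRankClosure H H) :
    (c • ContinuousLinearMap.id ℝ H + M + K).IsFredholm := by
  -- The gap `c - ‖M‖` is the admissible error: with `F` so close to `K`, the operator `c + M + (K -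
  -- F)` is invertible by a Neumann series. Its inverse `V` is then a parametrix, with errors `V F`
  -- and `F V` of finite rank.
  obtain ⟨F, hF, hFK⟩ := Metric.mem_closure_iff.1
    (show K ∈ closure (rankOneSpan H H : Set (H →L[ℝ] H)) from hK) (c - ‖M‖) (by linarith)
  set D : H →L[ℝ] H := M + (K - F) with hD
  have hDn : ‖-(c⁻¹ • D)‖ < 1 := by
    rw [norm_neg, norm_smul, norm_inv, Real.norm_eq_abs, abs_of_pos hc, inv_mul_lt_one₀ hc]
    rw [dist_eq_norm] at hFK
    linarith [norm_add_le M (K - F)]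
  have hu : IsUnit (1 - -(c⁻¹ • D)) := isUnit_one_sub_of_norm_lt_one hDn
  have hu2 : IsUnit (c • (1 - -(c⁻¹ • D))) := by
    have h3 : IsUnit (algebraMap ℝ (H →L[ℝ] H) c) := (IsUnit.mk0 c hc.ne').map _
    have := h3.mul hu
    rwa [← Algebra.smul_def] at this
  obtain ⟨u, hu3⟩ := hu2
  have hdec : c • ContinuousLinearMap.id ℝ H + M + K = (u : H →L[ℝ] H) + F := by
    rw [hu3, hD, smul_sub, smul_neg, smul_smul, mul_inv_cancel₀ hc.ne', one_smul]
    change _ = c • ContinuousLinearMap.id ℝ H - -(M + (K - F)) + F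
    abel
  rw [hdec]
  set V : H →L[ℝ] H := ((u⁻¹ : (H →L[ℝ] H)ˣ) : H →L[ℝ] H) with hV
  have hVu : V * (u : H →L[ℝ] H) = 1 := u.inv_mul
  have huV : (u : H →L[ℝ] H) * V = 1 := u.mul_inv
  have hFf := hasFiniteRange_of_mem_rankOneSpan hF
  refine ContinuousLinearMap.IsFredholm.of_isQuasiInverse (v := V) ?_
  constructor
  · refine LinearMap.FiniteRangeSetoid.equiv_iff_hasFiniteRange.2 ?_
    have : ((V : H →ₗ[ℝ] H) ∘ₗ (((u : H →L[ℝ] H) + F : H →L[ℝ] H) : H →ₗ[ℝ] H)) - LinearMap.id =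
        (V : H →ₗ[ℝ] H) ∘ₗ (F : H →ₗ[ℝ] H) := by
      ext x
      have := congrArg (fun T : H →L[ℝ] H => T x) hVu
      simp only [mul_apply_eq_comp, one_apply_eq_self] at this
      simp [this]
    rw [this]
    exact hFf.comp_left _
  · refine LinearMap.FiniteRangeSetoid.equiv_iff_hasFiniteRange.2 ?_
    have : ((((u : H →L[ℝ] H) + F : H →L[ℝ] H) : H →ₗ[ℝ] H) ∘ₗ (V : H →ₗ[ℝ] H)) - LinearMap.id =
        (F : H →ₗ[ℝ] H) ∘ₗ (V : H →ₗ[ℝ] H) := by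
      ext x
      have := congrArg (fun T : H →L[ℝ] H => T x) huV
      simp only [mul_apply_eq_comp, one_apply_eq_self] at this
      simp [this]
    rw [this]
    exact hFf.comp_right _

/-- The Hessian of a functional `G ∘ J + (c / 2) ‖·‖²`, for an isometric embedding `J`. -/
theorem exists_hasHessianAt {H' : Type*} [NormedAddCommGroup H'] [NormedSpace ℝ H']
    (J : H →L[ℝ] H') (hJ : ‖J‖ ≤ 1) {F : H → ℝ} {G : H' → ℝ} {dG : H' → H' →L[ℝ] ℝ} {c : ℝ}
    (hc : 0 < c) (hF : ∀ x, F x = G (J x) + c / 2 * ‖x‖ ^ 2) (hG : ∀ y, HasFDerivAt G (dG y) y)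
    (x : H) {K N : H' →L[ℝ] H' →L[ℝ] ℝ}
    (h2 : ∀ h, HasDerivAt (fun ε : ℝ => dG (J x + ε • h)) (K h + N h) 0)
    (hK : K ∈ finiteRankClosure H' (H' →L[ℝ] ℝ)) :
    ∃ A : H →L[ℝ] H, HasHessianAt F A x ∧ (‖N‖ < c → A.IsFredholm) := by
  -- Gradients live in the Hilbert space `H`, derivatives of `G` in the dual of `H'`: a functional
  -- is restricted along `J` and then represented by Riesz.
  let pull : (H' →L[ℝ] ℝ) →L[ℝ] H :=
    (show (H →L[ℝ] ℝ) ≃ₗᵢ[ℝ] H from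
      (InnerProductSpace.toDual ℝ H).symm).toContinuousLinearEquiv.toContinuousLinearMap.comp
      ((ContinuousLinearMap.compL ℝ H H' ℝ).flip J)
  have hpull : ∀ f : H' →L[ℝ] ℝ, pull f = (InnerProductSpace.toDual ℝ H).symm (f.comp J) :=
    fun f => rfl
  have hFd : ∀ x, HasGradientAt F (pull (dG (J x)) + c • x) x := by
    intro x
    rw [hasGradientAt_iff_hasFDerivAt]
    have a1 := (hG (J x)).comp x J.hasFDerivAt
    have a2 := ((hasStrictFDerivAt_norm_sq x).hasFDerivAt).const_mul (c / 2)
    have a3 := a1.add a2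
    have : F = fun x => (G ∘ J) x + c / 2 * ‖x‖ ^ 2 := funext hF
    rw [this]
    refine a3.congr_fderiv ?_
    ext h
    rw [map_add, hpull, LinearIsometryEquiv.apply_symm_apply]
    simp [InnerProductSpace.toDual_apply_apply]
    ring
  have hgrad : gradient F = fun x => pull (dG (J x)) + c • x := funext fun x => (hFd x).gradient
  refine ⟨c • ContinuousLinearMap.id ℝ H + pull.comp (N.comp J) + pull.comp (K.comp J),
    ⟨Eventually.of_forall fun y => (hFd y).differentiableAt, fun h => ?_⟩, fun hN => ?_⟩
  · rw [hgrad]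
    have b1 := pull.hasFDerivAt.comp_hasDerivAt (0 : ℝ) (h2 (J h))
    have b2 : HasDerivAt (fun ε : ℝ => c • (x + ε • h)) (c • h) 0 := by
      have h3 : HasDerivAt (fun ε : ℝ => x + ε • h) h 0 := by
        simpa using ((hasDerivAt_id (0 : ℝ)).smul_const h).const_add x
      exact h3.const_smul c
    have b3 := b1.add b2
    refine HasDerivAt.congr_deriv (f' := pull (K (J h) + N (J h)) + c • h) ?_ ?_
    · refine b3.congr_of_eventuallyEq (Eventually.of_forall fun ε => ?_)
      simp [map_add, map_smul]
    · simp only [_root_.add_apply, _root_.smul_apply, ContinuousLinearMap.id_apply,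
        ContinuousLinearMap.comp_apply, map_add]
      abel
  · refine isFredholm_smul_id_add_add hc (lt_of_le_of_lt ?_ hN) ?_
    -- Riesz is isometric and `‖J‖ ≤ 1`, so the norm of `N` does not grow and can be compared with
    -- `c`.
    · refine ContinuousLinearMap.opNorm_le_bound _ (norm_nonneg N) fun h => ?_
      rw [ContinuousLinearMap.comp_apply, hpull, LinearIsometryEquiv.norm_map,
        ContinuousLinearMap.comp_apply]
      have hJh : ‖J h‖ ≤ ‖h‖ := by simpa using J.le_of_opNorm_le hJ h
      calc _ ≤ ‖N (J h)‖ * ‖J‖ := ContinuousLinearMap.opNorm_comp_le _ _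
        _ ≤ (‖N‖ * ‖h‖) * 1 := by
            gcongr
            exact (N.le_opNorm _).trans (by gcongr)
        _ = _ := mul_one _
    · exact comp_mem_finiteRankClosure _ (mem_finiteRankClosure_comp _ hK)

end Fredholm

/-! ### Jointly measurable versions of elements of the Bochner space -/

section Uncurry

variable {Ω : Type*} [MeasurableSpace Ω] {P : Measure Ω} [IsProbabilityMeasure P] {m : ℕ}

/-- `Ψ` is a jointly measurable version of `Θ`. -/
def IsUncurrying (Θ : ParamSpace P m) (Ψ : Lp (Eucl m) 2 (stm P)) : Prop :=
  ∀ᵐ t ∂(volume.restrict (Ioo (0 : ℝ) 1)), (fun ω => Ψ (t, ω)) =ᵐ[P] (Θ t : RandVec P m)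

namespace IsUncurrying

variable {Θ Θ' : ParamSpace P m} {Ψ Ψ' : Lp (Eucl m) 2 (stm P)}

theorem add (h : IsUncurrying Θ Ψ) (h' : IsUncurrying Θ' Ψ') :
    IsUncurrying (Θ + Θ') (Ψ + Ψ') := by
  filter_upwards [h, h', Lp.coeFn_add Θ Θ', Measure.ae_ae_of_ae_prod (Lp.coeFn_add Ψ Ψ')]
    with t h1 h2 h3 h4
  rw [h3, Pi.add_apply]
  filter_upwards [h1, h2, h4, Lp.coeFn_add (Θ t : RandVec P m) (Θ' t)] with ω g1 g2 g3 g4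
  rw [g3, g4, Pi.add_apply, Pi.add_apply, g1, g2]

theorem smul (c : ℝ) (h : IsUncurrying Θ Ψ) : IsUncurrying (c • Θ) (c • Ψ) := by
  filter_upwards [h, Lp.coeFn_smul c Θ, Measure.ae_ae_of_ae_prod (Lp.coeFn_smul c Ψ)]
    with t h1 h3 h4
  rw [h3, Pi.smul_apply]
  filter_upwards [h1, h4, Lp.coeFn_smul c (Θ t : RandVec P m)] with ω g1 g3 g4
  rw [g3, g4, Pi.smul_apply, Pi.smul_apply, g1]

theorem sub (h : IsUncurrying Θ Ψ) (h' : IsUncurrying Θ' Ψ') :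
    IsUncurrying (Θ - Θ') (Ψ - Ψ') := by
  have := h.add (h'.smul (-1))
  simpa [sub_eq_add_neg] using this

/-- Fubini. The isometry yields uniqueness of the version, and turns convergent sequences of curves
into Cauchy sequences of versions. -/
theorem norm_eq (h : IsUncurrying Θ Ψ) : ‖Ψ‖ = ‖Θ‖ := by
  have h1 : ‖Ψ‖ ^ 2 = ‖Θ‖ ^ 2 := by
    rw [← Lp.integral_norm_sq Ψ, ← Lp.integral_norm_sq Θ,
      integral_prod _ (Lp.integrable_norm_sq Ψ)]
    refine integral_congr_ae ?_
    filter_upwards [h] with t ht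
    rw [← Lp.integral_norm_sq (Θ t : RandVec P m)]
    refine integral_congr_ae ?_
    filter_upwards [ht] with ω hω
    rw [hω]
  exact (sq_eq_sq₀ (norm_nonneg _) (norm_nonneg _)).1 h1

theorem unique (h : IsUncurrying Θ Ψ) (h' : IsUncurrying Θ Ψ') : Ψ = Ψ' := by
  have := (h.sub h').norm_eq
  rw [sub_self, norm_zero, norm_eq_zero] at this
  exact sub_eq_zero.1 this

/-- At time `t`, every `H n t` bounds the `L¹(Ω)` distance between `Ψ` and `Θ`. The integrals of `H
n` tend to zero, hence the infimum over `n` vanishes for almost every `t`; no subsequence has to be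
extracted. -/
theorem of_tendsto {Θn : ℕ → ParamSpace P m} {Ψn : ℕ → Lp (Eucl m) 2 (stm P)}
    (h : ∀ n, IsUncurrying (Θn n) (Ψn n)) (hΘ : Tendsto Θn atTop (𝓝 Θ))
    (hΨ : Tendsto Ψn atTop (𝓝 Ψ)) : IsUncurrying Θ Ψ := by
  set H : ℕ → ℝ → ℝ≥0∞ := fun n t =>
    (∫⁻ ω, ‖(Ψ - Ψn n) (t, ω)‖ₑ ∂P) + ‖(Θn n - Θ) t‖ₑ with hH
  have hHm : ∀ n, AEMeasurable (H n) (volume.restrict (Ioo (0 : ℝ) 1)) := fun n =>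
    ((Lp.aestronglyMeasurable (Ψ - Ψn n)).enorm.lintegral_prod_right').add
      (Lp.aestronglyMeasurable (Θn n - Θ)).enorm
  have hHi : ∀ n, ∫⁻ t in Ioo (0 : ℝ) 1, H n t ≤ ‖Ψ - Ψn n‖ₑ + ‖Θn n - Θ‖ₑ := by
    intro n
    rw [lintegral_add_right' _ (Lp.aestronglyMeasurable (Θn n - Θ)).enorm,
      ← lintegral_prod _ (Lp.aestronglyMeasurable (Ψ - Ψn n)).enorm, ← eLpNorm_one_eq_lintegral_enorm,
      ← eLpNorm_one_eq_lintegral_enorm, Lp.enorm_def, Lp.enorm_def]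
    exact add_le_add
      (eLpNorm_le_eLpNorm_of_exponent_le one_le_two (Lp.aestronglyMeasurable _))
      (eLpNorm_le_eLpNorm_of_exponent_le one_le_two (Lp.aestronglyMeasurable _))
  have hlim : Tendsto (fun n => ‖Ψ - Ψn n‖ₑ + ‖Θn n - Θ‖ₑ) atTop (𝓝 0) := by
    have h1 : Tendsto (fun n => Ψ - Ψn n) atTop (𝓝 0) := by
      simpa using (tendsto_const_nhds (x := Ψ)).sub hΨ
    have h2 : Tendsto (fun n => Θn n - Θ) atTop (𝓝 0) := by
      simpa using hΘ.sub (tendsto_const_nhds (x := Θ))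
    simpa using h1.enorm.add h2.enorm
  have hzero : ∫⁻ t in Ioo (0 : ℝ) 1, ⨅ n, H n t = 0 := by
    refine le_antisymm (ge_of_tendsto' hlim fun n => ?_) bot_le
    exact (lintegral_mono fun t => iInf_le _ n).trans (hHi n)
  rw [lintegral_eq_zero_iff' (AEMeasurable.iInf hHm)] at hzero
  filter_upwards [hzero, ae_all_iff.2 h, ae_all_iff.2 fun n =>
    Measure.ae_ae_of_ae_prod (Lp.coeFn_sub Ψ (Ψn n)), ae_all_iff.2 fun n => Lp.coeFn_sub (Θn n) Θ,
    (Lp.aestronglyMeasurable Ψ).prodMk_left] with t h0 h1 h2 h3 h4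
  have hle : ∀ n, ∫⁻ ω, ‖Ψ (t, ω) - (Θ t : RandVec P m) ω‖ₑ ∂P ≤ H n t := by
    intro n
    have e1 : ∫⁻ ω, ‖(Θn n t - Θ t : RandVec P m) ω‖ₑ ∂P ≤ ‖(Θn n - Θ) t‖ₑ := by
      rw [h3, Pi.sub_apply, ← eLpNorm_one_eq_lintegral_enorm, Lp.enorm_def]
      exact eLpNorm_le_eLpNorm_of_exponent_le one_le_two (Lp.aestronglyMeasurable _)
    refine le_trans ?_ (add_le_add le_rfl e1)
    rw [← lintegral_add_right' _ (Lp.aestronglyMeasurable _).enorm]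
    refine lintegral_mono_ae ?_
    filter_upwards [h1 n, h2 n, Lp.coeFn_sub (Θn n t : RandVec P m) (Θ t)] with ω g1 g2 g3
    rw [g2, g3, Pi.sub_apply, Pi.sub_apply, ← g1]
    refine le_trans (le_of_eq ?_) (enorm_add_le _ _)
    rw [sub_add_sub_cancel]
  have h5 : ∫⁻ ω, ‖((fun ω => Ψ (t, ω)) - (Θ t : RandVec P m)) ω‖ₑ ∂P = 0 :=
    le_antisymm ((le_iInf hle).trans h0.le) bot_le
  rw [lintegral_eq_zero_iff' (h4.sub (Lp.aestronglyMeasurable (Θ t : RandVec P m))).enorm] at h5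
  filter_upwards [h5] with ω hω
  simpa [sub_eq_zero] using hω

end IsUncurrying

/-- An indicator in time multiplied by a random vector has an explicit version. Sums keep the
property, and limits keep it by the isometry and completeness. -/
theorem exists_isUncurrying (Θ : ParamSpace P m) : ∃ Ψ, IsUncurrying Θ Ψ := by
  refine Lp.induction (by norm_num) (fun Θ : ParamSpace P m => ∃ Ψ, IsUncurrying Θ Ψ) ?_ ?_ ?_ Θ
  · intro c s hs hμs
    have hmem : MemLp (fun q : ℝ × Ω => (s.indicator (fun _ => (1 : ℝ)) q.1 : ℝ) • c q.2) 2 (stm P) := by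
      have h1 : MemLp (fun q : ℝ × Ω => c q.2) 2 (stm P) := (Lp.memLp c).comp_snd _
      refine h1.mono ?_ (Eventually.of_forall fun q => ?_)
      · exact (((measurable_const (a := (1 : ℝ))).indicator hs).comp measurable_fst).aestronglyMeasurable.smul
          h1.aestronglyMeasurable
      · rw [norm_smul]
        refine mul_le_of_le_one_left (norm_nonneg _) ?_
        exact (norm_indicator_le_norm_self (fun _ => (1 : ℝ)) q.1).trans (by simp)
    refine ⟨hmem.toLp, ?_⟩
    have h2 := Lp.simpleFunc.coe_indicatorConst (p := 2)
      (μ := volume.restrict (Ioo (0 : ℝ) 1)) hs hμs.ne c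
    filter_upwards [Measure.ae_ae_of_ae_prod hmem.coeFn_toLp,
      indicatorConstLp_coeFn (p := 2) (hs := hs) (hμs := hμs.ne) (c := c)] with t h3 h4
    rw [h2, h4]
    by_cases ht : t ∈ s
    · simp only [indicator_of_mem ht, one_smul] at h3 ⊢
      exact h3
    · simp only [indicator_of_notMem ht, zero_smul] at h3 ⊢
      filter_upwards [h3, Lp.coeFn_zero (Eucl m) 2 P] with ω g1 g2
      rw [g1, g2, Pi.zero_apply]
  · rintro f g hf hg - ⟨Ψ, hΨ⟩ ⟨Ψ', hΨ'⟩
    exact ⟨Ψ + Ψ', hΨ.add hΨ'⟩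
  · refine IsSeqClosed.isClosed fun Θn Θ hn hΘ => ?_
    choose Ψn hΨn using hn
    have hc : CauchySeq Ψn := by
      have h1 := hΘ.cauchySeq
      rw [Metric.cauchySeq_iff] at h1 ⊢
      intro ε hε
      obtain ⟨N, hN⟩ := h1 ε hε
      refine ⟨N, fun a ha b hb => ?_⟩
      have := hN a ha b hb
      rw [dist_eq_norm] at this ⊢
      rwa [((hΨn a).sub (hΨn b)).norm_eq]
    obtain ⟨Ψ, hΨ⟩ := cauchySeq_tendsto_of_complete hc
    exact ⟨Ψ, IsUncurrying.of_tendsto hΨn hΘ hΨ⟩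

/-- The embedding of the Bochner space `L²(0,1; L²(Ω))` into `L²((0,1) × Ω)`. -/
def uncurryL (P : Measure Ω) [IsProbabilityMeasure P] (m : ℕ) :
    ParamSpace P m →L[ℝ] Lp (Eucl m) 2 (stm P) :=
  LinearMap.mkContinuous
    { toFun := fun Θ => (exists_isUncurrying Θ).choose
      map_add' := fun Θ Θ' => (exists_isUncurrying (Θ + Θ')).choose_spec.unique
        ((exists_isUncurrying Θ).choose_spec.add (exists_isUncurrying Θ').choose_spec)
      map_smul' := fun c Θ => (exists_isUncurrying (c • Θ)).choose_spec.unique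
        ((exists_isUncurrying Θ).choose_spec.smul c) }
    1 fun Θ => by
      rw [one_mul]
      exact (exists_isUncurrying Θ).choose_spec.norm_eq.le

theorem isUncurrying_uncurryL (Θ : ParamSpace P m) : IsUncurrying Θ (uncurryL P m Θ) :=
  (exists_isUncurrying Θ).choose_spec

theorem norm_uncurryL_le : ‖uncurryL P m‖ ≤ 1 := LinearMap.mkContinuous_norm_le _ zero_le_one _

end Uncurry

section

/-! ### Derivatives of the loss and of the network -/

section LossDerivatives

variable {E G F : Type*} [NormedAddCommGroup E] [NormedSpace ℝ E] [NormedAddCommGroup G]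
  [NormedSpace ℝ G] [NormedAddCommGroup F] [NormedSpace ℝ F] [CompleteSpace F]

/-- The parameter set `S` need not be open, so the derivative is computed from a function `g`
analytic at the point that agrees with `f` on `univ ×ˢ S`. That set contains whole lines in the `x`
direction, so the partial derivative of `f` is that of `g`. The result is analytic again, which
allows iteration. -/
theorem AnalyticOn.partial {f : E → G → F} {S : Set G}
    (hf : AnalyticOn ℝ (fun z : E × G => f z.1 z.2) (univ ×ˢ S)) :
    (∀ y ∈ S, ∀ x, HasFDerivAt (fun x => f x y) (fderiv ℝ (fun x => f x y) x) x) ∧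
      AnalyticOn ℝ (fun z : E × G => fderiv ℝ (fun x => f x z.2) z.1) (univ ×ˢ S) := by
  have key : ∀ z ∈ (univ ×ˢ S : Set (E × G)), ∃ g : E × G → F, AnalyticAt ℝ g z ∧
      ∀ w ∈ (univ ×ˢ S : Set (E × G)), f w.1 w.2 = g w := by
    intro z hz
    obtain ⟨g, -, h2, h3⟩ := (hf z hz).exists_analyticAt
    exact ⟨g, h3, fun w hw => h2 (mem_insert_of_mem _ hw)⟩
  have hpart : ∀ (g : E × G → F), (∀ w ∈ (univ ×ˢ S : Set (E × G)), f w.1 w.2 = g w) →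
      ∀ w : E × G, w.2 ∈ S → DifferentiableAt ℝ g w →
      HasFDerivAt (fun x => f x w.2) ((fderiv ℝ g w).comp (ContinuousLinearMap.inl ℝ E G)) w.1 := by
    intro g hg w hw hd
    have h1 : HasFDerivAt (fun x => g (x, w.2))
        ((fderiv ℝ g w).comp (ContinuousLinearMap.inl ℝ E G)) w.1 :=
      HasFDerivAt.comp (g := g) (f := fun x => (x, w.2)) w.1 hd.hasFDerivAt
        (hasFDerivAt_prodMk_left (𝕜 := ℝ) w.1 w.2)
    refine h1.congr_of_eventuallyEq (Eventually.of_forall fun x => ?_)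
    exact hg (x, w.2) ⟨mem_univ _, hw⟩
  constructor
  · intro y hy x
    obtain ⟨g, hg, hfg⟩ := key (x, y) ⟨mem_univ _, hy⟩
    exact (hpart g hfg (x, y) hy hg.differentiableAt).differentiableAt.hasFDerivAt
  · intro z hz
    obtain ⟨g, hg, hfg⟩ := key z hz
    have h1 : AnalyticAt ℝ
        (fun w => (fderiv ℝ g w).comp (ContinuousLinearMap.inl ℝ E G)) z :=
      ((ContinuousLinearMap.compL ℝ E (E × G) F).flip (ContinuousLinearMap.inl ℝ E G)).analyticAt _
        |>.comp hg.fderiv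
    refine (h1.analyticWithinAt (s := univ ×ˢ S)).congr_of_eventuallyEq_insert ?_
    rw [insert_eq_of_mem hz]
    filter_upwards [nhdsWithin_le_nhds hg.eventually_analyticAt, self_mem_nhdsWithin] with w hw hwS
    exact (hpart g hfg w hwS.2 hw.differentiableAt).fderiv

/-- A real analytic loss has continuous derivatives of order two. -/
def LossJet.ofAnalyticOn {l : E → G → ℝ} {S : Set G}
    (hl : AnalyticOn ℝ (fun z : E × G => l z.1 z.2) (univ ×ˢ S)) : LossJet l S where
  l1 x y := fderiv ℝ (fun x => l x y) x
  l2 x y := fderiv ℝ (fun x => fderiv ℝ (fun x => l x y) x) x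
  cont_l := hl.continuousOn
  cont_l1 := hl.partial.2.continuousOn
  cont_l2 := (AnalyticOn.partial (f := fun x y => fderiv ℝ (fun x => l x y) x)
    hl.partial.2).2.continuousOn
  hasFDerivAt_l := hl.partial.1
  hasFDerivAt_l1 := (AnalyticOn.partial (f := fun x y => fderiv ℝ (fun x => l x y) x)
    hl.partial.2).1

end LossDerivatives

section NetworkDerivatives

/-- This replaces the real exponents `(p - j)₊` by the integers `2 - j`, so that `p` disappears from
all constants. -/
theorem Real.rpow_le_one_add_pow {t q : ℝ} (ht : 0 ≤ t) (hq : 0 ≤ q) {k : ℕ} (hqk : q ≤ k) :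
    t ^ q ≤ 1 + t ^ k := by
  rcases le_total t 1 with h | h
  · have := Real.rpow_le_one ht h hq
    have : 0 ≤ t ^ k := by positivity
    linarith
  · have := Real.rpow_le_rpow_of_exponent_le h hqk
    rw [Real.rpow_natCast] at this
    linarith

variable {E M : Type*} [NormedAddCommGroup E] [NormedSpace ℝ E] [NormedAddCommGroup M]
  [NormedSpace ℝ M]

theorem norm_fderiv_fderiv_eq {F : Type*} [NormedAddCommGroup F] [NormedSpace ℝ F] (f : E → F)
    (x : E) : ‖fderiv ℝ (fderiv ℝ f) x‖ = ‖iteratedFDeriv ℝ 2 f x‖ := by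
  rw [← norm_iteratedFDeriv_one, norm_iteratedFDeriv_fderiv]

theorem norm_fderiv_iteratedFDeriv_one_eq {F : Type*} [NormedAddCommGroup F] [NormedSpace ℝ F]
    (f : E → M → F) (x : E) (θ : M) :
    ‖iteratedFDeriv ℝ 1 (fun x' => iteratedFDeriv ℝ 1 (fun θ' => f x' θ') θ) x‖ =
      ‖fderiv ℝ (fun x' => fderiv ℝ (fun θ' => f x' θ') θ) x‖ := by
  have h : (fun x' => iteratedFDeriv ℝ 1 (fun θ' => f x' θ') θ) =
      (continuousMultilinearCurryFin1 ℝ M F).symm ∘ fun x' => fderiv ℝ (fun θ' => f x' θ') θ := by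
    ext x' u
    simp [iteratedFDeriv_one_apply]
  rw [norm_iteratedFDeriv_one, h, LinearIsometryEquiv.comp_fderiv]
  exact LinearIsometry.norm_toContinuousLinearMap_comp
    (continuousMultilinearCurryFin1 ℝ M F).symm.toLinearIsometry

/-- The derivatives of order at most two of a function of two variables, with their bounds. -/
def VJet.ofContDiff {v : E → M → E} {c0 c1 c2 : ℝ} (n0 : 0 ≤ c0) (n1 : 0 ≤ c1) (n2 : 0 ≤ c2)
    (hv : ContDiff ℝ 3 fun z : E × M => v z.1 z.2)
    (h00 : ∀ x θ, ‖v x θ‖ ≤ c0 * (1 + ‖θ‖ ^ 2) * (1 + ‖x‖))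
    (h10 : ∀ x θ, ‖fderiv ℝ (fun x' => v x' θ) x‖ ≤ 2 * c0 * (1 + ‖θ‖ ^ 2))
    (h20 : ∀ x θ, ‖fderiv ℝ (fderiv ℝ (fun x' => v x' θ)) x‖ ≤ 2 * c0 * (1 + ‖θ‖ ^ 2))
    (h01 : ∀ x θ, ‖fderiv ℝ (fun θ' => v x θ') θ‖ ≤ c1 * (1 + ‖θ‖) * (1 + ‖x‖))
    (h11 : ∀ x θ, ‖fderiv ℝ (fun x' => fderiv ℝ (fun θ' => v x' θ') θ) x‖ ≤ 2 * c1 * (1 + ‖θ‖))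
    (h02 : ∀ x θ, ‖fderiv ℝ (fderiv ℝ (fun θ' => v x θ')) θ‖ ≤ c2 * (1 + ‖x‖)) :
    VJet v c0 c1 c2 := by
  set f : E × M → E := fun z => v z.1 z.2 with hf
  set rE := (ContinuousLinearMap.compL ℝ E (E × M) E).flip (ContinuousLinearMap.inl ℝ E M)
  set rM := (ContinuousLinearMap.compL ℝ M (E × M) E).flip (ContinuousLinearMap.inr ℝ E M)
  set D := fderiv ℝ f
  set D2 := fderiv ℝ D
  have hD : ContDiff ℝ 2 D := hv.fderiv_right (by norm_num)
  have hD2 : Continuous D2 := (hD.fderiv_right (m := 1) (by norm_num)).continuous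
  have hd1 : ∀ z, HasFDerivAt f (D z) z := fun z =>
    (hv.differentiable (by norm_num) z).hasFDerivAt
  have hd2 : ∀ z, HasFDerivAt D (D2 z) z := fun z =>
    (hD.differentiable (by norm_num) z).hasFDerivAt
  have a1 : ∀ x θ, HasFDerivAt (fun z : E × M => v z.1 z.2)
      ((rE (D (x, θ))).coprod (rM (D (x, θ)))) (x, θ) := by
    intro x θ
    refine (hd1 (x, θ)).congr_fderiv ?_
    exact (ContinuousLinearMap.coprod_comp_inl_inr (D (x, θ))).symm
  have a2 : ∀ x θ, HasFDerivAt (fun z : E × M => rE (D (z.1, z.2)))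
      (((rE.comp (D2 (x, θ))).comp (ContinuousLinearMap.inl ℝ E M)).coprod
        ((rE.comp (D2 (x, θ))).comp (ContinuousLinearMap.inr ℝ E M))) (x, θ) := by
    intro x θ
    rw [ContinuousLinearMap.coprod_comp_inl_inr]
    exact rE.hasFDerivAt.comp (x, θ) (hd2 (x, θ))
  have a3 : ∀ x θ, HasFDerivAt (fun z : E × M => rM (D (z.1, z.2)))
      (((rM.comp (D2 (x, θ))).comp (ContinuousLinearMap.inl ℝ E M)).coprod
        ((rM.comp (D2 (x, θ))).comp (ContinuousLinearMap.inr ℝ E M))) (x, θ) := by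
    intro x θ
    rw [ContinuousLinearMap.coprod_comp_inl_inr]
    exact rM.hasFDerivAt.comp (x, θ) (hd2 (x, θ))
  have sE : ∀ θ, fderiv ℝ (fun x' => v x' θ) = fun x => rE (D (x, θ)) := fun θ =>
    funext fun x => (HasFDerivAt.slice_left (a1 x θ)).fderiv
  have sM : ∀ x, fderiv ℝ (fun θ' => v x θ') = fun θ => rM (D (x, θ)) := fun x =>
    funext fun θ => (HasFDerivAt.slice_right (a1 x θ)).fderiv
  have b11 : ∀ x θ, ‖(rM.comp (D2 (x, θ))).comp (ContinuousLinearMap.inl ℝ E M)‖ ≤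
      2 * c1 * (1 + ‖θ‖) := by
    intro x θ
    have := h11 x θ
    simp only [sM] at this
    rwa [(HasFDerivAt.slice_left (f := fun x θ => rM (D (x, θ))) (a3 x θ)).fderiv] at this
  exact {
    vx := fun x θ => rE (D (x, θ))
    vθ := fun x θ => rM (D (x, θ))
    vxx := fun x θ => (rE.comp (D2 (x, θ))).comp (ContinuousLinearMap.inl ℝ E M)
    vxθ := fun x θ => (rE.comp (D2 (x, θ))).comp (ContinuousLinearMap.inr ℝ E M)
    vθx := fun x θ => (rM.comp (D2 (x, θ))).comp (ContinuousLinearMap.inl ℝ E M)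
    vθθ := fun x θ => (rM.comp (D2 (x, θ))).comp (ContinuousLinearMap.inr ℝ E M)
    nonneg0 := n0
    nonneg1 := n1
    nonneg2 := n2
    cont_vxx := (continuous_const.clm_comp hD2).clm_comp continuous_const
    cont_vxθ := (continuous_const.clm_comp hD2).clm_comp continuous_const
    cont_vθx := (continuous_const.clm_comp hD2).clm_comp continuous_const
    cont_vθθ := (continuous_const.clm_comp hD2).clm_comp continuous_const
    hasFDerivAt_v := a1
    hasFDerivAt_vx := a2
    hasFDerivAt_vθ := a3
    norm_v := h00
    norm_vx := fun x θ => by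
      have := h10 x θ
      rwa [sE] at this
    norm_vxx := fun x θ => by
      have := h20 x θ
      rw [sE] at this
      rwa [(HasFDerivAt.slice_left (f := fun x θ => rE (D (x, θ))) (a2 x θ)).fderiv] at this
    norm_vθ := fun x θ => by
      have := h01 x θ
      rwa [sM] at this
    -- The hypotheses bound only the `x`-derivative of `v_θ`; symmetry of the second derivative
    -- transfers the bound to the `θ`-derivative of `v_x`.
    norm_vxθ := fun x θ => by
      refine ContinuousLinearMap.opNorm_le_bound₂ _ (by positivity) fun h k => ?_
      have hs : IsSymmSndFDerivAt ℝ f (x, θ) :=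
        hv.contDiffAt.isSymmSndFDerivAt (by simp; norm_num)
      have h1 := hs.eq ((0, h) : E × M) ((k, 0) : E × M)
      have h2 := ((rM.comp (D2 (x, θ))).comp (ContinuousLinearMap.inl ℝ E M)).le_of_opNorm₂_le_of_le
        (b11 x θ) (le_refl ‖k‖) (le_refl ‖h‖)
      change ‖D2 (x, θ) (0, h) (k, 0)‖ ≤ _
      change ‖D2 (x, θ) (k, 0) (0, h)‖ ≤ _ at h2
      rw [h1]
      refine h2.trans (le_of_eq ?_)
      ring
    norm_vθx := b11
    norm_vθθ := fun x θ => by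
      have := h02 x θ
      rw [sM] at this
      rwa [(HasFDerivAt.slice_right (f := fun x θ => rM (D (x, θ))) (a3 x θ)).fderiv] at this }

end NetworkDerivatives

variable {d m : ℕ}

/-- The `C j` are kept unchanged as constants, which is essential for `C 2`. The factors `2` arise
from `1 + ‖x‖ ^ 0` when there is at least one derivative in `x`. -/
theorem HasBoundedDerivatives.nonempty_vjet {v : Eucl d → Eucl m → Eucl d} {p : ℝ} {C : ℕ → ℝ}
    (h : HasBoundedDerivatives v p C) : Nonempty (VJet v (C 0) (C 1) (C 2)) := by
  have hp := h.p_nonneg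
  have hp2 := h.p_lt_two
  have n0 := (h.C_pos 0).le
  have n1 := (h.C_pos 1).le
  have b0 : ∀ θ : Eucl m, ‖θ‖ ^ max (p - ((0 : ℕ) : ℝ)) 0 ≤ 1 + ‖θ‖ ^ 2 := fun θ =>
    Real.rpow_le_one_add_pow (norm_nonneg _) (le_max_right _ _)
      (max_le (by push_cast; linarith) (by positivity))
  have b1 : ∀ θ : Eucl m, ‖θ‖ ^ max (p - ((1 : ℕ) : ℝ)) 0 ≤ 1 + ‖θ‖ := fun θ => by
    have := Real.rpow_le_one_add_pow (norm_nonneg θ) (le_max_right (p - ((1 : ℕ) : ℝ)) 0) (k := 1)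
      (max_le (by push_cast; linarith) (by positivity))
    simpa using this
  have b2 : ∀ θ : Eucl m, ‖θ‖ ^ max (p - ((2 : ℕ) : ℝ)) 0 = 1 := fun θ => by
    rw [max_eq_right (by push_cast; linarith), Real.rpow_zero]
  refine ⟨VJet.ofContDiff n0 n1 (h.C_pos 2).le h.analytic.contDiff (fun x θ => ?_)
    (fun x θ => ?_) (fun x θ => ?_) (fun x θ => ?_) (fun x θ => ?_) (fun x θ => ?_)⟩
  · have hb := h.bound 0 (by simp) 0 x θ
    simp only [norm_iteratedFDeriv_zero, tsub_zero, pow_one] at hb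
    exact hb.trans (by gcongr; exact b0 θ)
  · have hb := h.bound 1 (by simp) 0 x θ
    have e : (fun x' => iteratedFDeriv ℝ 0 (fun θ' => v x' θ') θ) =
        (continuousMultilinearCurryFin0 ℝ (Eucl m) (Eucl d)).symm ∘ fun x' => v x' θ := by
      ext x' u
      simp
    rw [e, LinearIsometryEquiv.norm_iteratedFDeriv_comp_left, norm_iteratedFDeriv_one] at hb
    refine (hb.trans (mul_le_mul_of_nonneg_right (mul_le_mul_of_nonneg_left (b0 θ) n0)
      (by positivity))).trans (le_of_eq ?_)
    norm_num
    ring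
  · have hb := h.bound 2 (by simp) 0 x θ
    have e : (fun x' => iteratedFDeriv ℝ 0 (fun θ' => v x' θ') θ) =
        (continuousMultilinearCurryFin0 ℝ (Eucl m) (Eucl d)).symm ∘ fun x' => v x' θ := by
      ext x' u
      simp
    rw [e, LinearIsometryEquiv.norm_iteratedFDeriv_comp_left, ← norm_fderiv_fderiv_eq] at hb
    refine (hb.trans (mul_le_mul_of_nonneg_right (mul_le_mul_of_nonneg_left (b0 θ) n0)
      (by positivity))).trans (le_of_eq ?_)
    norm_num
    ring
  · have hb := h.bound 0 (by simp) 1 x θ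
    rw [norm_iteratedFDeriv_zero, norm_iteratedFDeriv_one, tsub_zero, pow_one] at hb
    exact hb.trans (by gcongr; exact b1 θ)
  · have hb := h.bound 1 (by simp) 1 x θ
    rw [norm_fderiv_iteratedFDeriv_one_eq] at hb
    refine (hb.trans (mul_le_mul_of_nonneg_right (mul_le_mul_of_nonneg_left (b1 θ) n1)
      (by positivity))).trans (le_of_eq ?_)
    norm_num
    ring
  · have hb := h.bound 0 (by simp) 2 x θ
    rwa [norm_iteratedFDeriv_zero, ← norm_fderiv_fderiv_eq, b2, mul_one, tsub_zero, pow_one] at hb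

end

/-! ### The averaged velocity field -/

/-- A time dependent vector field, integrable in time, of linear growth and with bounded Lipschitz
derivative in space; all bounds are controlled by `a`. -/
structure TransportField {W : Type*} [NormedAddCommGroup W] [NormedSpace ℝ W] (U : ℝ → W → W)
    (a : ℝ → ℝ) where
  DU : ℝ → W → W →L[ℝ] W
  stronglyMeasurable_apply : ∀ z, StronglyMeasurable fun r => U r z
  stronglyMeasurable_DU : ∀ z, StronglyMeasurable fun r => DU r z
  nonneg : ∀ r, 0 ≤ a r
  integrable : Integrable a
  hasFDerivAt : ∀ r z, HasFDerivAt (U r) (DU r z) z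
  norm_le : ∀ r z, ‖U r z‖ ≤ a r * (1 + ‖z‖)
  norm_DU_le : ∀ r z, ‖DU r z‖ ≤ a r
  norm_DU_sub_le : ∀ r z z', ‖DU r z - DU r z'‖ ≤ a r * ‖z - z'‖

section Field

variable {E M : Type*} [NormedAddCommGroup E] [NormedSpace ℝ E] [CompleteSpace E]
  [NormedAddCommGroup M] [NormedSpace ℝ M]
variable {Ω : Type*} [MeasurableSpace Ω] {P : Measure Ω} [IsProbabilityMeasure P]
variable {v : E → M → E} {c0 c1 c2 : ℝ} (J : VJet v c0 c1 c2)

/-- Outside `T` the field will be set to zero, so that its bounds and its differentiability hold at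
every time and not only almost everywhere. -/
theorem exists_good_times (Ψ : Lp M 2 (stm P)) :
    ∃ T : Set ℝ, MeasurableSet T ∧ T ⊆ Ioo 0 1 ∧ (∀ᵐ t, t ∈ Ioo (0 : ℝ) 1 → t ∈ T) ∧
      ∀ t ∈ T, Integrable (fun ω => ‖Ψ (t, ω)‖ ^ 2) P := by
  have h1 : ∀ᵐ t ∂(volume.restrict (Ioo (0 : ℝ) 1)), Integrable (fun ω => ‖Ψ (t, ω)‖ ^ 2) P :=
    (Lp.integrable_norm_sq Ψ).prod_right_ae
  rw [ae_restrict_iff' measurableSet_Ioo] at h1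
  obtain ⟨N, hN, hNm, hN0⟩ := exists_measurable_superset_of_null (ae_iff.1 h1)
  refine ⟨Ioo 0 1 \ N, measurableSet_Ioo.diff hNm, sdiff_subset, ?_, fun t ht => ?_⟩
  · filter_upwards [measure_eq_zero_iff_ae_notMem.1 hN0] with t ht h
    exact ⟨h, ht⟩
  · by_contra hcon
    exact ht.2 (hN fun h => hcon (h ht.1))

namespace VJet

include J in
theorem exists_transportField (Ψ : Lp M 2 (stm P)) :
    ∃ (U : ℝ → E × E → E × E) (a : ℝ → ℝ), Nonempty (TransportField U a) ∧
      (∀ᵐ t, t ∈ Ioo (0 : ℝ) 1 → ∀ z, U t z = (∫ ω, v z.1 (Ψ (t, ω)) ∂P, 0)) := by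
  have n0 := J.nonneg0
  obtain ⟨T, hTm, hT01, hTae, hT⟩ := exists_good_times Ψ
  have hΨ : StronglyMeasurable Ψ := Lp.stronglyMeasurable Ψ
  have hΨt : ∀ t, StronglyMeasurable fun ω => Ψ (t, ω) := fun t =>
    hΨ.comp_measurable measurable_prodMk_left
  have hcv : Continuous fun z : E × M => v z.1 z.2 :=
    continuous_iff_continuousAt.2 fun z => (J.hasFDerivAt_v z.1 z.2).continuousAt
  have hcvx : Continuous fun z : E × M => J.vx z.1 z.2 :=
    continuous_iff_continuousAt.2 fun z => (J.hasFDerivAt_vx z.1 z.2).continuousAt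
  have hv : ∀ x, StronglyMeasurable fun q : ℝ × Ω => v x (Ψ q) := fun x =>
    (hcv.comp (Continuous.prodMk_right x)).comp_stronglyMeasurable hΨ
  have hvx : ∀ x, StronglyMeasurable fun q : ℝ × Ω => J.vx x (Ψ q) := fun x =>
    (hcvx.comp (Continuous.prodMk_right x)).comp_stronglyMeasurable hΨ
  have hvt : ∀ t x, AEStronglyMeasurable (fun ω => v x (Ψ (t, ω))) P := fun t x =>
    ((hv x).comp_measurable measurable_prodMk_left).aestronglyMeasurable
  have hvxt : ∀ t x, AEStronglyMeasurable (fun ω => J.vx x (Ψ (t, ω))) P := fun t x =>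
    ((hvx x).comp_measurable measurable_prodMk_left).aestronglyMeasurable
  set k : ℝ → ℝ := fun t => ∫ ω, 2 * c0 * (1 + ‖Ψ (t, ω)‖ ^ 2) ∂P with hk
  have hki : ∀ t ∈ T, Integrable (fun ω => 2 * c0 * (1 + ‖Ψ (t, ω)‖ ^ 2)) P := fun t ht =>
    ((integrable_const _).add (hT t ht)).const_mul _
  have hk0 : ∀ t, 0 ≤ k t := fun t => integral_nonneg fun ω => by positivity
  have hvi : ∀ t ∈ T, ∀ x, Integrable (fun ω => v x (Ψ (t, ω))) P := fun t ht x => by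
    refine ((hki t ht).mul_const (1 + ‖x‖)).mono' (hvt t x) (Eventually.of_forall fun ω => ?_)
    refine (J.norm_v _ _).trans ?_
    gcongr
    linarith
  have hvxi : ∀ t ∈ T, ∀ x, Integrable (fun ω => J.vx x (Ψ (t, ω))) P := fun t ht x =>
    (hki t ht).mono' (hvxt t x) (Eventually.of_forall fun ω => J.norm_vx _ _)
  set V : ℝ → E → E := fun t => T.indicator (fun t x => ∫ ω, v x (Ψ (t, ω)) ∂P) t with hV
  set DV : ℝ → E → E →L[ℝ] E := fun t => T.indicator (fun t x => ∫ ω, J.vx x (Ψ (t, ω)) ∂P) t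
    with hDV
  have hVd : ∀ t x, HasFDerivAt (V t) (DV t x) x := by
    intro t x
    by_cases ht : t ∈ T
    · simp only [hV, hDV, indicator_of_mem ht]
      exact hasFDerivAt_integral_of_dominated_of_fderiv_le
        (F := fun x ω => v x (Ψ (t, ω))) (F' := fun x ω => J.vx x (Ψ (t, ω))) univ_mem
        (Eventually.of_forall fun x => hvt t x) (hvi t ht x) (hvxt t x)
        (Eventually.of_forall fun ω x _ => J.norm_vx _ _) (hki t ht)
        (Eventually.of_forall fun ω x _ => HasFDerivAt.slice_left (J.hasFDerivAt_v x (Ψ (t, ω))))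
    · simp only [hV, hDV, indicator_of_notMem ht]
      exact hasFDerivAt_const (0 : E) x
  have hVn : ∀ t x, ‖V t x‖ ≤ T.indicator k t * (1 + ‖x‖) := by
    intro t x
    by_cases ht : t ∈ T
    · simp only [hV, indicator_of_mem ht]
      rw [hk, ← integral_mul_const]
      refine norm_integral_le_of_norm_le ((hki t ht).mul_const _) (Eventually.of_forall fun ω => ?_)
      refine (J.norm_v _ _).trans ?_
      gcongr
      linarith
    · simp [hV, indicator_of_notMem ht]
  have hDVn : ∀ t x, ‖DV t x‖ ≤ T.indicator k t := by
    intro t x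
    by_cases ht : t ∈ T
    · simp only [hDV, indicator_of_mem ht]
      exact norm_integral_le_of_norm_le (hki t ht) (Eventually.of_forall fun ω => J.norm_vx _ _)
    · simp [hDV, indicator_of_notMem ht]
  have hDVl : ∀ t x x', ‖DV t x - DV t x'‖ ≤ T.indicator k t * ‖x - x'‖ := by
    intro t x x'
    by_cases ht : t ∈ T
    · simp only [hDV, indicator_of_mem ht]
      rw [hk, ← integral_mul_const, ← integral_sub (hvxi t ht x) (hvxi t ht x')]
      refine norm_integral_le_of_norm_le ((hki t ht).mul_const _) (Eventually.of_forall fun ω => ?_)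
      exact norm_image_sub_le_of_norm_fderiv_le
        (fun y => HasFDerivAt.slice_left (J.hasFDerivAt_vx y (Ψ (t, ω))))
        (fun y => J.norm_vxx _ _) x' x
    · simp [hDV, indicator_of_notMem ht]
  -- The labels are frozen: the field on features and labels has a vanishing second component, so
  -- all bounds reduce to those of `V`.
  refine ⟨fun t z => (V t z.1, 0), T.indicator k, ⟨{
    DU := fun t z => ((ContinuousLinearMap.inl ℝ E E).comp (DV t z.1)).comp
      (ContinuousLinearMap.fst ℝ E E)
    stronglyMeasurable_apply := fun z => ?_
    stronglyMeasurable_DU := fun z => ?_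
    nonneg := fun t => indicator_nonneg (fun t _ => hk0 t) t
    integrable := ?_
    hasFDerivAt := fun t z => ?_
    norm_le := fun t z => ?_
    norm_DU_le := fun t z => ?_
    norm_DU_sub_le := fun t z z' => ?_ }⟩, ?_⟩
  · have h1 : StronglyMeasurable fun t => V t z.1 := by
      have h2 := ((hv z.1).integral_prod_right' (ν := P)).indicator hTm
      have h3 : (fun t => V t z.1) = T.indicator fun t => ∫ ω, v z.1 (Ψ (t, ω)) ∂P := by
        ext1 t
        by_cases ht : t ∈ T <;> simp [hV, ht]
      rwa [h3]
    exact h1.prodMk stronglyMeasurable_const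
  · have h1 : StronglyMeasurable fun t => DV t z.1 := by
      have h2 := ((hvx z.1).integral_prod_right' (ν := P)).indicator hTm
      have h3 : (fun t => DV t z.1) = T.indicator fun t => ∫ ω, J.vx z.1 (Ψ (t, ω)) ∂P := by
        ext1 t
        by_cases ht : t ∈ T <;> simp [hDV, ht]
      rwa [h3]
    exact ((continuous_const.clm_comp continuous_id).clm_comp
      continuous_const).comp_stronglyMeasurable h1
  · rw [integrable_indicator_iff hTm]
    have h1 : Integrable (fun q : ℝ × Ω => 2 * c0 * (1 + ‖Ψ q‖ ^ 2)) (stm P) :=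
      ((integrable_const _).add (Lp.integrable_norm_sq Ψ)).const_mul _
    exact IntegrableOn.mono_set (t := Ioo 0 1) h1.integral_prod_left hT01
  · exact ((ContinuousLinearMap.inl ℝ E E).hasFDerivAt.comp z
      ((hVd t z.1).comp z (ContinuousLinearMap.fst ℝ E E).hasFDerivAt))
  · have : ‖((V t z.1, 0) : E × E)‖ = ‖V t z.1‖ := by simp [Prod.norm_def]
    rw [this]
    refine (hVn t z.1).trans ?_
    have := indicator_nonneg (s := T) (fun t _ => hk0 t) t
    gcongr
    exact norm_fst_le z
  · refine ContinuousLinearMap.opNorm_le_bound _ (indicator_nonneg (fun t _ => hk0 t) t) fun w => ?_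
    have : ‖((DV t z.1 w.1, 0) : E × E)‖ = ‖DV t z.1 w.1‖ := by simp [Prod.norm_def]
    change ‖((DV t z.1 w.1, 0) : E × E)‖ ≤ _
    rw [this]
    exact (ContinuousLinearMap.le_opNorm _ _).trans
      (mul_le_mul (hDVn t z.1) (norm_fst_le w) (norm_nonneg _) (indicator_nonneg (fun t _ => hk0 t) t))
  · have h0 := indicator_nonneg (s := T) (fun t _ => hk0 t) t
    refine ContinuousLinearMap.opNorm_le_bound _ (by positivity) fun w => ?_
    have : ‖(((DV t z.1 - DV t z'.1) w.1, 0) : E × E)‖ = ‖(DV t z.1 - DV t z'.1) w.1‖ := by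
      simp [Prod.norm_def]
    have h2 : (((ContinuousLinearMap.inl ℝ E E).comp (DV t z.1)).comp
      (ContinuousLinearMap.fst ℝ E E) - ((ContinuousLinearMap.inl ℝ E E).comp (DV t z'.1)).comp
      (ContinuousLinearMap.fst ℝ E E)) w = ((DV t z.1 - DV t z'.1) w.1, 0) := by simp
    rw [h2, this]
    refine (ContinuousLinearMap.le_opNorm _ _).trans
      (mul_le_mul ((hDVl t z.1 z'.1).trans ?_) (norm_fst_le w) (norm_nonneg _) (by positivity))
    gcongr
    exact norm_fst_le (z - z')
  · filter_upwards [hTae] with t ht h z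
    simp only [hV, indicator_of_mem (ht h)]

end VJet

end Field

/-! ### Narrowly continuous curves and transported measures -/

theorem AbsolutelyContinuousOnInterval.of_dist_le {X Y : Type*} [PseudoMetricSpace X]
    [PseudoMetricSpace Y] {f : ℝ → X} {g : ℝ → Y} {a b : ℝ}
    (hg : AbsolutelyContinuousOnInterval g a b)
    (h : ∀ s ∈ uIcc a b, ∀ t ∈ uIcc a b, dist (f s) (f t) ≤ dist (g s) (g t)) :
    AbsolutelyContinuousOnInterval f a b := by
  rw [absolutelyContinuousOnInterval_iff] at hg ⊢
  intro ε hε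
  obtain ⟨δ, hδ, hE⟩ := hg ε hε
  refine ⟨δ, hδ, fun E hEm hEl => lt_of_le_of_lt (Finset.sum_le_sum fun i hi => ?_) (hE E hEm hEl)⟩
  exact h _ (hEm.left i hi).left _ (hEm.left i hi).right

section NarrowCurves

variable {W : Type*} [TopologicalSpace W] [TopologicalSpace.PseudoMetrizableSpace W]
  [MeasurableSpace W] [BorelSpace W]

/-- Closed sets form a generating π-system, and the mass of a closed set is a limit of integrals of
bounded continuous functions, each continuous along the curve. -/
theorem measurable_toMeasure_of_continuous {κ : ℝ → ProbabilityMeasure W} (hκ : Continuous κ) :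
    Measurable fun t => (κ t : Measure W) := by
  refine Measurable.measure_of_isPiSystem_of_isProbabilityMeasure (S := {s | IsClosed s})
    ((BorelSpace.measurable_eq (α := W)).trans borel_eq_generateFrom_isClosed)
    isPiSystem_isClosed fun F hF => ?_
  have hF' : IsClosed F := hF
  refine measurable_of_tendsto_metrizable (f := fun n t => ∫⁻ x, (hF'.apprSeq n x : ℝ≥0∞) ∂(κ t))
    (fun n => Continuous.measurable ?_)
    (tendsto_pi_nhds.2 fun t => HasOuterApproxClosed.tendsto_lintegral_apprSeq hF' (κ t))
  exact continuous_iff_continuousAt.2 fun t =>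
    ProbabilityMeasure.tendsto_iff_forall_lintegral_tendsto.1 (hκ.tendsto t) _

theorem aestronglyMeasurable_integral_curve {G : Type*} [NormedAddCommGroup G] [NormedSpace ℝ G]
    {μ : ℝ → ProbabilityMeasure W} (hμ : ContinuousOn μ (Icc 0 1)) {F : ℝ → W → G}
    (hF : StronglyMeasurable (Function.uncurry F)) :
    AEStronglyMeasurable (fun t => ∫ z, F t z ∂(μ t : Measure W))
      (volume.restrict (Icc (0 : ℝ) 1)) := by
  set κ : ℝ → ProbabilityMeasure W := fun t => μ (projIcc 0 1 zero_le_one t) with hκ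
  have hκc : Continuous κ := hμ.comp_continuous (continuous_subtype_val.comp continuous_projIcc)
    fun t => (projIcc 0 1 zero_le_one t).2
  let k : ProbabilityTheory.Kernel ℝ W := ⟨fun t => (κ t : Measure W),
    measurable_toMeasure_of_continuous hκc⟩
  have : ProbabilityTheory.IsMarkovKernel k := ⟨fun t => (inferInstance :
    IsProbabilityMeasure (κ t : Measure W))⟩
  have h1 : StronglyMeasurable fun t => ∫ z, F t z ∂(k t) := hF.integral_kernel_prod_right
  refine ⟨_, h1, ?_⟩
  filter_upwards [ae_restrict_mem measurableSet_Icc] with t ht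
  change _ = ∫ z, F t z ∂(μ (projIcc 0 1 zero_le_one t) : Measure W)
  rw [projIcc_of_mem zero_le_one ht]

end NarrowCurves

namespace TransportField

variable {W : Type*} [NormedAddCommGroup W] [NormedSpace ℝ W] [FiniteDimensional ℝ W]
  [MeasurableSpace W] [BorelSpace W] {U : ℝ → W → W} {a : ℝ → ℝ} (T : TransportField U a)

include T

theorem continuous_apply (r : ℝ) : Continuous (U r) :=
  continuous_iff_continuousAt.2 fun z => (T.hasFDerivAt r z).continuousAt

theorem stronglyMeasurable_uncurry : StronglyMeasurable fun q : ℝ × W => U q.1 q.2 := by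
  have := stronglyMeasurable_uncurry_of_continuous_of_stronglyMeasurable (u := fun z r => U r z)
    T.continuous_apply T.stronglyMeasurable_apply
  exact this.comp_measurable measurable_swap

theorem intervalIntegrable_a (s t : ℝ) : IntervalIntegrable a volume s t :=
  T.integrable.intervalIntegrable

variable {γ : W → ℝ → W} (hγc : Continuous fun q : W × ℝ => γ q.1 q.2)
  (hγ : ∀ z, ∀ t ∈ Icc (0 : ℝ) 1, γ z t = z + ∫ r in (0 : ℝ)..t, U r (γ z r))

include hγc hγ

/-- The integrand is almost everywhere the derivative of `t ↦ φ(t, γ_t)`, which is absolutely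
continuous and vanishes at both ends of `[0,1]`. -/
theorem integral_along_trajectory {φ : ℝ × W → ℝ} (hφ : ContDiff ℝ (⊤ : ℕ∞) φ)
    (hφc : HasCompactSupport φ) (hφs : tsupport φ ⊆ Ioo (0 : ℝ) 1 ×ˢ univ) (z : W) :
    ∫ t in Ioo (0 : ℝ) 1, (fderiv ℝ φ (t, γ z t) (1, 0) + fderiv ℝ φ (t, γ z t) (0, U t (γ z t)))
      = 0 := by
  have hγz : Continuous (γ z) := hγc.comp (Continuous.prodMk_right z)
  set g : ℝ → W := fun r => U r (γ z r) with hg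
  have hgm : StronglyMeasurable g :=
    T.stronglyMeasurable_uncurry.comp_measurable (measurable_id.prodMk hγz.measurable)
  obtain ⟨B, hB⟩ := (isCompact_Icc (a := (0 : ℝ)) (b := 1)).exists_bound_of_continuousOn
    hγz.continuousOn
  have hgi : IntervalIntegrable g volume 0 1 := by
    refine ((T.intervalIntegrable_a 0 1).mul_const (1 + B)).mono_fun' hgm.aestronglyMeasurable ?_
    rw [uIoc_of_le zero_le_one]
    filter_upwards [ae_restrict_mem measurableSet_Ioc] with r hr
    have := hB r ⟨hr.1.le, hr.2⟩
    refine (T.norm_le r _).trans ?_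
    have := T.nonneg r
    gcongr
  set H : ℝ → ℝ := fun t => φ (t, γ z t) with hH
  obtain ⟨K, hK⟩ := hφ.lipschitzWith_of_hasCompactSupport hφc (by simp)
  have hac : AbsolutelyContinuousOnInterval H 0 1 := by
    -- A monotone function whose increments dominate those of `H`: `K` is a Lipschitz constant of
    -- `φ`, and the bracket controls the motion of `(t, γ_t)`.
    have h1 : AbsolutelyContinuousOnInterval (fun t => (K : ℝ) * (t + ∫ r in (0 : ℝ)..t, ‖g r‖)) 0 1 := by
      refine AbsolutelyContinuousOnInterval.const_mul _ (AbsolutelyContinuousOnInterval.add ?_ ?_)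
      · exact (LipschitzWith.id.lipschitzOnWith).absolutelyContinuousOnInterval
      · exact hgi.norm.absolutelyContinuousOnInterval_intervalIntegral (by simp)
    refine h1.of_dist_le ?_
    have key : ∀ s ∈ Icc (0 : ℝ) 1, ∀ t ∈ Icc (0 : ℝ) 1, s ≤ t → dist (H s) (H t) ≤
        dist ((K : ℝ) * (s + ∫ r in (0 : ℝ)..s, ‖g r‖)) ((K : ℝ) * (t + ∫ r in (0 : ℝ)..t, ‖g r‖)) := by
      intro s hs t ht hst
      have is : IntervalIntegrable g volume 0 s := hgi.mono_set (by
        rw [uIcc_of_le hs.1, uIcc_of_le zero_le_one]; exact Icc_subset_Icc_right hs.2)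
      have it : IntervalIntegrable g volume 0 t := hgi.mono_set (by
        rw [uIcc_of_le ht.1, uIcc_of_le zero_le_one]; exact Icc_subset_Icc_right ht.2)
      have e1 : ‖γ z t - γ z s‖ ≤ ∫ r in s..t, ‖g r‖ := by
        rw [hγ z t ht, hγ z s hs, add_sub_add_left_eq_sub, intervalIntegral.integral_interval_sub_left
          it is]
        exact intervalIntegral.norm_integral_le_integral_norm hst
      have e2 : (∫ r in (0 : ℝ)..t, ‖g r‖) - ∫ r in (0 : ℝ)..s, ‖g r‖ = ∫ r in s..t, ‖g r‖ :=
        intervalIntegral.integral_interval_sub_left it.norm is.norm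
      rw [dist_comm, dist_comm (_ * _)]
      refine (hK.dist_le_mul _ _).trans ?_
      rw [Real.dist_eq, ← mul_sub, abs_mul, NNReal.abs_eq]
      gcongr
      rw [Prod.dist_eq, Real.dist_eq, dist_eq_norm, add_sub_add_comm, e2]
      have e3 : 0 ≤ ∫ r in s..t, ‖g r‖ := intervalIntegral.integral_nonneg hst fun r _ => norm_nonneg _
      rw [abs_of_nonneg (by linarith : 0 ≤ t - s), abs_of_nonneg (by linarith)]
      exact max_le (by linarith) (by linarith)
    intro s hs t ht
    rw [uIcc_of_le zero_le_one] at hs ht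
    rcases le_total s t with h | h
    · exact key s hs t ht h
    · rw [dist_comm, dist_comm (_ * _)]
      exact key t ht s hs h
  have hder : ∀ᵐ t, t ∈ Ioo (0 : ℝ) 1 → deriv H t =
      fderiv ℝ φ (t, γ z t) (1, 0) + fderiv ℝ φ (t, γ z t) (0, U t (γ z t)) := by
    filter_upwards [hgi.ae_hasDerivAt_integral] with t ht h
    rw [uIcc_of_le zero_le_one] at ht
    have h1 := ht ⟨h.1.le, h.2.le⟩ 0 (by simp)
    have h2 : HasDerivAt (γ z) (g t) t := by
      refine (h1.const_add z).congr_of_eventuallyEq ?_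
      filter_upwards [Ioo_mem_nhds h.1 h.2] with r hr
      exact hγ z r ⟨hr.1.le, hr.2.le⟩
    have h3 := (hφ.differentiable (by simp) (t, γ z t)).hasFDerivAt.comp_hasDerivAt t
      ((hasDerivAt_id t).prodMk h2)
    rw [← map_add, Prod.mk_add_mk, add_zero, zero_add]
    exact h3.deriv
  have hend : ∀ t : ℝ, t ∉ Ioo (0 : ℝ) 1 → H t = 0 := fun t ht => by
    by_contra hne
    exact ht (hφs (subset_tsupport _ (Function.mem_support.2 hne))).1
  have hmain := hac.integral_deriv_eq_sub
  rw [hend 0 (by simp), hend 1 (by simp), sub_zero, intervalIntegral.integral_of_le zero_le_one,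
    integral_Ioc_eq_integral_Ioo] at hmain
  exact (setIntegral_congr_ae measurableSet_Ioo hder).symm.trans hmain

theorem weak_eq_map {φ : ℝ × W → ℝ} (hφ : ContDiff ℝ (⊤ : ℕ∞) φ)
    (hφc : HasCompactSupport φ) (hφs : tsupport φ ⊆ Ioo (0 : ℝ) 1 ×ˢ univ) (μ₀ : Measure W)
    [IsProbabilityMeasure μ₀] :
    ∫ t in Ioo (0 : ℝ) 1, ∫ z, (fderiv ℝ φ (t, z) (1, 0) + fderiv ℝ φ (t, z) (0, U t z))
      ∂(μ₀.map fun z => γ z t) = 0 := by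
  have hDc : Continuous (fderiv ℝ φ) := hφ.continuous_fderiv (by simp)
  obtain ⟨L, hL⟩ := (hφc.fderiv ℝ).exists_bound_of_continuous hDc
  obtain ⟨ρ, hρ0, hρ⟩ := (hφc.fderiv ℝ).isBounded.exists_pos_norm_le
  have hL0 : 0 ≤ L := (norm_nonneg _).trans (hL 0)
  set G : ℝ × W → ℝ := fun q => fderiv ℝ φ q (1, 0) + fderiv ℝ φ q (0, U q.1 q.2) with hG
  have hGm : StronglyMeasurable G := by
    have h1 : StronglyMeasurable fun q : ℝ × W => fderiv ℝ φ q (1, 0) :=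
      (hDc.clm_apply continuous_const).stronglyMeasurable
    have h2 : StronglyMeasurable fun q : ℝ × W => fderiv ℝ φ q (0, U q.1 q.2) := by
      have h3 : Continuous fun p : (ℝ × W →L[ℝ] ℝ) × W => p.1 (0, p.2) := by fun_prop
      exact h3.comp_stronglyMeasurable
        (hDc.stronglyMeasurable.prodMk T.stronglyMeasurable_uncurry)
    exact h1.add h2
  have hGb : ∀ q, ‖G q‖ ≤ L + L * (a q.1 * (1 + ρ)) := by
    intro q
    by_cases hq : q ∈ tsupport (fderiv ℝ φ)
    · have h1 : ‖q.2‖ ≤ ρ := (norm_snd_le q).trans (hρ q hq)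
      have h2 := T.nonneg q.1
      refine (norm_add_le _ _).trans (add_le_add ?_ ?_)
      · refine ((fderiv ℝ φ q).le_opNorm _).trans ?_
        have : ‖((1 : ℝ), (0 : W))‖ = 1 := by simp [Prod.norm_def]
        rw [this, mul_one]
        exact hL q
      · refine ((fderiv ℝ φ q).le_opNorm _).trans ?_
        have : ‖((0 : ℝ), U q.1 q.2)‖ = ‖U q.1 q.2‖ := by simp [Prod.norm_def]
        rw [this]
        gcongr
        · exact hL q
        · exact (T.norm_le _ _).trans (by gcongr)
    · have h1 : fderiv ℝ φ q = 0 := image_eq_zero_of_notMem_tsupport hq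
      have h2 := T.nonneg q.1
      simp only [hG, h1]
      simp only [_root_.zero_apply, add_zero, norm_zero]
      positivity
  have hγt : ∀ t, Continuous fun z => γ z t := fun t => hγc.comp (Continuous.prodMk_left t)
  have h1 : ∀ t, ∫ z, G (t, z) ∂(μ₀.map fun z => γ z t) = ∫ z, G (t, γ z t) ∂μ₀ := fun t =>
    integral_map (hγt t).aemeasurable
      (hGm.comp_measurable measurable_prodMk_left).aestronglyMeasurable
  change ∫ t in Ioo (0 : ℝ) 1, ∫ z, G (t, z) ∂(μ₀.map fun z => γ z t) = 0
  simp only [h1]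
  rw [integral_integral_swap]
  · refine integral_eq_zero_of_ae (Eventually.of_forall fun z => ?_)
    exact T.integral_along_trajectory hγc hγ hφ hφc hφs z
  · have hm : StronglyMeasurable (Function.uncurry fun (t : ℝ) (z : W) => G (t, γ z t)) :=
      hGm.comp_measurable (measurable_fst.prodMk (hγc.comp continuous_swap).measurable)
    have hi : Integrable (fun q : ℝ × W => L + L * (a q.1 * (1 + ρ)))
        ((volume.restrict (Ioo (0 : ℝ) 1)).prod μ₀) :=
      (integrable_const _).add (((T.integrable.restrict.comp_fst μ₀).mul_const _).const_mul _)
    exact hi.mono' hm.aestronglyMeasurable (Eventually.of_forall fun q => hGb _)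

omit T hγ in
/-- A continuous curve of continuous maps transports a measure narrowly continuously. -/
theorem continuous_map_curve (μ₀ : ProbabilityMeasure W) :
    Continuous fun t : ℝ => μ₀.map (f := fun z => γ z t)
      (hγc.comp (Continuous.prodMk_left t)).aemeasurable := by
  refine continuous_iff_continuousAt.2 fun t =>
    ProbabilityMeasure.tendsto_iff_forall_integral_tendsto.2 fun f => ?_
  have hγt : ∀ t, Continuous fun z => γ z t := fun t => hγc.comp (Continuous.prodMk_left t)
  have h : ∀ t : ℝ, ∫ w, f w ∂((μ₀.map (f := fun z => γ z t) (hγt t).aemeasurable :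
      ProbabilityMeasure W) : Measure W) = ∫ z, f (γ z t) ∂(μ₀ : Measure W) := fun t =>
    integral_map (hγt t).aemeasurable f.continuous.aestronglyMeasurable
  simp only [h]
  refine tendsto_integral_filter_of_dominated_convergence (fun _ => ‖f‖) ?_ ?_ (integrable_const _) ?_
  · exact Eventually.of_forall fun s => (f.continuous.comp (hγt s)).aestronglyMeasurable
  · exact Eventually.of_forall fun s => Eventually.of_forall fun z => f.norm_coe_le_norm _
  · exact Eventually.of_forall fun z =>
      (f.continuous.comp (hγc.comp (Continuous.prodMk_right z))).tendsto t

end TransportField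

/-! ### Mollification and test functions of class `C^{1,1}` -/

section Mollification

variable {W : Type*} [NormedAddCommGroup W] [NormedSpace ℝ W] [FiniteDimensional ℝ W]
  [MeasurableSpace W] [BorelSpace W]

/-- The standard mollification at scale `ε`. -/
def mollify {ε : ℝ} (hε : 0 < ε) (f : W → ℝ) : W → ℝ :=
  convolution ((⟨ε / 2, ε, by positivity, by linarith⟩ : ContDiffBump (0 : W)).normed
    Measure.addHaar) f (ContinuousLinearMap.lsmul ℝ ℝ) Measure.addHaar

variable {ε : ℝ} (hε : 0 < ε) {f : W → ℝ}

theorem contDiff_mollify (hf : Continuous f) : ContDiff ℝ (⊤ : ℕ∞) (mollify hε f) :=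
  (ContDiffBump.hasCompactSupport_normed _).contDiff_convolution_left _
    (ContDiffBump.contDiff_normed _) hf.locallyIntegrable

theorem dist_mollify_le (hf : Continuous f) {x : W} {δ : ℝ}
    (h : ∀ y, ‖y - x‖ < ε → |f y - f x| ≤ δ) : |mollify hε f x - f x| ≤ δ :=
  ContDiffBump.dist_normed_convolution_le hf.aestronglyMeasurable fun y hy =>
    h y (mem_ball_iff_norm.1 hy)

theorem mollify_eq_zero {ρ : ℝ} (hf : ∀ z, ρ ≤ 1 + ‖z‖ → f z = 0) {z : W}
    (hz : ρ + ε ≤ 1 + ‖z‖) : mollify hε f z = 0 := by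
  have h0 : f z = 0 := hf z (by linarith)
  refine (ContDiffBump.normed_convolution_eq_right fun y hy => ?_).trans h0
  rw [h0]
  refine hf y ?_
  have h1 : ‖y - z‖ < ε := mem_ball_iff_norm.1 hy
  have := norm_sub_norm_le z y
  rw [norm_sub_rev] at this
  linarith

theorem integrable_mollify (hf : Continuous f) (x : W) : Integrable (fun t : W =>
    (⟨ε / 2, ε, by positivity, by linarith⟩ : ContDiffBump (0 : W)).normed
      Measure.addHaar t * f (x - t)) Measure.addHaar :=
  Continuous.integrable_of_hasCompactSupport
    ((ContDiffBump.continuous_normed _).mul (by fun_prop))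
    (HasCompactSupport.mul_right (ContDiffBump.hasCompactSupport_normed _))

theorem abs_mollify_sub_le (hf : Continuous f) {K : ℝ}
    (hK : ∀ z z', |f z - f z'| ≤ K * ‖z - z'‖) (z z' : W) :
    |mollify hε f z - mollify hε f z'| ≤ K * ‖z - z'‖ := by
  set φ : ContDiffBump (0 : W) := ⟨ε / 2, ε, by positivity, by linarith⟩ with hφ
  have h1 : mollify hε f z - mollify hε f z' =
      ∫ t, φ.normed Measure.addHaar t * (f (z - t) - f (z' - t)) ∂Measure.addHaar := by
    simp only [mul_sub]
    exact (integral_sub (integrable_mollify hε hf z) (integrable_mollify hε hf z')).symm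
  rw [h1, ← Real.norm_eq_abs]
  have h2 := norm_integral_le_of_norm_le (μ := (Measure.addHaar : Measure W))
    (f := fun t => φ.normed Measure.addHaar t * (f (z - t) - f (z' - t)))
    (g := fun t => φ.normed Measure.addHaar t * (K * ‖z - z'‖))
    (φ.integrable_normed.mul_const _) (Eventually.of_forall fun t => by
      rw [norm_mul, Real.norm_of_nonneg (φ.nonneg_normed t), Real.norm_eq_abs]
      refine mul_le_mul_of_nonneg_left ?_ (φ.nonneg_normed t)
      simpa using hK (z - t) (z' - t))
  rwa [integral_mul_const, φ.integral_normed, one_mul] at h2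

theorem mollify_sub_translate (hf : Continuous f) (w z : W) :
    mollify hε (fun y => f y - f (y + w)) z = mollify hε f z - mollify hε f (z + w) := by
  set φ : ContDiffBump (0 : W) := ⟨ε / 2, ε, by positivity, by linarith⟩ with hφ
  have h2 := integral_sub (integrable_mollify hε hf z) (integrable_mollify hε hf (z + w))
  refine Eq.trans ?_ h2
  refine integral_congr_ae (Eventually.of_forall fun t => ?_)
  change φ.normed Measure.addHaar t * (f (z - t) - f (z - t + w)) = _
  simp only
  rw [mul_sub, sub_add_eq_add_sub]

theorem fderiv_eq_zero_of_eq_zero {f : W → ℝ} {ρ : ℝ} (h : ∀ z, ρ ≤ 1 + ‖z‖ → f z = 0) {z : W}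
    (hz : ρ < 1 + ‖z‖) : fderiv ℝ f z = 0 := by
  have h1 : f =ᶠ[𝓝 z] fun _ => 0 := by
    have h2 : ∀ᶠ y in 𝓝 z, ρ < 1 + ‖y‖ :=
      (continuous_const.add continuous_norm).continuousAt.eventually (lt_mem_nhds hz)
    filter_upwards [h2] with y hy
    exact h y hy.le
  rw [h1.fderiv_eq]
  simp

/-- Test functions of class `C^{1,1}` with support in a ball, all constants bounded by `Q`. -/
structure IsTestFunction (ψ : W → ℝ) (Q : ℝ) : Prop where
  differentiable : Differentiable ℝ ψ
  norm_fderiv_le : ∀ z, ‖fderiv ℝ ψ z‖ ≤ Q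
  norm_fderiv_sub_le : ∀ z z', ‖fderiv ℝ ψ z - fderiv ℝ ψ z'‖ ≤ Q * ‖z - z'‖
  -- The support is measured by `1 + ‖z‖` because the velocity grows at most like this quantity.
  eq_zero : ∀ z, Q ≤ 1 + ‖z‖ → ψ z = 0

namespace IsTestFunction

variable {ψ : W → ℝ} {Q : ℝ}

theorem nonneg (h : IsTestFunction ψ Q) : 0 ≤ Q := (norm_nonneg _).trans (h.norm_fderiv_le 0)

theorem mono (h : IsTestFunction ψ Q) {Q' : ℝ} (hQ : Q ≤ Q') : IsTestFunction ψ Q' :=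
  ⟨h.differentiable, fun z => (h.norm_fderiv_le z).trans hQ,
    fun z z' => (h.norm_fderiv_sub_le z z').trans (by gcongr), fun z hz => h.eq_zero z (hQ.trans hz)⟩

theorem abs_sub_le (h : IsTestFunction ψ Q) (z z' : W) : |ψ z - ψ z'| ≤ Q * ‖z - z'‖ :=
  convex_univ.norm_image_sub_le_of_norm_fderiv_le (𝕜 := ℝ) (fun y _ => h.differentiable y)
    (fun y _ => h.norm_fderiv_le y) (mem_univ z') (mem_univ z)

theorem fderiv_eq_zero (h : IsTestFunction ψ Q) {z : W} (hz : Q < 1 + ‖z‖) : fderiv ℝ ψ z = 0 :=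
  fderiv_eq_zero_of_eq_zero h.eq_zero hz

/-- First order Taylor estimate. -/
theorem abs_taylor_le (h : IsTestFunction ψ Q) (z z' : W) :
    |ψ z' - ψ z - fderiv ℝ ψ z (z' - z)| ≤ Q * ‖z' - z‖ ^ 2 := by
  have hQ := h.nonneg
  have := (convex_segment z z').norm_image_sub_le_of_norm_hasFDerivWithin_le' (f := ψ)
    (f' := fun y => fderiv ℝ ψ y) (φ := fderiv ℝ ψ z) (C := Q * ‖z' - z‖)
    (fun y _ => (h.differentiable y).hasFDerivAt.hasFDerivWithinAt) (fun y hy => by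
      refine (h.norm_fderiv_sub_le y z).trans ?_
      gcongr
      simpa [dist_eq_norm] using (norm_sub_le_of_mem_segment hy))
    (left_mem_segment ℝ z z') (right_mem_segment ℝ z z')
  rw [Real.norm_eq_abs] at this
  calc _ ≤ Q * ‖z' - z‖ * ‖z' - z‖ := this
    _ = _ := by ring

/-- Averaging does not increase Lipschitz constants; the extra `ε` accounts for the larger support.
For the derivative, the difference of `ψ` and its translate by `w` is Lipschitz with constant `Q
‖w‖`, and mollification commutes with translation. -/
theorem mollify (h : IsTestFunction ψ Q) : IsTestFunction (mollify hε ψ) (Q + ε) := by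
  have hQ := h.nonneg
  have hc : Continuous ψ := h.differentiable.continuous
  have hd : Differentiable ℝ (_root_.mollify hε ψ) := (contDiff_mollify hε hc).differentiable (by simp)
  refine ⟨hd, fun z => ?_, fun z z' => ?_, fun z hz => mollify_eq_zero hε h.eq_zero hz⟩
  · have hl : LipschitzWith Q.toNNReal (_root_.mollify hε ψ) :=
      LipschitzWith.of_dist_le_mul fun x y => by
        rw [Real.coe_toNNReal _ hQ, Real.dist_eq, dist_eq_norm]
        exact abs_mollify_sub_le hε hc h.abs_sub_le x y
    have := norm_fderiv_le_of_lipschitz ℝ hl (x₀ := z)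
    rw [Real.coe_toNNReal _ hQ] at this
    linarith
  · set w := z' - z with hw
    set k : W → ℝ := fun y => ψ y - ψ (y + w) with hk
    have hdt : ∀ y, DifferentiableAt ℝ (fun y => ψ (y + w)) y := fun y =>
      (h.differentiable _).comp y (differentiableAt_id.add_const w)
    have hkl : ∀ x y, |k x - k y| ≤ Q * ‖w‖ * ‖x - y‖ := fun x y => by
      refine convex_univ.norm_image_sub_le_of_norm_fderiv_le (𝕜 := ℝ) (f := k)
        (fun y _ => (h.differentiable y).sub (hdt y)) (fun y _ => ?_) (mem_univ y) (mem_univ x)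
      rw [hk, fderiv_fun_sub (h.differentiable y) (hdt y), fderiv_comp_add_right]
      refine (h.norm_fderiv_sub_le _ _).trans (le_of_eq ?_)
      rw [sub_add_cancel_left, norm_neg]
    have hkc : Continuous k := hc.sub (hc.comp (continuous_id.add continuous_const))
    have hl : LipschitzWith (Q * ‖w‖).toNNReal (_root_.mollify hε k) :=
      LipschitzWith.of_dist_le_mul fun x y => by
        rw [Real.coe_toNNReal _ (by positivity), Real.dist_eq, dist_eq_norm]
        exact abs_mollify_sub_le hε hkc hkl x y
    have h1 := norm_fderiv_le_of_lipschitz ℝ hl (x₀ := z)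
    rw [Real.coe_toNNReal _ (by positivity)] at h1
    have h2 : _root_.mollify hε k = fun z => _root_.mollify hε ψ z - _root_.mollify hε ψ (z + w) :=
      funext fun z => mollify_sub_translate hε hc w z
    have hdt' : DifferentiableAt ℝ (fun y => _root_.mollify hε ψ (y + w)) z :=
      (hd _).comp z (differentiableAt_id.add_const w)
    rw [h2, fderiv_fun_sub (hd z) hdt', fderiv_comp_add_right, hw, add_sub_cancel] at h1
    refine h1.trans ?_
    rw [norm_sub_rev z' z]
    gcongr
    linarith

end IsTestFunction

end Mollification

/-! ### Weak derivatives on an interval -/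

section WeakDerivative

/-- The primitive from `0` vanishes before `a` because `k` does, and after `b` because the total
integral is zero. -/
theorem exists_primitive_of_integral_eq_zero {k : ℝ → ℝ} (hk : ContDiff ℝ (⊤ : ℕ∞) k) {a b : ℝ}
    (ha : 0 < a) (hs : ∀ r, r ∉ Icc a b → k r = 0) (h0 : ∫ r, k r = 0) :
    ∃ χ : ℝ → ℝ, ContDiff ℝ (⊤ : ℕ∞) χ ∧ deriv χ = k ∧ ∀ r, r ∉ Icc a b → χ r = 0 := by
  have hd : ∀ r, HasDerivAt (fun r => ∫ x in (0 : ℝ)..r, k x) (k r) r := fun r =>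
    hk.continuous.integral_hasStrictDerivAt 0 r |>.hasDerivAt
  have hd' : deriv (fun r => ∫ x in (0 : ℝ)..r, k x) = k := funext fun r => (hd r).deriv
  refine ⟨fun r => ∫ x in (0 : ℝ)..r, k x, contDiff_infty_iff_deriv.2
    ⟨fun r => (hd r).differentiableAt, hd'.symm ▸ hk⟩, hd', fun r hr => ?_⟩
  by_cases hra : r < a
  · refine intervalIntegral.integral_zero_ae (Eventually.of_forall fun x hx => hs x fun hx' => ?_)
    have : x ≤ max 0 r := hx.2
    have := hx'.1
    have := max_lt ha hra
    linarith
  · have hrb : b < r := not_le.1 fun h => hr ⟨not_lt.1 hra, h⟩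
    change ∫ x in (0 : ℝ)..r, k x = 0
    rw [intervalIntegral.integral_eq_integral_of_support_subset, h0]
    intro x hx
    have : x ∈ Icc a b := by_contra fun h => hx (hs x h)
    exact ⟨ha.trans_le this.1, this.2.trans hrb.le⟩

/-- A continuous function with an integrable weak derivative is a primitive of it. -/
theorem sub_eq_integral_of_weak_deriv {m n : ℝ → ℝ} (hm : ContinuousOn m (Icc 0 1))
    (hn : IntervalIntegrable n volume 0 1)
    (h : ∀ χ : ℝ → ℝ, ContDiff ℝ (⊤ : ℕ∞) χ → HasCompactSupport χ → tsupport χ ⊆ Ioo 0 1 →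
      ∫ t in Ioo (0 : ℝ) 1, (deriv χ t * m t + χ t * n t) = 0)
    {s t : ℝ} (hs : s ∈ Icc (0 : ℝ) 1) (ht : t ∈ Icc (0 : ℝ) 1) :
    m t - m s = ∫ r in s..t, n r := by
  set N : ℝ → ℝ := fun t => ∫ r in (0 : ℝ)..t, n r with hN
  have hNac : AbsolutelyContinuousOnInterval N 0 1 :=
    hn.absolutelyContinuousOnInterval_intervalIntegral (by simp)
  have hNc : ContinuousOn N (Icc 0 1) := by
    simpa [uIcc_of_le] using hNac.continuousOn
  -- The difference between `m` and the primitive `N` has zero weak derivative, and it remains to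
  -- see that it is constant. The projection extends it continuously to the line.
  set g : ℝ → ℝ := fun t => m (projIcc 0 1 zero_le_one t) - N (projIcc 0 1 zero_le_one t) with hg
  have hgc : Continuous g := (hm.sub hNc).comp_continuous
    (continuous_subtype_val.comp continuous_projIcc) fun t => (projIcc 0 1 zero_le_one t).2
  have hgI : ∀ t ∈ Icc (0 : ℝ) 1, g t = m t - N t := fun t ht => by
    simp only [hg, projIcc_of_mem zero_le_one ht]
  have key : ∀ χ : ℝ → ℝ, ContDiff ℝ (⊤ : ℕ∞) χ → HasCompactSupport χ → tsupport χ ⊆ Ioo 0 1 →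
      ∫ t in Ioo (0 : ℝ) 1, deriv χ t * g t = 0 := by
    intro χ hχ hχc hχs
    have hχd : Continuous (deriv χ) := hχ.continuous_deriv (by simp)
    have h0 : ∀ t, t ∉ Ioo (0 : ℝ) 1 → χ t = 0 := fun t ht =>
      image_eq_zero_of_notMem_tsupport fun h => ht (hχs h)
    obtain ⟨K, hK⟩ := hχ.lipschitzWith_of_hasCompactSupport hχc (by simp)
    have hχac : AbsolutelyContinuousOnInterval χ 0 1 :=
      hK.lipschitzOnWith.absolutelyContinuousOnInterval
    have h1 := hχac.integral_mul_deriv_eq_deriv_mul hNac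
    rw [h0 0 (by simp), h0 1 (by simp), zero_mul, zero_mul, sub_zero, zero_sub] at h1
    have h2 : ∫ x in (0 : ℝ)..1, χ x * deriv N x = ∫ x in (0 : ℝ)..1, χ x * n x := by
      refine intervalIntegral.integral_congr_ae ?_
      filter_upwards [hn.ae_hasDerivAt_integral] with x hx hx'
      rw [(hx (uIoc_subset_uIcc hx') 0 (by simp)).deriv]
    have h3 : IntervalIntegrable (fun t => deriv χ t * m t) volume 0 1 :=
      ContinuousOn.intervalIntegrable (by
        rw [uIcc_of_le zero_le_one]; exact hχd.continuousOn.mul hm)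
    have h4 : IntervalIntegrable (fun t => χ t * n t) volume 0 1 :=
      hn.continuousOn_mul hχ.continuous.continuousOn
    have h5 : IntervalIntegrable (fun t => deriv χ t * N t) volume 0 1 :=
      ContinuousOn.intervalIntegrable (by
        rw [uIcc_of_le zero_le_one]; exact hχd.continuousOn.mul hNc)
    have h6 := h χ hχ hχc hχs
    rw [← integral_Ioc_eq_integral_Ioo, ← intervalIntegral.integral_of_le zero_le_one] at h6 ⊢
    rw [intervalIntegral.integral_add h3 h4, ← h2, h1, ← sub_eq_add_neg,
      ← intervalIntegral.integral_sub h3 h5] at h6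
    refine Eq.trans (intervalIntegral.integral_congr fun t ht => ?_) h6
    rw [uIcc_of_le zero_le_one] at ht
    simp only [hgI t ht, mul_sub]
  -- Du Bois-Reymond's argument: the test function is a primitive of a bump at `s` minus a bump at
  -- `t`, so the averages of `g` near `s` and `t` coincide. Each average is within `η` of the value,
  -- whereas the values differ by `4 η`.
  have hmain : ∀ s ∈ Ioo (0 : ℝ) 1, ∀ t ∈ Ioo (0 : ℝ) 1, g s = g t := by
    intro s hs t ht
    by_contra hne
    set η := |g s - g t| / 4 with hη
    have hη0 : 0 < η := by
      have := abs_pos.2 (sub_ne_zero.2 hne)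
      positivity
    obtain ⟨δ₁, hδ₁, hd₁⟩ := Metric.continuousAt_iff.1 (hgc.continuousAt (x := s)) η hη0
    obtain ⟨δ₂, hδ₂, hd₂⟩ := Metric.continuousAt_iff.1 (hgc.continuousAt (x := t)) η hη0
    set ε := min (min δ₁ δ₂) (min (min s t) (min (1 - s) (1 - t))) / 2 with hε'
    have hε : 0 < ε := by
      have := hs.1; have := hs.2; have := ht.1; have := ht.2
      have : 0 < min (min δ₁ δ₂) (min (min s t) (min (1 - s) (1 - t))) := by
        simp only [lt_min_iff]
        refine ⟨⟨hδ₁, hδ₂⟩, ⟨hs.1, ht.1⟩, by linarith, by linarith⟩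
      positivity
    have hlt : ε < δ₁ ∧ ε < δ₂ ∧ ε < s ∧ ε < t ∧ ε < 1 - s ∧ ε < 1 - t := by
      have : ε < min (min δ₁ δ₂) (min (min s t) (min (1 - s) (1 - t))) := by linarith
      simp only [lt_min_iff] at this
      tauto
    obtain ⟨e1, e2, e3, e4, e5, e6⟩ := hlt
    set φ : ContDiffBump (0 : ℝ) := ⟨ε / 2, ε, by positivity, by linarith⟩ with hφ
    set ρ : ℝ → ℝ := φ.normed volume with hρ
    have hρ0 : ∀ x, ε ≤ |x| → ρ x = 0 := fun x hx => by
      have : x ∉ Function.support ρ := by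
        rw [hρ, φ.support_normed_eq]
        simpa using hx
      simpa using this
    have hρd : ContDiff ℝ (⊤ : ℕ∞) ρ := φ.contDiff_normed
    have hρi : ∀ x, Integrable fun r => ρ (x - r) := fun x =>
      (φ.integrable_normed (μ := volume)).comp_sub_left x
    have hρ1 : ∀ x, ∫ r, ρ (x - r) = 1 := fun x => by
      rw [integral_sub_left_eq_self ρ volume x, hρ, φ.integral_normed]
    have hav : ∀ x : ℝ, (∀ ⦃y⦄, dist y x < ε → dist (g y) (g x) < η) →
        |(∫ r, ρ (x - r) * g r) - g x| ≤ η := fun x hx => by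
      have := ContDiffBump.dist_normed_convolution_le (φ := φ) (μ := volume) (x₀ := x)
        hgc.aestronglyMeasurable fun y hy => (hx hy).le
      rwa [convolution_lsmul_swap] at this
    have hav1 := hav s fun y hy => hd₁ (hy.trans e1)
    have hav2 := hav t fun y hy => hd₂ (hy.trans e2)
    have hρsupp : ∀ x r, r ∉ Icc (x - ε) (x + ε) → ρ (x - r) = 0 := fun x r hr => hρ0 _ <| by
      by_contra hcon
      rw [not_le, abs_lt] at hcon
      exact hr ⟨by linarith, by linarith⟩
    obtain ⟨χ, hχ, hχd, hχs⟩ := exists_primitive_of_integral_eq_zero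
      (k := fun r => ρ (s - r) - ρ (t - r)) (a := min s t - ε) (b := max s t + ε)
      ((hρd.comp (contDiff_const.sub contDiff_id)).sub (hρd.comp (contDiff_const.sub contDiff_id)))
      (by have := lt_min e3 e4; linarith)
      (fun r hr => by
        have a1 := min_le_left s t
        have a2 := min_le_right s t
        have b1 := le_max_left s t
        have b2 := le_max_right s t
        rw [hρsupp s r fun h => hr ⟨by linarith [h.1], by linarith [h.2]⟩,
          hρsupp t r fun h => hr ⟨by linarith [h.1], by linarith [h.2]⟩, sub_zero])
      (by rw [integral_sub (hρi s) (hρi t), hρ1, hρ1, sub_self])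
    have hts : tsupport χ ⊆ Icc (min s t - ε) (max s t + ε) :=
      closure_minimal (fun r hr => by_contra fun h => hr (hχs r h)) isClosed_Icc
    have hIcc : Icc (min s t - ε) (max s t + ε) ⊆ Ioo 0 1 := fun r hr => by
      have h1 := lt_min e3 e4
      have h2 : max s t < 1 - ε := max_lt (by linarith) (by linarith)
      exact ⟨by linarith [hr.1], by linarith [hr.2]⟩
    have h1 := key χ hχ (HasCompactSupport.of_support_subset_isCompact isCompact_Icc
      ((subset_tsupport χ).trans hts)) (hts.trans hIcc)
    have hρc : HasCompactSupport ρ := φ.hasCompactSupport_normed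
    have hgi : ∀ x, Integrable fun r => ρ (x - r) * g r := fun x =>
      Continuous.integrable_of_hasCompactSupport ((hρd.continuous.comp (by fun_prop)).mul hgc)
        (HasCompactSupport.mul_right
          (HasCompactSupport.of_support_subset_isCompact (isCompact_Icc (a := x - ε) (b := x + ε))
            fun r hr => by_contra fun h => hr (hρsupp x r h)))
    rw [setIntegral_eq_integral_of_forall_compl_eq_zero] at h1
    · simp only [hχd, sub_mul] at h1
      rw [integral_sub (hgi s) (hgi t)] at h1
      have h4 : |g s - g t| ≤ 2 * η := by
        rw [abs_le] at *
        constructor <;> linarith [hav1.1, hav1.2, hav2.1, hav2.2]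
      linarith [abs_nonneg (g s - g t)]
    · intro r hr
      have : deriv χ r = 0 := by
        refine image_eq_zero_of_notMem_tsupport fun h => hr (hIcc (hts ?_))
        exact tsupport_deriv_subset h
      rw [this, zero_mul]
  have hcl : ∀ t ∈ Icc (0 : ℝ) 1, g t = g (1 / 2) := by
    have hcl : IsClosed {t | g t = g (1 / 2)} := isClosed_eq hgc continuous_const
    have : closure (Ioo (0 : ℝ) 1) ⊆ {t | g t = g (1 / 2)} :=
      hcl.closure_subset_iff.2 fun t ht => hmain t ht _ (by norm_num)
    rwa [closure_Ioo (by norm_num)] at this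
  have h1 := (hcl t ht).trans (hcl s hs).symm
  rw [hgI t ht, hgI s hs] at h1
  have h2 : N t - N s = ∫ r in s..t, n r := by
    refine intervalIntegral.integral_interval_sub_left (hn.mono_set ?_) (hn.mono_set ?_)
    · rw [uIcc_of_le ht.1, uIcc_of_le zero_le_one]; exact Icc_subset_Icc_right ht.2
    · rw [uIcc_of_le hs.1, uIcc_of_le zero_le_one]; exact Icc_subset_Icc_right hs.2
  linarith

end WeakDerivative

/-! ### Weak solutions tested against functions of space -/

section WeakSolutions

variable {W : Type*} [NormedAddCommGroup W] [NormedSpace ℝ W] [FiniteDimensional ℝ W]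
  [MeasurableSpace W] [BorelSpace W]

/-- Narrowly continuous curves of probability measures on `[0,1]` that solve the continuity equation
for the field `U` in the sense of distributions on `(0,1)`. -/
structure IsWeakSolution (U : ℝ → W → W) (μ : ℝ → ProbabilityMeasure W) : Prop where
  continuousOn : ContinuousOn μ (Icc 0 1)
  weak_eq : ∀ φ : ℝ × W → ℝ, ContDiff ℝ (⊤ : ℕ∞) φ → HasCompactSupport φ →
    tsupport φ ⊆ Ioo (0 : ℝ) 1 ×ˢ univ →
    ∫ t in Ioo (0 : ℝ) 1, ∫ z, (fderiv ℝ φ (t, z) (1, 0) + fderiv ℝ φ (t, z) (0, U t z))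
      ∂(μ t : Measure W) = 0

theorem hasCompactSupport_of_eq_zero {f : W → ℝ} {ρ : ℝ} (h : ∀ z, ρ ≤ 1 + ‖z‖ → f z = 0) :
    HasCompactSupport f :=
  HasCompactSupport.of_support_subset_isCompact (isCompact_closedBall 0 ρ) fun z hz => by
    rw [mem_closedBall_zero_iff]
    by_contra hcon
    exact hz (h z (by linarith))

theorem abs_integral_mollify_sub_le {ε : ℝ} (hε : 0 < ε) {f : W → ℝ} {K ρ : ℝ} (hK : 0 ≤ K)
    (hf : ∀ z z', |f z - f z'| ≤ K * ‖z - z'‖) (hρ : ∀ z, ρ ≤ 1 + ‖z‖ → f z = 0)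
    (μ : Measure W) [IsProbabilityMeasure μ] :
    |(∫ z, mollify hε f z ∂μ) - ∫ z, f z ∂μ| ≤ K * ε := by
  have hc : Continuous f := (LipschitzWith.of_dist_le_mul (K := K.toNNReal) fun x y => by
    rw [Real.coe_toNNReal _ hK, Real.dist_eq, dist_eq_norm]; exact hf x y).continuous
  have i1 : Integrable f μ :=
    hc.integrable_of_hasCompactSupport (hasCompactSupport_of_eq_zero hρ)
  have i2 : Integrable (mollify hε f) μ :=
    (contDiff_mollify hε hc).continuous.integrable_of_hasCompactSupport
      (hasCompactSupport_of_eq_zero fun z hz => mollify_eq_zero hε hρ hz)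
  rw [← integral_sub i2 i1, ← Real.norm_eq_abs]
  refine (norm_integral_le_of_norm_le_const (C := K * ε) (Eventually.of_forall fun z => ?_)).trans
    (by simp)
  refine dist_mollify_le hε hc fun y hy => (hf y z).trans ?_
  gcongr

theorem intervalIntegrable_integral_curve {μ : ℝ → ProbabilityMeasure W}
    (hμ : ContinuousOn μ (Icc 0 1)) {F : ℝ → W → ℝ} (hF : StronglyMeasurable (Function.uncurry F))
    {b : ℝ → ℝ} (hb : Integrable b) (hFb : ∀ r z, |F r z| ≤ b r) {s t : ℝ} (hs : s ∈ Icc (0 : ℝ) 1)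
    (ht : t ∈ Icc (0 : ℝ) 1) :
    IntervalIntegrable (fun r => ∫ z, F r z ∂(μ r : Measure W)) volume s t := by
  have h : IntervalIntegrable (fun r => ∫ z, F r z ∂(μ r : Measure W)) volume 0 1 := by
    rw [intervalIntegrable_iff_integrableOn_Icc_of_le zero_le_one]
    refine hb.integrableOn.mono' (aestronglyMeasurable_integral_curve hμ hF)
      (Eventually.of_forall fun r => ?_)
    exact (norm_integral_le_of_norm_le_const (C := b r) (Eventually.of_forall fun z => hFb r z)).trans
      (by simp)
  refine h.mono_set ?_
  rw [uIcc_of_le zero_le_one]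
  exact uIcc_subset_Icc hs ht

namespace TransportField

variable {U : ℝ → W → W} {a : ℝ → ℝ} (T : TransportField U a)

include T

theorem stronglyMeasurable_fderiv_apply {ψ : W → ℝ} (hψ : Continuous (fderiv ℝ ψ)) :
    StronglyMeasurable (Function.uncurry fun (r : ℝ) (z : W) => fderiv ℝ ψ z (U r z)) := by
  have h3 : Continuous fun p : (W →L[ℝ] ℝ) × W => p.1 p.2 := by fun_prop
  exact h3.comp_stronglyMeasurable
    ((hψ.comp continuous_snd).stronglyMeasurable.prodMk T.stronglyMeasurable_uncurry)

theorem abs_fderiv_apply_le {ψ : W → ℝ} {L ρ : ℝ} (hL : ∀ z, ‖fderiv ℝ ψ z‖ ≤ L) (hρ0 : 0 ≤ ρ)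
    (hρ : ∀ z, ρ ≤ 1 + ‖z‖ → ψ z = 0) (r : ℝ) (z : W) :
    |fderiv ℝ ψ z (U r z)| ≤ L * ρ * a r := by
  have hL0 : 0 ≤ L := (norm_nonneg _).trans (hL 0)
  have ha := T.nonneg r
  rcases lt_or_ge ρ (1 + ‖z‖) with h | h
  · rw [fderiv_eq_zero_of_eq_zero hρ h, _root_.zero_apply, abs_zero]
    positivity
  · calc |fderiv ℝ ψ z (U r z)| ≤ ‖fderiv ℝ ψ z‖ * ‖U r z‖ := (fderiv ℝ ψ z).le_opNorm _
      _ ≤ L * (a r * ρ) := by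
        gcongr
        · exact hL z
        · exact (T.norm_le r z).trans (by gcongr)
      _ = L * ρ * a r := by ring

variable {μ : ℝ → ProbabilityMeasure W} (hμ : IsWeakSolution U μ)

include hμ

/-- Testing the equation with products `χ(t) ψ(z)` identifies the weak derivative of the continuous
function `t ↦ ∫ ψ dμ_t`. -/
theorem integral_sub_integral_eq {ψ : W → ℝ} (hψ : ContDiff ℝ (⊤ : ℕ∞) ψ)
    (hψc : HasCompactSupport ψ) {s t : ℝ} (hs : s ∈ Icc (0 : ℝ) 1) (ht : t ∈ Icc (0 : ℝ) 1) :
    ∫ z, ψ z ∂(μ t : Measure W) - ∫ z, ψ z ∂(μ s : Measure W) =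
      ∫ r in s..t, ∫ z, fderiv ℝ ψ z (U r z) ∂(μ r : Measure W) := by
  have hDc : Continuous (fderiv ℝ ψ) := hψ.continuous_fderiv (by simp)
  obtain ⟨L, hL⟩ := (hψc.fderiv ℝ).exists_bound_of_continuous hDc
  obtain ⟨ρ, hρ0, hρ⟩ := hψc.isBounded.exists_pos_norm_le
  have hL0 : 0 ≤ L := (norm_nonneg _).trans (hL 0)
  have hz : ∀ z, 2 + ρ ≤ 1 + ‖z‖ → ψ z = 0 := fun z hz =>
    image_eq_zero_of_notMem_tsupport fun h => by linarith [hρ z h]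
  have hb := T.abs_fderiv_apply_le hL (by linarith) hz
  have hm := T.stronglyMeasurable_fderiv_apply hDc
  refine sub_eq_integral_of_weak_deriv (m := fun t => ∫ z, ψ z ∂(μ t : Measure W)) ?_
    (intervalIntegrable_integral_curve hμ.continuousOn hm (T.integrable.const_mul _) hb (by simp)
      (by simp)) (fun χ hχ hχc hχs => ?_) hs ht
  · let f : BoundedContinuousFunction W ℝ := BoundedContinuousFunction.ofNormedAddCommGroup ψ
      hψ.continuous _ (hψc.exists_bound_of_continuous hψ.continuous).choose_spec
    exact fun t ht => (ProbabilityMeasure.tendsto_iff_forall_integral_tendsto.1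
      (hμ.continuousOn t ht)) f
  · set φ : ℝ × W → ℝ := fun q => χ q.1 * ψ q.2 with hφ
    have hχd := hχ.differentiable (by simp)
    have hψd := hψ.differentiable (by simp)
    have hts : tsupport φ ⊆ tsupport χ ×ˢ tsupport ψ := by
      refine closure_minimal (fun q hq => ?_) ((isClosed_tsupport χ).prod (isClosed_tsupport ψ))
      have hq' : χ q.1 * ψ q.2 ≠ 0 := hq
      exact ⟨subset_tsupport _ (left_ne_zero_of_mul hq'), subset_tsupport _ (right_ne_zero_of_mul hq')⟩
    have h1 := hμ.weak_eq φ ((hχ.comp contDiff_fst).mul (hψ.comp contDiff_snd))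
      (HasCompactSupport.of_support_subset_isCompact (hχc.isCompact.prod hψc.isCompact)
        ((subset_tsupport φ).trans hts))
      (hts.trans (prod_mono hχs (subset_univ _)))
    refine Eq.trans ?_ h1
    refine integral_congr_ae (Eventually.of_forall fun t => ?_)
    have hd : ∀ z w, fderiv ℝ φ (t, z) w = deriv χ t * ψ z * w.1 + χ t * fderiv ℝ ψ z w.2 := by
      intro z w
      have e1 : HasFDerivAt (fun q : ℝ × W => χ q.1)
          ((fderiv ℝ χ t).comp (ContinuousLinearMap.fst ℝ ℝ W)) (t, z) :=
        HasFDerivAt.comp (t, z) (hχd t).hasFDerivAt hasFDerivAt_fst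
      have e2 : HasFDerivAt (fun q : ℝ × W => ψ q.2)
          ((fderiv ℝ ψ z).comp (ContinuousLinearMap.snd ℝ ℝ W)) (t, z) :=
        HasFDerivAt.comp (t, z) (hψd z).hasFDerivAt hasFDerivAt_snd
      have e4 : HasFDerivAt φ _ (t, z) := e1.mul e2
      rw [e4.fderiv]
      have e3 : fderiv ℝ χ t w.1 = w.1 * deriv χ t := by
        rw [← fderiv_apply_one_eq_deriv, ← smul_eq_mul, ← map_smul, smul_eq_mul, mul_one]
      simp only [_root_.add_apply, _root_.smul_apply,
        ContinuousLinearMap.comp_apply, ContinuousLinearMap.coe_fst', ContinuousLinearMap.coe_snd',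
        smul_eq_mul, e3]
      ring
    simp only [hd, map_zero, mul_one, mul_zero, add_zero, zero_add]
    rw [integral_add, integral_const_mul, integral_const_mul]
    · exact (hψ.continuous.integrable_of_hasCompactSupport hψc).const_mul _
    · refine Integrable.const_mul ?_ _
      exact (integrable_const (L * (2 + ρ) * a t)).mono'
        (hm.comp_measurable measurable_prodMk_left).aestronglyMeasurable
        (Eventually.of_forall fun z => hb t z)

/-- Mollification extends the estimate to Lipschitz functions. It will be applied to `z ↦ Dψ(z) U(r,
z)`, for which no more regularity is available. -/
theorem abs_integral_sub_integral_le {f : W → ℝ} {K ρ : ℝ} (hK : 0 ≤ K) (hρ0 : 0 ≤ ρ)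
    (hf : ∀ z z', |f z - f z'| ≤ K * ‖z - z'‖) (hρ : ∀ z, ρ ≤ 1 + ‖z‖ → f z = 0) {s t : ℝ}
    (hs : s ∈ Icc (0 : ℝ) 1) (ht : t ∈ Icc (0 : ℝ) 1) (hst : s ≤ t) :
    |∫ z, f z ∂(μ t : Measure W) - ∫ z, f z ∂(μ s : Measure W)| ≤ K * ρ * ∫ r in s..t, a r := by
  have hc : Continuous f := (LipschitzWith.of_dist_le_mul (K := K.toNNReal) fun x y => by
    rw [Real.coe_toNNReal _ hK, Real.dist_eq, dist_eq_norm]; exact hf x y).continuous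
  have key : ∀ ε > 0, |∫ z, f z ∂(μ t : Measure W) - ∫ z, f z ∂(μ s : Measure W)| ≤
      K * (ρ + ε) * (∫ r in s..t, a r) + 2 * (K * ε) := by
    intro ε hε
    have e1 := abs_integral_mollify_sub_le hε hK hf hρ (μ t : Measure W)
    have e2 := abs_integral_mollify_sub_le hε hK hf hρ (μ s : Measure W)
    have hs' : ∀ z, ρ + ε ≤ 1 + ‖z‖ → mollify hε f z = 0 := fun z => mollify_eq_zero hε hρ
    have hl : LipschitzWith K.toNNReal (mollify hε f) := LipschitzWith.of_dist_le_mul fun x y => by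
      rw [Real.coe_toNNReal _ hK, Real.dist_eq, dist_eq_norm]
      exact abs_mollify_sub_le hε hc hf x y
    have hL : ∀ z, ‖fderiv ℝ (mollify hε f) z‖ ≤ K := fun z => by
      simpa [Real.coe_toNNReal _ hK] using norm_fderiv_le_of_lipschitz ℝ hl (x₀ := z)
    have e3 := T.integral_sub_integral_eq hμ (contDiff_mollify hε hc)
      (hasCompactSupport_of_eq_zero hs') hs ht
    have e4 : |∫ r in s..t, ∫ z, fderiv ℝ (mollify hε f) z (U r z) ∂(μ r : Measure W)| ≤
        K * (ρ + ε) * ∫ r in s..t, a r := by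
      rw [← intervalIntegral.integral_const_mul, ← Real.norm_eq_abs]
      refine intervalIntegral.norm_integral_le_of_norm_le hst (Eventually.of_forall fun r _ => ?_)
        ((T.intervalIntegrable_a s t).const_mul _)
      exact (norm_integral_le_of_norm_le_const (C := K * (ρ + ε) * a r) (Eventually.of_forall
        fun z => T.abs_fderiv_apply_le hL (by linarith) hs' r z)).trans (by simp)
    rw [← e3] at e4
    rw [abs_le] at *
    constructor <;> linarith [e1.1, e1.2, e2.1, e2.2, e4.1, e4.2]
  have hlim : Tendsto (fun ε : ℝ => K * (ρ + ε) * (∫ r in s..t, a r) + 2 * (K * ε)) (𝓝[>] 0)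
      (𝓝 (K * ρ * ∫ r in s..t, a r)) := by
    have : Continuous fun ε : ℝ => K * (ρ + ε) * (∫ r in s..t, a r) + 2 * (K * ε) := by fun_prop
    have h := (this.tendsto 0).mono_left (nhdsWithin_le_nhds (s := Ioi 0))
    simpa using h
  exact ge_of_tendsto hlim (by filter_upwards [self_mem_nhdsWithin] with ε hε using key ε hε)

end TransportField

end WeakSolutions

/-! ### Consistency of the explicit Euler scheme on test functions -/

namespace TransportField

section EulerStep

variable {W : Type*} [NormedAddCommGroup W] [NormedSpace ℝ W] [FiniteDimensional ℝ W]
  [MeasurableSpace W] [BorelSpace W] {U : ℝ → W → W} {a : ℝ → ℝ} (T : TransportField U a)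

/-- One step of the explicit Euler scheme with exact time averages. -/
def eulerStep (U : ℝ → W → W) (s t : ℝ) (z : W) : W := z + ∫ r in s..t, U r z

variable {s t : ℝ} (hst : s ≤ t)

include T

theorem intervalIntegrable_apply (s t : ℝ) (z : W) :
    IntervalIntegrable (fun r => U r z) volume s t :=
  ((T.intervalIntegrable_a s t).mul_const (1 + ‖z‖)).mono_fun'
    (T.stronglyMeasurable_apply z).aestronglyMeasurable
    (Eventually.of_forall fun r => T.norm_le r z)

theorem intervalIntegrable_DU (s t : ℝ) (z : W) :
    IntervalIntegrable (fun r => T.DU r z) volume s t :=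
  (T.intervalIntegrable_a s t).mono_fun' (T.stronglyMeasurable_DU z).aestronglyMeasurable
    (Eventually.of_forall fun r => T.norm_DU_le r z)

theorem norm_sub_le (r : ℝ) (z z' : W) : ‖U r z - U r z'‖ ≤ a r * ‖z - z'‖ :=
  convex_univ.norm_image_sub_le_of_norm_hasFDerivWithin_le
    (fun y _ => (T.hasFDerivAt r y).hasFDerivWithinAt) (fun y _ => T.norm_DU_le r y)
    (mem_univ z') (mem_univ z)

theorem hasFDerivAt_eulerStep (s t : ℝ) (z : W) : HasFDerivAt (eulerStep U s t)
    (ContinuousLinearMap.id ℝ W + ∫ r in s..t, T.DU r z) z := by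
  refine (hasFDerivAt_id z).add ?_
  exact intervalIntegral.hasFDerivAt_integral_of_dominated_of_fderiv_le (bound := a) univ_mem
    (Eventually.of_forall fun x => (T.stronglyMeasurable_apply x).aestronglyMeasurable)
    (T.intervalIntegrable_apply s t z) (T.stronglyMeasurable_DU z).aestronglyMeasurable
    (Eventually.of_forall fun r _ x _ => T.norm_DU_le r x) (T.intervalIntegrable_a s t)
    (Eventually.of_forall fun r _ x _ => T.hasFDerivAt r x)

include hst

theorem integral_a_nonneg : 0 ≤ ∫ r in s..t, a r :=
  intervalIntegral.integral_nonneg hst fun r _ => T.nonneg r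

theorem norm_eulerStep_sub_le (z : W) :
    ‖eulerStep U s t z - z‖ ≤ (∫ r in s..t, a r) * (1 + ‖z‖) := by
  rw [eulerStep, add_sub_cancel_left, ← intervalIntegral.integral_mul_const]
  exact intervalIntegral.norm_integral_le_of_norm_le hst
    (Eventually.of_forall fun r _ => T.norm_le r z)
    ((T.intervalIntegrable_a s t).mul_const _)

theorem le_norm_eulerStep (z : W) :
    (1 - ∫ r in s..t, a r) * (1 + ‖z‖) ≤ 1 + ‖eulerStep U s t z‖ := by
  have h1 := T.norm_eulerStep_sub_le hst z
  have h2 := norm_sub_norm_le z (eulerStep U s t z)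
  rw [norm_sub_rev] at h2
  linarith

theorem norm_fderiv_eulerStep_le (z : W) :
    ‖ContinuousLinearMap.id ℝ W + ∫ r in s..t, T.DU r z‖ ≤ 1 + ∫ r in s..t, a r :=
  (norm_add_le _ _).trans (add_le_add ContinuousLinearMap.norm_id_le
    (intervalIntegral.norm_integral_le_of_norm_le hst
      (Eventually.of_forall fun r _ => T.norm_DU_le r z) (T.intervalIntegrable_a s t)))

theorem norm_fderiv_eulerStep_sub_le (z z' : W) :
    ‖(ContinuousLinearMap.id ℝ W + ∫ r in s..t, T.DU r z) -
      (ContinuousLinearMap.id ℝ W + ∫ r in s..t, T.DU r z')‖ ≤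
        (∫ r in s..t, a r) * ‖z - z'‖ := by
  rw [add_sub_add_left_eq_sub, ← intervalIntegral.integral_sub (T.intervalIntegrable_DU s t z)
    (T.intervalIntegrable_DU s t z'), ← intervalIntegral.integral_mul_const]
  exact intervalIntegral.norm_integral_le_of_norm_le hst
    (Eventually.of_forall fun r _ => T.norm_DU_sub_le r z z')
    ((T.intervalIntegrable_a s t).mul_const _)

theorem norm_eulerStep_sub_eulerStep_le (z z' : W) :
    ‖eulerStep U s t z - eulerStep U s t z'‖ ≤ (1 + ∫ r in s..t, a r) * ‖z - z'‖ :=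
  convex_univ.norm_image_sub_le_of_norm_hasFDerivWithin_le
    (fun y _ => (T.hasFDerivAt_eulerStep s t y).hasFDerivWithinAt)
    (fun y _ => T.norm_fderiv_eulerStep_le hst y) (mem_univ z') (mem_univ z)

/-- With `A` the integral of `a` over the step, the derivative bounds need `(1 + A)² + A ≤ 1 + 4A`
and the support needs `1 ≤ (1 - A)(1 + 4A)`; both hold for `0 ≤ A ≤ 1/2`. Such factors multiply to
at most `exp (4 ∫ a)` over a partition. -/
theorem isTestFunction_comp_eulerStep {ψ : W → ℝ} {Q : ℝ} (hψ : IsTestFunction ψ Q)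
    (hA : ∫ r in s..t, a r ≤ 1 / 2) :
    IsTestFunction (fun z => ψ (eulerStep U s t z)) (Q * (1 + 4 * ∫ r in s..t, a r)) := by
  have hQ := hψ.nonneg
  have hA0 := T.integral_a_nonneg hst
  have hle := T.le_norm_eulerStep hst
  have hn := T.norm_fderiv_eulerStep_le hst
  have hns := T.norm_fderiv_eulerStep_sub_le hst
  have hss := T.norm_eulerStep_sub_eulerStep_le hst
  have hd : ∀ z, HasFDerivAt (fun z => ψ (eulerStep U s t z))
      ((fderiv ℝ ψ (eulerStep U s t z)).comp
        (ContinuousLinearMap.id ℝ W + ∫ r in s..t, T.DU r z)) z := fun z =>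
    (hψ.differentiable _).hasFDerivAt.comp z (T.hasFDerivAt_eulerStep s t z)
  generalize (∫ r in s..t, a r) = A at *
  refine ⟨fun z => (hd z).differentiableAt, fun z => ?_, fun z z' => ?_, fun z hz => ?_⟩
  · rw [(hd z).fderiv]
    calc _ ≤ Q * (1 + A) := (ContinuousLinearMap.opNorm_comp_le _ _).trans
            (mul_le_mul (hψ.norm_fderiv_le _) (hn z) (norm_nonneg _) hQ)
      _ ≤ _ := by gcongr; linarith
  · rw [(hd z).fderiv, (hd z').fderiv]
    set D := ContinuousLinearMap.id ℝ W + ∫ r in s..t, T.DU r z with hD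
    set D' := ContinuousLinearMap.id ℝ W + ∫ r in s..t, T.DU r z' with hD'
    have e : (fderiv ℝ ψ (eulerStep U s t z)).comp D - (fderiv ℝ ψ (eulerStep U s t z')).comp D' =
        (fderiv ℝ ψ (eulerStep U s t z) - fderiv ℝ ψ (eulerStep U s t z')).comp D +
          (fderiv ℝ ψ (eulerStep U s t z')).comp (D - D') := by
      rw [ContinuousLinearMap.sub_comp, ContinuousLinearMap.comp_sub]
      abel
    rw [e]
    have e1 : ‖(fderiv ℝ ψ (eulerStep U s t z) - fderiv ℝ ψ (eulerStep U s t z')).comp D‖ ≤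
        (Q * ((1 + A) * ‖z - z'‖)) * (1 + A) := by
      refine (ContinuousLinearMap.opNorm_comp_le _ _).trans
        (mul_le_mul ((hψ.norm_fderiv_sub_le _ _).trans ?_) (hn z) (norm_nonneg _) (by positivity))
      have := hss z z'
      gcongr
    have e2 : ‖(fderiv ℝ ψ (eulerStep U s t z')).comp (D - D')‖ ≤ Q * (A * ‖z - z'‖) :=
      (ContinuousLinearMap.opNorm_comp_le _ _).trans
        (mul_le_mul (hψ.norm_fderiv_le _) (hns z z') (norm_nonneg _) hQ)
    have e3 : (1 + A) * (1 + A) + A ≤ 1 + 4 * A := by nlinarith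
    calc _ ≤ (Q * ((1 + A) * ‖z - z'‖)) * (1 + A) + Q * (A * ‖z - z'‖) :=
          (norm_add_le _ _).trans (add_le_add e1 e2)
      _ = Q * ((1 + A) * (1 + A) + A) * ‖z - z'‖ := by ring
      _ ≤ _ := by gcongr
  · refine hψ.eq_zero _ (le_trans ?_ (hle z))
    calc Q ≤ (1 - A) * (Q * (1 + 4 * A)) := by nlinarith [mul_nonneg hQ hA0]
      _ ≤ _ := by gcongr; linarith

variable {μ : ℝ → ProbabilityMeasure W} (hμ : IsWeakSolution U μ)

include hμ

/-- The local error has two sources, both quadratic in `A`. Freezing `μ_r` at `μ_s` in the time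
integral costs `Q (Q + 1)² A²`, as `Dψ · U` is Lipschitz; the Taylor remainder of `ψ` along the step
costs `4 Q³ A²`. -/
theorem abs_integral_sub_integral_comp_eulerStep_le_of_contDiff {ψ : W → ℝ} {Q : ℝ}
    (hψ : IsTestFunction ψ Q) (hψs : ContDiff ℝ (⊤ : ℕ∞) ψ) (hs : s ∈ Icc (0 : ℝ) 1)
    (ht : t ∈ Icc (0 : ℝ) 1) (hA : ∫ r in s..t, a r ≤ 1 / 2) :
    |∫ z, ψ z ∂(μ t : Measure W) - ∫ z, ψ (eulerStep U s t z) ∂(μ s : Measure W)| ≤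
      (Q * (Q + 1) ^ 2 + 4 * Q ^ 3) * (∫ r in s..t, a r) ^ 2 := by
  set A := ∫ r in s..t, a r with hAdef
  have hQ := hψ.nonneg
  have hA0 : 0 ≤ A := T.integral_a_nonneg hst
  have hDc : Continuous (fderiv ℝ ψ) := hψs.continuous_fderiv (by simp)
  have hc := hasCompactSupport_of_eq_zero hψ.eq_zero
  have hm := T.stronglyMeasurable_fderiv_apply hDc
  have hb := T.abs_fderiv_apply_le hψ.norm_fderiv_le hQ hψ.eq_zero
  have hbi : Integrable fun r => Q * Q * a r := T.integrable.const_mul _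
  have hlip : ∀ r z z', |fderiv ℝ ψ z (U r z) - fderiv ℝ ψ z' (U r z')| ≤
      a r * (Q * (Q + 1)) * ‖z - z'‖ := by
    have aux : ∀ r z z', 1 + ‖z‖ ≤ Q → |fderiv ℝ ψ z (U r z) - fderiv ℝ ψ z' (U r z')| ≤
        a r * (Q * (Q + 1)) * ‖z - z'‖ := by
      intro r z z' hz
      have ha := T.nonneg r
      have e : fderiv ℝ ψ z (U r z) - fderiv ℝ ψ z' (U r z') =
          (fderiv ℝ ψ z - fderiv ℝ ψ z') (U r z) + fderiv ℝ ψ z' (U r z - U r z') := by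
        rw [_root_.sub_apply, map_sub]; abel
      rw [e]
      calc _ ≤ Q * ‖z - z'‖ * (a r * Q) + Q * (a r * ‖z - z'‖) := by
            refine (abs_add_le _ _).trans (add_le_add ?_ ?_)
            · exact (ContinuousLinearMap.le_opNorm _ _).trans (mul_le_mul
                (hψ.norm_fderiv_sub_le z z') ((T.norm_le r z).trans (by gcongr)) (norm_nonneg _)
                (by positivity))
            · exact (ContinuousLinearMap.le_opNorm _ _).trans (mul_le_mul
                (hψ.norm_fderiv_le z') (T.norm_sub_le r z z') (norm_nonneg _) hQ)
        _ = _ := by ring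
    intro r z z'
    rcases lt_or_ge Q (1 + ‖z‖) with h | h
    · rcases lt_or_ge Q (1 + ‖z'‖) with h' | h'
      · have := T.nonneg r
        rw [hψ.fderiv_eq_zero h, hψ.fderiv_eq_zero h', _root_.zero_apply, _root_.zero_apply,
          sub_zero, abs_zero]
        positivity
      · rw [abs_sub_comm, norm_sub_rev]
        exact aux r z' z h'
    · exact aux r z z' h
  have i1 := intervalIntegrable_integral_curve hμ.continuousOn hm hbi hb hs ht
  have i2 : IntervalIntegrable (fun r => ∫ z, fderiv ℝ ψ z (U r z) ∂(μ s : Measure W)) volume s t :=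
    intervalIntegrable_integral_curve (μ := fun _ => μ s) continuousOn_const hm hbi hb hs ht
  have h1 : |(∫ r in s..t, ∫ z, fderiv ℝ ψ z (U r z) ∂(μ r : Measure W)) -
      ∫ r in s..t, ∫ z, fderiv ℝ ψ z (U r z) ∂(μ s : Measure W)| ≤ Q * (Q + 1) ^ 2 * A ^ 2 := by
    rw [← intervalIntegral.integral_sub i1 i2, ← Real.norm_eq_abs]
    have e : Q * (Q + 1) ^ 2 * A ^ 2 = ∫ r in s..t, a r * (Q * (Q + 1)) * (Q + 1) * A := by
      rw [intervalIntegral.integral_mul_const, intervalIntegral.integral_mul_const,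
        intervalIntegral.integral_mul_const, ← hAdef]
      ring
    rw [e]
    refine intervalIntegral.norm_integral_le_of_norm_le hst (Eventually.of_forall fun r hr => ?_)
      ((((T.intervalIntegrable_a s t).mul_const _).mul_const _).mul_const _)
    have ha := T.nonneg r
    refine (T.abs_integral_sub_integral_le hμ (K := a r * (Q * (Q + 1))) (ρ := Q + 1)
      (by positivity) (by positivity) (hlip r) (fun z hz => ?_) hs
      ⟨hs.1.trans hr.1.le, hr.2.trans ht.2⟩ hr.1.le).trans ?_
    · rw [hψ.fderiv_eq_zero (by linarith), _root_.zero_apply]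
    · gcongr
      exact intervalIntegral.integral_mono_interval le_rfl hr.1.le hr.2
        (Eventually.of_forall fun r => T.nonneg r) (T.intervalIntegrable_a s t)
  have h2 : ∫ r in s..t, ∫ z, fderiv ℝ ψ z (U r z) ∂(μ s : Measure W) =
      ∫ z, fderiv ℝ ψ z (eulerStep U s t z - z) ∂(μ s : Measure W) := by
    rw [intervalIntegral_integral_swap]
    · refine integral_congr_ae (Eventually.of_forall fun z => ?_)
      simp only [eulerStep, add_sub_cancel_left]
      exact ContinuousLinearMap.intervalIntegral_comp_comm _ (T.intervalIntegrable_apply s t z)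
    · refine Integrable.mono' (g := fun q : ℝ × W => Q * Q * a q.1)
        (hbi.restrict.comp_fst _) hm.aestronglyMeasurable
        (Eventually.of_forall fun q => hb q.1 q.2)
  have hSc : Continuous (eulerStep U s t) :=
    continuous_iff_continuousAt.2 fun z => (T.hasFDerivAt_eulerStep s t z).continuousAt
  have i3 : Integrable ψ (μ s : Measure W) :=
    hψs.continuous.integrable_of_hasCompactSupport hc
  have i4 : Integrable (fun z => ψ (eulerStep U s t z)) (μ s : Measure W) :=
    (hψs.continuous.comp hSc).integrable_of_hasCompactSupport
      (hasCompactSupport_of_eq_zero (T.isTestFunction_comp_eulerStep hst hψ hA).eq_zero)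
  have i5 : Integrable (fun z => fderiv ℝ ψ z (eulerStep U s t z - z)) (μ s : Measure W) :=
    (hDc.clm_apply (hSc.sub continuous_id)).integrable_of_hasCompactSupport
      (hasCompactSupport_of_eq_zero (ρ := Q + 1) fun z hz => by
        rw [hψ.fderiv_eq_zero (by linarith), _root_.zero_apply])
  have h3 : |∫ z, (ψ (eulerStep U s t z) - ψ z - fderiv ℝ ψ z (eulerStep U s t z - z))
      ∂(μ s : Measure W)| ≤ 4 * Q ^ 3 * A ^ 2 := by
    rw [← Real.norm_eq_abs]
    refine (norm_integral_le_of_norm_le_const (C := 4 * Q ^ 3 * A ^ 2)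
      (Eventually.of_forall fun z => ?_)).trans (by rw [probReal_univ, mul_one])
    -- Since `A ≤ 1/2`, a step at most halves `1 + ‖z‖`: beyond `2 Q` both the point and its image
    -- are outside the support of `ψ`.
    rcases lt_or_ge (2 * Q) (1 + ‖z‖) with h | h
    · have := T.le_norm_eulerStep hst z
      rw [hψ.fderiv_eq_zero (by linarith), hψ.eq_zero z (by linarith), hψ.eq_zero, _root_.zero_apply]
      · simp only [sub_zero, norm_zero]
        positivity
      · nlinarith [norm_nonneg z]
    · calc _ ≤ Q * ‖eulerStep U s t z - z‖ ^ 2 := hψ.abs_taylor_le z _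
        _ ≤ Q * (A * (2 * Q)) ^ 2 := by
          gcongr
          exact (T.norm_eulerStep_sub_le hst z).trans (by gcongr)
        _ = _ := by ring
  have i43 : Integrable (fun z => ψ (eulerStep U s t z) - ψ z) (μ s : Measure W) := i4.sub i3
  rw [integral_sub i43 i5, integral_sub i4 i3] at h3
  have h4 := T.integral_sub_integral_eq hμ hψs hc hs ht
  rw [← h4, h2] at h1
  rw [abs_le] at *
  constructor <;> linarith [h1.1, h1.2, h3.1, h3.2]

/-- Smoothness has to be removed because composition with an Euler step leaves only the class
`C^{1,1}`, and the scheme is iterated. -/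
theorem abs_integral_sub_integral_comp_eulerStep_le {ψ : W → ℝ} {Q : ℝ}
    (hψ : IsTestFunction ψ Q) (hs : s ∈ Icc (0 : ℝ) 1)
    (ht : t ∈ Icc (0 : ℝ) 1) (hA : ∫ r in s..t, a r ≤ 1 / 2) :
    |∫ z, ψ z ∂(μ t : Measure W) - ∫ z, ψ (eulerStep U s t z) ∂(μ s : Measure W)| ≤
      (Q * (Q + 1) ^ 2 + 4 * Q ^ 3) * (∫ r in s..t, a r) ^ 2 := by
  have hQ := hψ.nonneg
  have hc := hψ.differentiable.continuous
  have hSc : Continuous (eulerStep U s t) :=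
    continuous_iff_continuousAt.2 fun z => (T.hasFDerivAt_eulerStep s t z).continuousAt
  set b : ℝ → ℝ := fun ε => ((Q + ε) * ((Q + ε) + 1) ^ 2 + 4 * (Q + ε) ^ 3) *
    (∫ r in s..t, a r) ^ 2 + 2 * (Q * ε) with hb
  have key : ∀ ε > 0, |∫ z, ψ z ∂(μ t : Measure W) -
      ∫ z, ψ (eulerStep U s t z) ∂(μ s : Measure W)| ≤ b ε := by
    intro ε hε
    have hm := hψ.mollify hε
    have e1 := T.abs_integral_sub_integral_comp_eulerStep_le_of_contDiff hst hμ hm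
      (contDiff_mollify hε hc) hs ht hA
    have e2 := abs_integral_mollify_sub_le hε hQ hψ.abs_sub_le hψ.eq_zero (μ t : Measure W)
    have e3 : |(∫ z, mollify hε ψ (eulerStep U s t z) ∂(μ s : Measure W)) -
        ∫ z, ψ (eulerStep U s t z) ∂(μ s : Measure W)| ≤ Q * ε := by
      rw [← integral_sub, ← Real.norm_eq_abs]
      · refine (norm_integral_le_of_norm_le_const (C := Q * ε) (Eventually.of_forall fun z => ?_)).trans
          (by simp)
        refine dist_mollify_le hε hc fun y hy => (hψ.abs_sub_le y _).trans ?_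
        gcongr
      · exact ((contDiff_mollify hε hc).continuous.comp hSc).integrable_of_hasCompactSupport
          (hasCompactSupport_of_eq_zero (T.isTestFunction_comp_eulerStep hst hm hA).eq_zero)
      · exact (hc.comp hSc).integrable_of_hasCompactSupport
          (hasCompactSupport_of_eq_zero (T.isTestFunction_comp_eulerStep hst hψ hA).eq_zero)
    rw [abs_le] at *
    constructor <;> linarith [e1.1, e1.2, e2.1, e2.2, e3.1, e3.2]
  have hlim : Tendsto b (𝓝[>] 0)
      (𝓝 ((Q * (Q + 1) ^ 2 + 4 * Q ^ 3) * (∫ r in s..t, a r) ^ 2)) := by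
    have : Continuous b := by fun_prop
    have h := (this.tendsto 0).mono_left (nhdsWithin_le_nhds (s := Ioi 0))
    simpa [hb] using h
  exact ge_of_tendsto hlim (by filter_upwards [self_mem_nhdsWithin] with ε hε using key ε hε)

end EulerStep

end TransportField

/-! ### Uniqueness for the continuity equation -/

namespace TransportField

section Uniqueness

variable {W : Type*} [NormedAddCommGroup W] [NormedSpace ℝ W] [FiniteDimensional ℝ W]
  [MeasurableSpace W] [BorelSpace W] {U : ℝ → W → W} {a : ℝ → ℝ} (T : TransportField U a)
  {μ ν : ℝ → ProbabilityMeasure W} (hμ : IsWeakSolution U μ) (hν : IsWeakSolution U ν)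
  (h0 : μ 0 = ν 0)

include T hμ hν h0

/-- Both solutions follow the same Euler scheme up to local errors `C A²`. If every step has `A ≤
δ`, these sum to at most `C δ ∫ a` for each solution. The argument replaces the solution of a
backward transport equation. -/
theorem abs_integral_sub_integral_le_of_initial_eq {ψ : W → ℝ} {Q : ℝ} (hψ : IsTestFunction ψ Q)
    {δ : ℝ} (hδ : 0 < δ) (hδ2 : δ ≤ 1 / 2) :
    |∫ z, ψ z ∂(μ 1 : Measure W) - ∫ z, ψ z ∂(ν 1 : Measure W)| ≤
      2 * ((Q * Real.exp (4 * ∫ r in (0 : ℝ)..1, a r)) *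
        ((Q * Real.exp (4 * ∫ r in (0 : ℝ)..1, a r)) + 1) ^ 2 +
        4 * (Q * Real.exp (4 * ∫ r in (0 : ℝ)..1, a r)) ^ 3) * δ * ∫ r in (0 : ℝ)..1, a r := by
  set α : ℝ → ℝ := fun t => ∫ r in (0 : ℝ)..t, a r with hα
  have hQ := hψ.nonneg
  have hsub : ∀ s t, ∫ r in s..t, a r = α t - α s := fun s t =>
    (intervalIntegral.integral_interval_sub_left (T.intervalIntegrable_a 0 t)
      (T.intervalIntegrable_a 0 s)).symm
  have hα0 : α 0 = 0 := intervalIntegral.integral_same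
  have hαc : Continuous α := intervalIntegral.continuous_primitive T.intervalIntegrable_a 0
  have hαm : Monotone α := fun s t hst => by
    have := T.integral_a_nonneg hst
    rw [hsub] at this
    linarith
  set Q' := Q * Real.exp (4 * α 1) with hQ'
  set C := Q' * (Q' + 1) ^ 2 + 4 * Q' ^ 3 with hC
  have hQ'0 : 0 ≤ Q' := by positivity
  have hC0 : 0 ≤ C := by positivity
  -- Uniform continuity of the primitive of `a` provides a uniform partition whose steps carry at
  -- most `δ` of the integral.
  obtain ⟨η, hη, hηd⟩ := Metric.uniformContinuousOn_iff.1
    (isCompact_Icc.uniformContinuousOn_of_continuous hαc.continuousOn : UniformContinuousOn α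
      (Icc 0 1)) δ hδ
  obtain ⟨n, hn⟩ := exists_nat_one_div_lt hη
  set t : ℕ → ℝ := fun k => k / (n + 1) with ht
  have hn0 : (0 : ℝ) < n + 1 := by positivity
  have htI : ∀ k ≤ n + 1, t k ∈ Icc (0 : ℝ) 1 := fun k hk =>
    ⟨by positivity, by rw [ht, div_le_one hn0]; exact_mod_cast hk⟩
  have hstep : ∀ k, t (k + 1) = t k + 1 / (n + 1) := fun k => by
    simp only [ht]; push_cast; ring
  -- The induction runs over all test functions at once. The admissible constant shrinks with time,
  -- which leaves room for the factor lost when a test function is pulled back by one step.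
  have main : ∀ k ≤ n + 1, ∀ ψ : W → ℝ, IsTestFunction ψ (Q * Real.exp (4 * (α 1 - α (t k)))) →
      |∫ z, ψ z ∂(μ (t k) : Measure W) - ∫ z, ψ z ∂(ν (t k) : Measure W)| ≤
        2 * C * δ * α (t k) := by
    intro k
    induction k with
    | zero =>
      intro _ ψ _
      have : t 0 = 0 := by simp [ht]
      rw [this, h0, hα0]
      simp
    | succ k ih =>
      intro hk ψ hψ
      have hk' := htI k (by omega)
      have hk1 := htI (k + 1) hk
      have hst : t k ≤ t (k + 1) := by rw [hstep]; have : 0 ≤ 1 / ((n : ℝ) + 1) := by positivity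
                                       linarith
      have hA := hsub (t k) (t (k + 1))
      have hAδ : ∫ r in t k..t (k + 1), a r ≤ δ := by
        rw [hA]
        have := hηd (t (k + 1)) hk1 (t k) hk' (by
          rw [hstep, Real.dist_eq, add_sub_cancel_left, abs_of_pos (by positivity)]; exact hn)
        exact (le_abs_self _).trans this.le
      have hA0 := T.integral_a_nonneg hst
      set A := ∫ r in t k..t (k + 1), a r with hAdef
      set Qk := Q * Real.exp (4 * (α 1 - α (t (k + 1)))) with hQk
      have hQk0 : 0 ≤ Qk := by positivity
      have hQkQ' : Qk ≤ Q' := by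
        have : 0 ≤ α (t (k + 1)) := hα0 ▸ hαm hk1.1
        rw [hQk, hQ']
        gcongr
        linarith
      have e1 := T.abs_integral_sub_integral_comp_eulerStep_le hst hμ hψ hk' hk1 (hAδ.trans hδ2)
      have e2 := T.abs_integral_sub_integral_comp_eulerStep_le hst hν hψ hk' hk1 (hAδ.trans hδ2)
      have e3 := ih (by omega) _ ((T.isTestFunction_comp_eulerStep hst hψ (hAδ.trans hδ2)).mono (by
        have : Q * Real.exp (4 * (α 1 - α (t k))) = Qk * Real.exp (4 * A) := by
          rw [hQk, mul_assoc, ← Real.exp_add, hA]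
          ring_nf
        rw [this, ← hAdef]
        gcongr
        linarith [Real.add_one_le_exp (4 * A)]))
      have e4 : (Qk * (Qk + 1) ^ 2 + 4 * Qk ^ 3) * A ^ 2 ≤ C * δ * A := by
        calc _ ≤ C * (δ * A) := by
              rw [pow_two A, hC]
              gcongr
          _ = _ := by ring
      rw [← hAdef] at e1 e2
      have e5 : 2 * C * δ * α (t (k + 1)) = 2 * C * δ * α (t k) + 2 * (C * δ * A) := by
        rw [hA]; ring
      rw [e5]
      rw [abs_le] at *
      constructor <;> linarith [e1.1, e1.2, e2.1, e2.2, e3.1, e3.2]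
  have h1 : t (n + 1) = 1 := by
    simp only [ht]; push_cast; exact div_self hn0.ne'
  have := main (n + 1) le_rfl ψ (by rwa [h1, sub_self, mul_zero, Real.exp_zero, mul_one])
  rwa [h1] at this

theorem integral_eq_of_initial_eq {ψ : W → ℝ} {Q : ℝ} (hψ : IsTestFunction ψ Q) :
    ∫ z, ψ z ∂(μ 1 : Measure W) = ∫ z, ψ z ∂(ν 1 : Measure W) := by
  refine sub_eq_zero.1 (abs_nonpos_iff.1 ?_)
  have h := fun δ => T.abs_integral_sub_integral_le_of_initial_eq hμ hν h0 hψ (δ := δ)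
  generalize 2 * ((Q * Real.exp (4 * ∫ r in (0 : ℝ)..1, a r)) *
        ((Q * Real.exp (4 * ∫ r in (0 : ℝ)..1, a r)) + 1) ^ 2 +
        4 * (Q * Real.exp (4 * ∫ r in (0 : ℝ)..1, a r)) ^ 3) = C at h
  have hlim : Tendsto (fun δ : ℝ => C * δ * ∫ r in (0 : ℝ)..1, a r) (𝓝[>] 0) (𝓝 0) := by
    have : Continuous fun δ : ℝ => C * δ * ∫ r in (0 : ℝ)..1, a r := by fun_prop
    have h := (this.tendsto 0).mono_left (nhdsWithin_le_nhds (s := Ioi 0))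
    simpa using h
  refine ge_of_tendsto hlim ?_
  filter_upwards [self_mem_nhdsWithin, mem_nhdsWithin_of_mem_nhds
    (Iio_mem_nhds (show (0 : ℝ) < 1 / 2 by norm_num))]
    with δ h1 h2 using h δ h1 (le_of_lt h2)

/-- Weak solutions of the continuity equation are determined by their initial value. -/
theorem eq_of_initial_eq : μ 1 = ν 1 := by
  have : ProperSpace W := FiniteDimensional.proper ℝ W
  have r1 : (μ 1 : Measure W).Regular := inferInstance
  have r2 : (ν 1 : Measure W).Regular := inferInstance
  refine Subtype.ext (Measure.ext_of_integral_eq_on_compactlySupported (μ := (μ 1 : Measure W))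
    (ν := (ν 1 : Measure W)) fun f => ?_)
  refine sub_eq_zero.1 (abs_nonpos_iff.1 (le_of_forall_pos_le_add fun η hη => ?_))
  have hfc : Continuous f := f.continuous
  have hfs : HasCompactSupport f := f.hasCompactSupport
  obtain ⟨ε, hε, hfε⟩ := Metric.uniformContinuous_iff.1
    (hfs.uniformContinuous_of_continuous hfc) (η / 2) (by positivity)
  obtain ⟨ρ, hρ0, hρ⟩ := hfs.isBounded.exists_pos_norm_le
  have hz : ∀ z, 2 + ρ ≤ 1 + ‖z‖ → f z = 0 := fun z hz =>
    image_eq_zero_of_notMem_tsupport fun h => by linarith [hρ z h]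
  -- Compactly supported continuous functions determine a measure and are uniformly approximated by
  -- smooth test functions.
  set g := mollify hε f with hg
  have hgs : ContDiff ℝ (⊤ : ℕ∞) g := contDiff_mollify hε hfc
  have hgz : ∀ z, 2 + ρ + ε ≤ 1 + ‖z‖ → g z = 0 := fun z => mollify_eq_zero hε hz
  have hgc : HasCompactSupport g := hasCompactSupport_of_eq_zero hgz
  have htest : ∃ Q, IsTestFunction g Q := by
    have hD : ContDiff ℝ (⊤ : ℕ∞) (fderiv ℝ g) := hgs.fderiv_right (by simp)
    obtain ⟨L, hL⟩ := (hgc.fderiv ℝ).exists_bound_of_continuous hD.continuous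
    obtain ⟨K, hK⟩ := hD.lipschitzWith_of_hasCompactSupport (hgc.fderiv ℝ) (by simp)
    refine ⟨max (max L K) (2 + ρ + ε), hgs.differentiable (by simp), fun z => ?_, fun z z' => ?_,
      fun z hz' => hgz z ((le_max_right _ _).trans hz')⟩
    · exact (hL z).trans ((le_max_left _ _).trans (le_max_left _ _))
    · rw [← dist_eq_norm, ← dist_eq_norm]
      refine (hK.dist_le_mul z z').trans ?_
      gcongr
      exact (le_max_right _ _).trans (le_max_left _ _)
  obtain ⟨Q, hQ⟩ := htest
  have e := T.integral_eq_of_initial_eq hμ hν h0 hQ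
  have hclose : ∀ κ : ProbabilityMeasure W,
      |(∫ z, g z ∂(κ : Measure W)) - ∫ z, f z ∂(κ : Measure W)| ≤ η / 2 := fun κ => by
    rw [← integral_sub (hgs.continuous.integrable_of_hasCompactSupport hgc)
      (hfc.integrable_of_hasCompactSupport hfs), ← Real.norm_eq_abs]
    refine (norm_integral_le_of_norm_le_const (C := η / 2) (Eventually.of_forall fun z => ?_)).trans
      (by rw [probReal_univ, mul_one])
    refine dist_mollify_le hε hfc fun y hy => ?_
    rw [← Real.dist_eq]
    exact (hfε (by rwa [dist_eq_norm])).le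
  have e1 := hclose (μ 1)
  have e2 := hclose (ν 1)
  rw [e] at e1
  rw [zero_add]
  change |∫ z, f z ∂(μ 1 : Measure W) - ∫ z, f z ∂(ν 1 : Measure W)| ≤ η
  rw [abs_le] at *
  constructor <;> linarith [e1.1, e1.2, e2.1, e2.2]

end Uniqueness

end TransportField

/-! ### The flow as solution of the continuity equation -/

section ContinuityEquation

variable {E M : Type*} [NormedAddCommGroup E] [NormedSpace ℝ E] [FiniteDimensional ℝ E]
  [CompleteSpace E] [NormedAddCommGroup M] [NormedSpace ℝ M]
variable {Ω : Type*} [MeasurableSpace Ω] (P : Measure Ω) [IsProbabilityMeasure P]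
variable {v : E → M → E} {c0 c1 c2 : ℝ} (J : VJet v c0 c1 c2) (Ψ : Lp M 2 (stm P))

namespace VJet

/-- The flow of the features, with frozen labels. -/
def labelledFlow (z : E × E) (t : ℝ) : E × E :=
  (J.flow P z.1 Ψ (projIcc 0 1 zero_le_one t), z.2)

theorem continuous_labelledFlow :
    Continuous fun q : (E × E) × ℝ => J.labelledFlow P Ψ q.1 q.2 := by
  have h1 : Continuous fun q : C(I, E) × I => q.1 q.2 := ContinuousEval.continuous_eval
  have h2 : Continuous fun q : (E × E) × ℝ =>
      ((show C(I, E) from J.flow P q.1.1 Ψ), projIcc (0 : ℝ) 1 zero_le_one q.2) :=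
    Continuous.prodMk ((J.continuous_flow P Ψ).comp (continuous_fst.comp continuous_fst))
      (continuous_projIcc.comp continuous_snd)
  exact (h1.comp h2).prodMk (continuous_snd.comp continuous_fst)

/-- By Fubini, the space-time integral defining the flow is a time integral of the velocity averaged
over `Ω`. -/
theorem labelledFlow_eq {U : ℝ → E × E → E × E}
    (hU : ∀ᵐ t, t ∈ Ioo (0 : ℝ) 1 → ∀ z, U t z = (∫ ω, v z.1 (Ψ (t, ω)) ∂P, 0)) (z : E × E) {t : ℝ}
    (ht : t ∈ Icc (0 : ℝ) 1) :
    J.labelledFlow P Ψ z t = z + ∫ r in (0 : ℝ)..t, U r (J.labelledFlow P Ψ z r) := by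
  set X := J.flow P z.1 Ψ with hX
  have hmem : MemLp (fun q => v (X (timeOf q)) (Ψ q)) 1 (stm P) := J.nemOne_v.memLp X Ψ
  have hi : Integrable (fun q => v (X (timeOf q)) (Ψ q)) (stm P) := memLp_one_iff_integrable.1 hmem
  set g : ℝ → E := fun s => ∫ ω, v (X (timeOf (s, ω))) (Ψ (s, ω)) ∂P with hg
  have hgi : IntervalIntegrable g volume 0 t := by
    have h1 : IntegrableOn g (Ioo 0 1) := hi.integral_prod_left
    rw [intervalIntegrable_iff_integrableOn_Ioo_of_le ht.1]
    exact h1.mono_set (Ioo_subset_Ioo_right ht.2)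
  have h1 : X (projIcc 0 1 zero_le_one t) = z.1 + ∫ r in (0 : ℝ)..t, g r := by
    have h2 : X (projIcc 0 1 zero_le_one t) = (Traj.const z.1 + cumul P (nem P 1 v X Ψ))
      (projIcc 0 1 zero_le_one t) := by rw [hX, ← J.flow_eq P z.1 Ψ]
    rw [h2, Traj.add_apply, Traj.const_apply, cumul_apply, projIcc_of_mem zero_le_one ht,
      ← setIntegral_stm_eq P hi ht]
    congr 1
    exact integral_congr_ae (ae_restrict_of_ae (J.nemOne_v.coeFn X Ψ))
  have h3 : ∫ r in (0 : ℝ)..t, U r (J.labelledFlow P Ψ z r) =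
      ∫ r in (0 : ℝ)..t, ContinuousLinearMap.inl ℝ E E (g r) := by
    rw [intervalIntegral.integral_of_le ht.1, intervalIntegral.integral_of_le ht.1,
      integral_Ioc_eq_integral_Ioo, integral_Ioc_eq_integral_Ioo]
    refine setIntegral_congr_ae measurableSet_Ioo ?_
    filter_upwards [hU] with r hr hr'
    rw [hr ⟨hr'.1, hr'.2.trans_le ht.2⟩]
    rfl
  rw [h3, ContinuousLinearMap.intervalIntegral_comp_comm _ hgi, ContinuousLinearMap.inl_apply,
    labelledFlow, ← hX, h1]
  ext <;> simp

end VJet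

end ContinuityEquation

/-! ### The lifted objective in terms of the flow -/

section Objective

variable {d m : ℕ} {Ω : Type*} [MeasurableSpace Ω] {P : Measure Ω} [IsProbabilityMeasure P]
  {v : Eucl d → Eucl m → Eucl d} {c0 c1 c2 : ℝ} (J : VJet v c0 c1 c2)

include J in
theorem ae_meanField_lawCurve (Θ : ParamSpace P m) : ∀ᵐ t, t ∈ Ioo (0 : ℝ) 1 → ∀ x,
    meanField v (lawCurve Θ t) x = ∫ ω, v x (uncurryL P m Θ (t, ω)) ∂P := by
  have h := isUncurrying_uncurryL Θ
  rw [IsUncurrying, ae_restrict_iff' measurableSet_Ioo] at h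
  filter_upwards [h] with t ht ht' x
  have hc : Continuous (v x) := J.cont_v.comp (Continuous.prodMk_right x)
  rw [meanField, lawCurve, integral_map (Lp.aestronglyMeasurable _).aemeasurable
    hc.aestronglyMeasurable]
  refine integral_congr_ae ?_
  filter_upwards [ht ht'] with ω hω
  rw [hω]

variable {Y : Set (Eucl d)} {μ₀ : ProbabilityMeasure (Eucl d × Eucl d)} {Θ : ParamSpace P m}
  {U : ℝ → Eucl d × Eucl d → Eucl d × Eucl d}

include J in
theorem weak_integrand_ae_eq
    (hU : ∀ᵐ t, t ∈ Ioo (0 : ℝ) 1 → ∀ z, U t z = (∫ ω, v z.1 (uncurryL P m Θ (t, ω)) ∂P, 0))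
    (μ : ℝ → Measure (Eucl d × Eucl d)) (φ : ℝ × (Eucl d × Eucl d) → ℝ) :
    ∫ t in Ioo (0 : ℝ) 1, ∫ z, (fderiv ℝ φ (t, z) (1, (0, 0))
      + fderiv ℝ φ (t, z) (0, (meanField v (lawCurve Θ t) z.1, 0))) ∂(μ t) =
    ∫ t in Ioo (0 : ℝ) 1, ∫ z, (fderiv ℝ φ (t, z) (1, 0) + fderiv ℝ φ (t, z) (0, U t z)) ∂(μ t) := by
  refine setIntegral_congr_ae measurableSet_Ioo ?_
  filter_upwards [hU, ae_meanField_lawCurve J Θ] with t h1 h2 ht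
  refine integral_congr_ae (Eventually.of_forall fun z => ?_)
  simp only [h1 ht, h2 ht]
  rfl

variable {a : ℝ → ℝ}

include J in
theorem IsContinuityEqSolution.isWeakSolution {μ : ℝ → ProbabilityMeasure (Eucl d × Eucl d)}
    (h : IsContinuityEqSolution Y v μ₀ (lawCurve Θ) μ)
    (hU : ∀ᵐ t, t ∈ Ioo (0 : ℝ) 1 → ∀ z, U t z = (∫ ω, v z.1 (uncurryL P m Θ (t, ω)) ∂P, 0)) :
    IsWeakSolution U μ :=
  ⟨h.continuousOn, fun φ h1 h2 h3 =>
    (weak_integrand_ae_eq J hU (fun t => μ t) φ).symm.trans (h.weak_eq φ h1 h2 h3)⟩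

/-- The curve of laws transported by the flow. -/
def transportedLaw (μ₀ : ProbabilityMeasure (Eucl d × Eucl d)) (Θ : ParamSpace P m) (t : ℝ) :
    ProbabilityMeasure (Eucl d × Eucl d) :=
  μ₀.map (f := fun z => J.labelledFlow P (uncurryL P m Θ) z t)
    ((J.continuous_labelledFlow P _).comp (Continuous.prodMk_left t)).aemeasurable

theorem isContinuityEqSolution_transportedLaw (hY : IsClosed Y)
    (hμ₀ : (μ₀ : Measure (Eucl d × Eucl d)) (univ ×ˢ Y)ᶜ = 0) (Θ : ParamSpace P m) :
    IsContinuityEqSolution Y v μ₀ (lawCurve Θ) (transportedLaw J μ₀ Θ) := by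
  set Ψ := uncurryL P m Θ with hΨ
  have hγc := J.continuous_labelledFlow P Ψ
  have hγt : ∀ t, Continuous fun z => J.labelledFlow P Ψ z t := fun t =>
    hγc.comp (Continuous.prodMk_left t)
  obtain ⟨U, a, ⟨T⟩, hU⟩ := J.exists_transportField Ψ
  have hγ := fun z t (ht : t ∈ Icc (0 : ℝ) 1) => J.labelledFlow_eq P Ψ hU z ht
  refine ⟨(TransportField.continuous_map_curve hγc μ₀).continuousOn, fun t _ => ?_, ?_,
    fun φ h1 h2 h3 => ?_⟩
  · have hm : MeasurableSet ((univ : Set (Eucl d)) ×ˢ Y)ᶜ :=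
      (MeasurableSet.univ.prod hY.measurableSet).compl
    change (Measure.map _ (μ₀ : Measure (Eucl d × Eucl d))) _ = 0
    rw [Measure.map_apply (hγt t).measurable hm, ← hμ₀]
    congr 1
  · refine Subtype.ext ?_
    change Measure.map _ (μ₀ : Measure (Eucl d × Eucl d)) = _
    have : (fun z => J.labelledFlow P Ψ z 0) = id := funext fun z => by
      rw [hγ z 0 (by simp), intervalIntegral.integral_same, add_zero, id]
    rw [this, Measure.map_id]
    rfl
  · rw [weak_integrand_ae_eq J hU]
    exact T.weak_eq_map hγc hγ h1 h2 h3 μ₀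

/-- The loss is defined through an arbitrarily chosen solution; uniqueness at time one identifies it
with the transported law. The loss is continuous only on `univ ×ˢ Y`, so its measurability uses that
this set carries the law. -/
theorem lossFunctional_lawCurve {l : Eucl d → Eucl d → ℝ} (hY : IsClosed Y)
    (hl : ContinuousOn (fun z : Eucl d × Eucl d => l z.1 z.2) (univ ×ˢ Y))
    (hμ₀ : (μ₀ : Measure (Eucl d × Eucl d)) (univ ×ˢ Y)ᶜ = 0) (Θ : ParamSpace P m) :
    lossFunctional Y v l μ₀ (lawCurve Θ) = J.meanLoss P μ₀ l (uncurryL P m Θ) := by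
  set Ψ := uncurryL P m Θ with hΨ
  have hsol := isContinuityEqSolution_transportedLaw J hY hμ₀ Θ
  have hex : ∃ μ, IsContinuityEqSolution Y v μ₀ (lawCurve Θ) μ := ⟨_, hsol⟩
  obtain ⟨U, a, ⟨T⟩, hU⟩ := J.exists_transportField Ψ
  have h1 : hex.choose 1 = transportedLaw J μ₀ Θ 1 :=
    T.eq_of_initial_eq (hex.choose_spec.isWeakSolution J hU) (hsol.isWeakSolution J hU)
      (hex.choose_spec.initial.trans hsol.initial.symm)
  have hm : MeasurableSet ((univ : Set (Eucl d)) ×ˢ Y) :=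
    MeasurableSet.univ.prod hY.measurableSet
  have hlm : AEStronglyMeasurable (fun z : Eucl d × Eucl d => l z.1 z.2)
      (transportedLaw J μ₀ Θ 1 : Measure (Eucl d × Eucl d)) := by
    have h2 := hl.aestronglyMeasurable (μ := (transportedLaw J μ₀ Θ 1 : Measure _)) hm
    rwa [Measure.restrict_eq_self_of_ae_mem] at h2
    exact measure_eq_zero_iff_ae_notMem.1 (hsol.carried 1 (by simp)) |>.mono
      fun z hz => not_not.1 hz
  rw [lossFunctional, dif_pos hex, h1]
  refine (integral_map ((J.continuous_labelledFlow P Ψ).comp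
    (Continuous.prodMk_left 1)).aemeasurable hlm).trans ?_
  simp only [VJet.labelledFlow, VJet.meanLoss, Function.comp_apply, projIcc_right]
  rfl

theorem integral_norm_sq_lawCurve (Θ : ParamSpace P m) :
    ∫ t in Ioo (0 : ℝ) 1, ∫ θ, ‖θ‖ ^ 2 ∂(lawCurve Θ t) = ‖Θ‖ ^ 2 := by
  rw [← Lp.integral_norm_sq Θ]
  refine integral_congr_ae (Eventually.of_forall fun t => ?_)
  simp only [lawCurve]
  rw [integral_map (Lp.aestronglyMeasurable _).aemeasurable (by fun_prop), Lp.integral_norm_sq]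

theorem liftedObjective_eq {l : Eucl d → Eucl d → ℝ} (hY : IsClosed Y)
    (hl : ContinuousOn (fun z : Eucl d × Eucl d => l z.1 z.2) (univ ×ˢ Y))
    (hμ₀ : (μ₀ : Measure (Eucl d × Eucl d)) (univ ×ˢ Y)ᶜ = 0) (lam : ℝ) (Θ : ParamSpace P m) :
    liftedObjective Y v l μ₀ lam P Θ =
      J.meanLoss P μ₀ l (uncurryL P m Θ) + lam / 2 * ‖Θ‖ ^ 2 := by
  rw [liftedObjective, objective, lossFunctional_lawCurve J hY hl hμ₀, integral_norm_sq_lawCurve]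

end Objective

end

/-! ### The main theorem -/

theorem mainTheorem7 {d : ℕ} (Y : Set (Eucl d)) (hY : IsCompact Y)
    (l : Eucl d → Eucl d → ℝ) (hl : IsAdmissibleLoss Y l)
    (μ₀ : MeasureTheory.ProbabilityMeasure (Eucl d × Eucl d))
    (hμ₀ : ∃ K : Set (Eucl d × Eucl d), IsCompact K ∧ K ⊆ Set.univ ×ˢ Y ∧
      (μ₀ : MeasureTheory.Measure (Eucl d × Eucl d)) Kᶜ = 0)
    (lam : ℝ) (hlam : 0 < lam) (B₀ R : ℝ) :
    ∃ c : ℝ, 0 < c ∧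
      ∀ (m : ℕ) (v : Eucl d → Eucl m → Eucl d) (p : ℝ) (C : ℕ → ℝ),
        HasBoundedDerivatives v p C → C 0 ≤ B₀ →
      ∀ (Ω : Type*) [MeasurableSpace Ω] (P : MeasureTheory.Measure Ω)
        [MeasureTheory.IsProbabilityMeasure P] (Θ : ParamSpace P m),
        ∃ A : ParamSpace P m →L[ℝ] ParamSpace P m,
          HasHessianAt (liftedObjective Y v l μ₀ lam P) A Θ ∧
          (C 2 < c → ‖Θ‖ ≤ R → A.IsFredholm) := by
  obtain ⟨K, hK, hKS, hK0⟩ := hμ₀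
  have hμK : ∀ᵐ z ∂(μ₀ : Measure (Eucl d × Eucl d)), z ∈ K :=
    (measure_eq_zero_iff_ae_notMem.1 hK0).mono fun z hz => not_not.1 hz
  have hμY : (μ₀ : Measure (Eucl d × Eucl d)) (univ ×ˢ Y)ᶜ = 0 :=
    measure_mono_null (compl_subset_compl.2 hKS) hK0
  let L : LossJet l Y := LossJet.ofAnalyticOn hl.analytic
  obtain ⟨ρ, hρ0, hρ⟩ := hK.isBounded.exists_pos_norm_le
  have hρ1 : ∀ z ∈ K, ‖z.1‖ ≤ ρ := fun z hz => (norm_fst_le z).trans (hρ z hz)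
  have hbound : ∀ r : ℝ, ∃ Λ : ℝ, 0 ≤ Λ ∧ ∀ z ∈ K, ∀ x, ‖x‖ ≤ r → ‖L.l1 x z.2‖ ≤ Λ := fun r => by
    obtain ⟨Λ, hΛ0, hΛ⟩ :=
      exists_bound_of_continuousOn_prod (f := L.l1) L.cont_l1 hY subset_rfl r
    exact ⟨Λ, hΛ0, fun z hz x hx => hΛ x hx z.2 (hKS hz).2⟩
  -- `e` bounds both exponentials of `VJet.exists_meanHessMul` when `C 0 ≤ B₀` and `‖Θ‖ ≤ R`.
  -- Neither it nor `Λ` depends on `m`, `v` or `Θ`.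
  set e : ℝ := 2 * Real.exp (2 * (2 * |B₀| * (1 + R ^ 2))) with he
  obtain ⟨Λ, hΛ0, hΛ⟩ := hbound (e * (1 + ρ))
  -- The multiplication part has norm at most `C 2` times `Λ e · e (1 + ρ)`; the added `1` keeps the
  -- denominator positive when `Λ = 0`.
  refine ⟨lam / (Λ * e * (e * (1 + ρ)) + 1), by positivity, ?_⟩
  intro m v p C hv hC0 Ω _ P _ Θ
  obtain ⟨J⟩ := hv.nonempty_vjet
  set Ψ := uncurryL P m Θ with hΨ
  -- The Hessian must exist for every `Θ`, also beyond radius `R`, so a bound `Λ'` depending on `Θ`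
  -- is used here.
  obtain ⟨Λ', hΛ0', hΛ'⟩ := hbound (2 * Real.exp (2 * (C 0 * (1 + ‖Ψ‖ ^ 2))) * (1 + ρ))
  obtain ⟨N, hN, -⟩ := J.exists_meanHessMul P L Ψ μ₀ hK hKS hμK hρ0.le hρ1 hΛ0' hΛ'
  obtain ⟨A, hA, hAF⟩ := exists_hasHessianAt (uncurryL P m) norm_uncurryL_le hlam
    (liftedObjective_eq J hY.isClosed L.cont_l hμY lam)
    (fun Ψ => J.hasFDerivAt_meanLoss P L Ψ μ₀ hK hKS hμK) Θ
    (K := J.meanHessCompact P L Ψ μ₀) (N := N)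
    (fun Φ => by rw [hN]; exact J.hasDerivAt_dMeanLoss P L Ψ μ₀ hK hKS hμK Φ)
    (J.meanHessCompact_mem_finiteRankClosure P L Ψ μ₀ hK hKS hμK)
  refine ⟨A, hA, fun hC2 hR => hAF ?_⟩
  have hΨR : ‖Ψ‖ ^ 2 ≤ R ^ 2 := by
    have : ‖Ψ‖ ≤ R := ((isUncurrying_uncurryL Θ).norm_eq).trans_le hR
    gcongr
  have p0 := (hv.C_pos 0).le
  have p2 := (hv.C_pos 2).le
  have hB : C 0 ≤ |B₀| := hC0.trans (le_abs_self _)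
  have he1 : 2 * Real.exp (2 * (2 * C 0 * (1 + ‖Ψ‖ ^ 2))) ≤ e := by
    rw [he]
    gcongr
  have he2 : 2 * Real.exp (2 * (C 0 * (1 + ‖Ψ‖ ^ 2))) ≤ e := by
    refine le_trans ?_ he1
    gcongr
    linarith
  -- For `‖Θ‖ ≤ R` the same operator is obtained with the uniform `Λ`; both versions are given by
  -- the same integrals, so they agree and inherit the uniform bound.
  obtain ⟨N', hN', hN'le⟩ := J.exists_meanHessMul P L Ψ μ₀ hK hKS hμK hρ0.le hρ1 hΛ0
    (fun z hz x hx => hΛ z hz x (hx.trans (by gcongr)))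
  have hNN : N = N' := ContinuousLinearMap.ext fun Φ => (hN Φ).trans (hN' Φ).symm
  rw [hNN]
  have e0 : 0 ≤ e := by positivity
  have hD : 0 ≤ Λ * e * (e * (1 + ρ)) := by positivity
  calc ‖N'‖ ≤ Λ * e * (C 2 * (e * (1 + ρ))) := hN'le.trans (by gcongr)
    _ = C 2 * (Λ * e * (e * (1 + ρ))) := by ring
    _ ≤ C 2 * (Λ * e * (e * (1 + ρ)) + 1) := by gcongr; linarith
    _ < lam := (lt_div_iff₀ (by positivity)).1 hC2
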